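/- Let $A$ be a Hilbert space of finite dimension $d_A\ge 1$ and let $B_1,\dots,B_n$ be Hilbert spaces of arbitrary (possibly infinite) dimension. Write $\mathcal D(X)$ for the set of density operators on $X$. Let $\Lambda:\mathcal D(A)\to\mathcal D(B_1\otimes\cdots\otimes B_n)$ be a completely positive trace-preserving linear map, and let $1\le t\le n$. For every subset $S_t\subseteq[n]=\{1,\dots,n\}$ with $t$ elements, let $\Lambda_{S_t}:=\mathrm{tr}_{\backslash \cup_{l\in S_t}B_l}\circ\Lambda$ be the effective channel from $\mathcal D(A)$ to $\mathcal D(\bigotimes_{l\in S_t}B_l)$ obtained by tracing out all $B_l$ with $l\notin S_t$. Then for every $\delta>0$ there exists a finite measurement (POVM) $\{M_k\}_k$ on $A$ ($M_k\ge 0$, $\sum_k M_k=I$) such that for more than a $(1-\delta)$ fraction of the $t$-element subsets $S_t\subseteq[n]$ there are states $\sigma_{S_t,k}\in\mathcal D(\bigotimes_{l\in S_t}B_l)$ with $$\left\Vert \Lambda_{S_t}-\mathcal E_{S_t}\right\Vert_{\Diamond}\le\left(\frac{27\,\ln(2)\,d_A^6\,\log_2(d_A)\,t}{n\,\delta^3}\right)^{1/3},\qquad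 \mathcal E_{S_t}(X):=\sum_k\mathrm{tr}(M_kX)\,\sigma_{S_t,k}.$$ Here $\Vert\Phi\Vert_\Diamond=\sup_{X\neq0}\Vert(\Phi\otimes\mathrm{id})(X)\Vert_1/\Vert X\Vert_1$ is the diamond norm (the supremum also ranges over all finite-dimensional ancillas), and $\Vert X\Vert_1=\mathrm{tr}((X^\dagger X)^{1/2})$ is the trace norm. -/

import Mathlib

open scoped Matrix ComplexOrder MatrixOrder ENNReal

/-! Operators on the Hilbert space `ℓ²(ι)` (`ι` an arbitrary, possibly infinite, index set of an
orthonormal basis) are described by their matrices `Matrix ι ι ℂ` in the standard basis. The tensor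
product of the spaces `ℓ²(β j)`, `j ∈ S`, is `ℓ²` of the product index set `∀ j : S, β j`. -/

open Classical in
/-- The trace norm `tr ((X† X)^(1/2))` of a finite square matrix. -/
noncomputable def finTraceNorm {ι : Type*} [Fintype ι] (X : Matrix ι ι ℂ) : ℝ :=
  (CFC.sqrt (Xᴴ * X)).trace.re

/-- The trace norm of a (possibly infinite) square matrix, as an extended nonnegative number:
the supremum of the trace norms of its finite principal blocks `P X P`. It is `⊤` exactly when `X`
is not the matrix of a trace class operator; for a finite index set the supremum is attained at the
whole matrix. -/
noncomputable def traceNorm {ι : Type*} (X : Matrix ι ι ℂ) : ℝ≥0∞ :=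
  ⨆ F : Finset ι,
    ENNReal.ofReal (finTraceNorm (X.submatrix (Subtype.val : F → ι) (Subtype.val : F → ι)))

/-- Density matrices on `ℓ²(ι)`: positive semidefinite with trace one. -/
def IsDensity {ι : Type*} (ρ : Matrix ι ι ℂ) : Prop :=
  ρ.PosSemidef ∧ HasSum (fun i => ρ i i) 1

/-- `Φ ⊗ id_r` for a map `Φ` from operators on `ℂ^d` to operators on `ℓ²(ι)`, where `id_r` is the
identity on `r × r` matrices: `Φ` is applied to each `d × d` block of `X`. -/
def ampliation {d : ℕ} {ι : Type*} (Φ : Matrix (Fin d) (Fin d) ℂ → Matrix ι ι ℂ) (r : ℕ)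
    (X : Matrix (Fin d × Fin r) (Fin d × Fin r) ℂ) : Matrix (ι × Fin r) (ι × Fin r) ℂ :=
  Matrix.of fun x y => Φ (Matrix.of fun p q => X (p, x.2) (q, y.2)) x.1 y.1

/-- Quantum channels (completely positive trace-preserving linear maps) from operators on `ℂ^d` to
trace class operators on `ℓ²(ι)`. -/
structure IsChannel {d : ℕ} {ι : Type*}
    (Λ : Matrix (Fin d) (Fin d) ℂ →ₗ[ℂ] Matrix ι ι ℂ) : Prop where
  completelyPositive : ∀ (r : ℕ) (X : Matrix (Fin d × Fin r) (Fin d × Fin r) ℂ),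
    X.PosSemidef → (ampliation Λ r X).PosSemidef
  tracePreserving : ∀ X : Matrix (Fin d) (Fin d) ℂ, HasSum (fun i => Λ X i i) X.trace

/-- The diamond norm `sup_X ‖(Φ ⊗ id)(X)‖₁ / ‖X‖₁`, the supremum being over nonzero operators `X` on
`ℂ^d ⊗ ℂ^r` for all finite dimensions `r` of the ancilla. -/
noncomputable def diamondNorm {d : ℕ} {ι : Type*}
    (Φ : Matrix (Fin d) (Fin d) ℂ → Matrix ι ι ℂ) : ℝ≥0∞ :=
  ⨆ (r : ℕ) (X : Matrix (Fin d × Fin r) (Fin d × Fin r) ℂ) (_ : X ≠ 0),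
    traceNorm (ampliation Φ r X) / traceNorm X

/-- The partial trace over all tensor factors except those in `S`. The index
`(Equiv.piEquivPiSubtypeProd _ β).symm (x, z)` is the one which equals `x` on `S` and `z` off `S`. -/
noncomputable def partialTrace {n : ℕ} {β : Fin n → Type*} (S : Finset (Fin n))
    (X : Matrix (∀ j, β j) (∀ j, β j) ℂ) : Matrix (∀ j : S, β j) (∀ j : S, β j) ℂ :=
  Matrix.of fun x y => ∑' z : (∀ j : {j // j ∉ S}, β j),
    X ((Equiv.piEquivPiSubtypeProd (· ∈ S) β).symm (x, z))
      ((Equiv.piEquivPiSubtypeProd (· ∈ S) β).symm (y, z))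

/-- A measurement on `ℂ^d` with outcomes `k : Fin K`. -/
def IsPOVM {d K : ℕ} (M : Fin K → Matrix (Fin d) (Fin d) ℂ) : Prop :=
  (∀ k, (M k).PosSemidef) ∧ ∑ k, M k = 1

/-- The measure-and-prepare map `X ↦ ∑ k, tr (M k X) σ k`. -/
noncomputable def measurePrepare {d K : ℕ} {ι : Type*} (M : Fin K → Matrix (Fin d) (Fin d) ℂ)
    (σ : Fin K → Matrix ι ι ℂ) (X : Matrix (Fin d) (Fin d) ℂ) : Matrix ι ι ℂ :=
  ∑ k, (M k * X).trace • σ k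

/-! Measuring some of the output factors and conditioning on the outcomes turns `Λ` into positive
maps Ψ. The effect E of Ψ, with tr(E X) = tr Ψ(X), records what the outcome reveals about the input;
the coordinates of E/w, w = tr E, in an orthonormal basis of Hermitian matrices H_p are the
posterior of Ψ. For a set S of factors, Ψ is of measure-and-prepare form on S up to its defect, the
marginal on S of Ψ(X) minus tr(E X)/w times the marginal on S of Ψ(1).

Suppose that the defects, summed over the outcomes so far, have large trace norm at some H_p. The
projection onto the positive part of this Hermitian matrix is then a measurement on S, and the
pairing of a defect with it is the new weight times the movement of the posterior
(`blockPairing_defect`). So a large defect forces the posteriors to move. But they form a martingale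
in the unit ball: the potential ∑ w ‖posterior‖² grows by exactly the weighted squared movement and
never exceeds the weight d of `Λ`. If m random disjoint t-sets are measured in turn, some round
gains at most d/m on average, and by Cauchy-Schwarz the mean movement in it is at most d/√m
(`exists_small_gain`, `sum_increment_le`). Summed over d² basis elements, the mean defect on a fresh
random S is at most d³/√m, up to an arbitrarily small ε.

This uses only outcomes of measurements that avoid S, whereas one POVM has to serve for all S.
Outcomes are therefore grouped into cells on which each coordinate of the posterior is constant up
to 1/k. The operator of a cell averages the effects of all outcomes in it; the state prepared on S
averages only those outcomes that leave S unmeasured. Besides the defect there are two errors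
(`partialTrace_sub_cells`): the spread inside the cells, at most d²/k, and the change in the law of
the cell when S is required to be unmeasured.

The last error is an entropy estimate. The probability h(J) of a cell, given that J is unmeasured,
is harmonic: h(J) is the mean of h(J ∪ {a}) over a outside J. Convexity makes the mean of h log h
over the sets of size l a convex function of l, and it is at most 0 on the last level r, the number
of unmeasured factors. Hence the mean relative entropy of the law at a t-set with respect to the law
at ∅ is at most t/r times the entropy of the cell, so at most (t/r) d² log(2k+1), and Pinsker's
inequality bounds the ℓ¹ distance (`IsHarmonic.sum_abs_sub_le`).

With m near n/(2t) the mean error is below ηδ, η being the claimed bound, and Markov's inequality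
concludes. The numerical estimates need η < 2(1 - 1/d); for larger η a measurement in the standard
basis is good enough for every S. Infinite dimension enters mildly: each measurement is a projection
on a finite block of basis vectors, with one more outcome for being off the block. -/

section FiniteTraceNorm

/-! ### Trace norm of finite matrices: polar decomposition and duality with the operator norm. -/

open scoped Matrix.Norms.L2Operator

variable {ι κ : Type*} [Fintype ι] [DecidableEq ι] [Fintype κ] [DecidableEq κ]

theorem Matrix.norm_apply_le_l2_opNorm (A : Matrix ι ι ℂ) (i j : ι) : ‖A i j‖ ≤ ‖A‖ := by
  have h := Matrix.l2_opNorm_mulVec A (EuclideanSpace.single j (1 : ℂ))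
  have h2 := PiLp.norm_apply_le
    ((EuclideanSpace.equiv ι ℂ).symm (A *ᵥ (EuclideanSpace.single j (1 : ℂ)).ofLp)) i
  refine le_trans ?_ (le_trans h2 (le_trans h ?_))
  · simp [Matrix.mulVec_single]
  · simp

/-- In an eigenbasis of A the trace is the sum of the diagonal entries of a rotated contraction,
weighted by the eigenvalues. -/
theorem Matrix.PosSemidef.norm_trace_mul_le {A : Matrix ι ι ℂ} (hA : A.PosSemidef)
    {C : Matrix ι ι ℂ} (hC : ‖C‖ ≤ 1) : ‖(C * A).trace‖ ≤ A.trace.re := by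
  set U : Matrix ι ι ℂ := (hA.1.eigenvectorUnitary : Matrix ι ι ℂ) with hU
  have hUm := hA.1.eigenvectorUnitary.2
  have hsp : A = U * Matrix.diagonal (fun i => (hA.1.eigenvalues i : ℂ)) * star U := by
    conv_lhs => rw [hA.1.spectral_theorem, Unitary.conjStarAlgAut_apply]
    rfl
  have hUn : ‖U‖ ≤ 1 := by
    have h1 : ‖star U * U‖ = ‖U‖ * ‖U‖ := CStarRing.norm_star_mul_self
    rw [(Unitary.mem_iff.mp hUm).1] at h1
    have h2 : ‖(1 : Matrix ι ι ℂ)‖ ≤ 1 := by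
      rw [← Matrix.diagonal_one, Matrix.l2_opNorm_diagonal]
      exact (pi_norm_le_iff_of_nonneg zero_le_one).2 (by simp)
    nlinarith [norm_nonneg U]
  have hM : ‖star U * C * U‖ ≤ 1 := by
    have h1 : ‖star U‖ ≤ 1 := by
      rwa [Matrix.star_eq_conjTranspose, Matrix.l2_opNorm_conjTranspose]
    have h2 : ‖star U * C‖ ≤ 1 :=
      (norm_mul_le (star U) C).trans (mul_le_one₀ h1 (norm_nonneg C) hC)
    exact (norm_mul_le (star U * C) U).trans (mul_le_one₀ h2 (norm_nonneg U) hUn)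
  have ht : (C * A).trace = ∑ i, (star U * C * U) i i * (hA.1.eigenvalues i : ℂ) := by
    conv_lhs => rw [hsp, ← mul_assoc, Matrix.trace_mul_comm, ← mul_assoc, ← mul_assoc]
    simp only [Matrix.trace, Matrix.diag, Matrix.mul_diagonal]
  rw [ht, hA.1.trace_eq_sum_eigenvalues]
  refine (norm_sum_le _ _).trans ?_
  rw [Complex.re_sum]
  refine Finset.sum_le_sum fun i _ => ?_
  rw [norm_mul]
  have h0 := hA.eigenvalues_nonneg i
  have h1 : ‖(hA.1.eigenvalues i : ℂ)‖ = hA.1.eigenvalues i := by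
    rw [Complex.norm_real, Real.norm_of_nonneg h0]
  rw [h1]
  have h2 := (Matrix.norm_apply_le_l2_opNorm (star U * C * U) i i).trans hM
  calc _ ≤ 1 * hA.1.eigenvalues i := by gcongr
    _ = _ := by simp

theorem Matrix.continuousOn_real_spectrum (A : Matrix ι ι ℂ) (f : ℝ → ℝ) :
    ContinuousOn f (spectrum ℝ A) := A.finite_real_spectrum.continuousOn f

/-- V = X Q, where Q is the pseudo-inverse of |X| given by the functional calculus. -/
theorem Matrix.exists_polar (X : Matrix ι ι ℂ) :
    ∃ V : Matrix ι ι ℂ, ‖V‖ ≤ 1 ∧ V * CFC.abs X = X ∧ Vᴴ * X = CFC.abs X := by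
  set A := CFC.abs X with hA
  have hAsa : IsSelfAdjoint A := (CFC.abs_nonneg X).isSelfAdjoint
  have hAA : A * A = star X * X := CFC.abs_mul_abs X
  -- The convention 0⁻¹ = 0 makes this the pseudo-inverse, so that Q A is the projection onto the
  -- range of A.
  set Q := cfc (fun x : ℝ => x⁻¹) A with hQ
  have hQs : star Q = Q := (cfc_predicate (R := ℝ) (fun x : ℝ => x⁻¹) A : IsSelfAdjoint Q)
  have cf := Matrix.continuousOn_real_spectrum A
  have hid : cfc (fun x : ℝ => x) A = A := cfc_id' ℝ A hAsa
  have hQA : Q * A = cfc (fun x : ℝ => x⁻¹ * x) A := by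
    rw [cfc_mul _ _ A (cf _) (cf _), hid]
  have hAQA : A * (Q * A) = A := by
    rw [hQA]
    nth_rw 1 [← hid]
    rw [← cfc_mul _ _ A (cf _) (cf _)]
    conv_rhs => rw [← hid]
    refine cfc_congr fun x _ => ?_
    by_cases hx : x = 0
    · simp [hx]
    · field_simp
  have hcomm : A * Q = Q * A := by
    rw [hQA]
    nth_rw 1 [← hid]
    rw [← cfc_mul _ _ A (cf _) (cf _)]
    exact cfc_congr fun x _ => mul_comm _ _
  have hXX : X * (Q * A) = X := by
    -- X vanishes on the kernel of A, because X†X = A².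
    have h0 : star (X - X * (Q * A)) * (X - X * (Q * A)) = 0 := by
      have hs : star (Q * A) = Q * A := by rw [star_mul, hQs, hAsa.star_eq, hcomm]
      have : star (X - X * (Q * A)) * (X - X * (Q * A))
          = star X * X - star X * X * (Q * A) - Q * A * (star X * X)
            + Q * A * (star X * X) * (Q * A) := by
        rw [star_sub, star_mul, hs]; noncomm_ring
      rw [this, ← hAA]
      have e1 : A * A * (Q * A) = A * A := by rw [mul_assoc, hAQA]
      have e2 : Q * A * (A * A) = A * A := by
        rw [← hcomm]
        calc A * Q * (A * A) = (A * (Q * A)) * A := by noncomm_ring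
          _ = A * A := by rw [hAQA]
      rw [e1, e2, e1]; abel
    have := (CStarRing.star_mul_self_eq_zero_iff _).1 h0
    exact (sub_eq_zero.1 this).symm
  refine ⟨X * Q, ?_, by rw [mul_assoc, hXX], ?_⟩
  · have h1 : ‖star (X * Q) * (X * Q)‖ = ‖X * Q‖ * ‖X * Q‖ := CStarRing.norm_star_mul_self
    have h2 : star (X * Q) * (X * Q) = cfc (fun x : ℝ => x⁻¹ * x * (x⁻¹ * x)) A := by
      rw [star_mul, hQs]
      calc Q * star X * (X * Q) = Q * (star X * X) * Q := by noncomm_ring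
        _ = (Q * A) * (A * Q) := by rw [← hAA]; noncomm_ring
        _ = _ := by rw [hcomm, hQA, ← cfc_mul _ _ A (cf _) (cf _)]
    have h3 : ‖star (X * Q) * (X * Q)‖ ≤ 1 := by
      rw [h2]
      refine norm_cfc_le zero_le_one fun x _ => ?_
      by_cases hx : x = 0
      · simp [hx]
      · simp [hx]
    nlinarith [norm_nonneg (X * Q)]
  · rw [Matrix.conjTranspose_mul, ← Matrix.star_eq_conjTranspose, hQs,
      ← Matrix.star_eq_conjTranspose, mul_assoc, ← hAA, ← mul_assoc, ← hcomm, mul_assoc, hAQA]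

theorem finTraceNorm_eq (X : Matrix ι ι ℂ) : finTraceNorm X = (CFC.abs X).trace.re := by
  unfold finTraceNorm CFC.abs
  rw [Matrix.star_eq_conjTranspose]

theorem norm_trace_mul_le_finTraceNorm (X : Matrix ι ι ℂ) {U : Matrix ι ι ℂ} (hU : ‖U‖ ≤ 1) :
    ‖(U * X).trace‖ ≤ finTraceNorm X := by
  obtain ⟨V, hV, hVX, -⟩ := X.exists_polar
  rw [finTraceNorm_eq]
  conv_lhs => rw [← hVX, ← mul_assoc]
  refine Matrix.PosSemidef.norm_trace_mul_le
    (Matrix.nonneg_iff_posSemidef.1 (CFC.abs_nonneg X)) ?_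
  calc _ ≤ ‖U‖ * ‖V‖ := norm_mul_le _ _
    _ ≤ 1 * 1 := by gcongr
    _ = 1 := one_mul 1

/-- With `norm_trace_mul_le_finTraceNorm` this is the duality of trace norm and operator norm. Most
inequalities for the trace norm below are proved by testing against a contraction U and moving the
other factors onto U by cyclicity. -/
theorem exists_trace_mul_eq_finTraceNorm (X : Matrix ι ι ℂ) :
    ∃ U : Matrix ι ι ℂ, ‖U‖ ≤ 1 ∧ (U * X).trace = finTraceNorm X := by
  obtain ⟨V, hV, -, hVX⟩ := X.exists_polar
  refine ⟨Vᴴ, by rwa [Matrix.l2_opNorm_conjTranspose], ?_⟩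
  rw [hVX, finTraceNorm_eq]
  have h := (Matrix.nonneg_iff_posSemidef.1 (CFC.abs_nonneg X)).trace_nonneg
  exact Complex.ext rfl (by simpa using ((Complex.le_def.1 h).2).symm)

theorem finTraceNorm_le_of_forall {X : Matrix ι ι ℂ} {c : ℝ}
    (h : ∀ U : Matrix ι ι ℂ, ‖U‖ ≤ 1 → ‖(U * X).trace‖ ≤ c) : finTraceNorm X ≤ c := by
  obtain ⟨U, hU, hX⟩ := exists_trace_mul_eq_finTraceNorm X
  have := h U hU
  rw [hX, Complex.norm_real] at this
  exact (le_abs_self _).trans this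

theorem finTraceNorm_nonneg (X : Matrix ι ι ℂ) : 0 ≤ finTraceNorm X :=
  (norm_nonneg _).trans (norm_trace_mul_le_finTraceNorm X (U := 0) (by simp))

theorem finTraceNorm_add_le (X Y : Matrix ι ι ℂ) :
    finTraceNorm (X + Y) ≤ finTraceNorm X + finTraceNorm Y :=
  finTraceNorm_le_of_forall fun U hU => by
    rw [mul_add, Matrix.trace_add]
    exact (norm_add_le _ _).trans (add_le_add (norm_trace_mul_le_finTraceNorm X hU)
      (norm_trace_mul_le_finTraceNorm Y hU))

theorem finTraceNorm_smul_le (c : ℂ) (X : Matrix ι ι ℂ) :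
    finTraceNorm (c • X) ≤ ‖c‖ * finTraceNorm X :=
  finTraceNorm_le_of_forall fun U hU => by
    rw [mul_smul_comm, Matrix.trace_smul, smul_eq_mul, norm_mul]
    gcongr
    exact norm_trace_mul_le_finTraceNorm X hU

theorem Matrix.PosSemidef.finTraceNorm_eq_trace {X : Matrix ι ι ℂ} (hX : X.PosSemidef) :
    finTraceNorm X = X.trace.re := by
  rw [finTraceNorm_eq, CFC.abs_of_nonneg X (Matrix.nonneg_iff_posSemidef.2 hX)]

theorem Matrix.l2_opNorm_one_le : ‖(1 : Matrix ι ι ℂ)‖ ≤ 1 := by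
  rw [← Matrix.diagonal_one, Matrix.l2_opNorm_diagonal]
  exact (pi_norm_le_iff_of_nonneg zero_le_one).2 (by simp)

omit [DecidableEq ι] in
theorem Matrix.l2_opNorm_le_one_of_conjTranspose_mul_self {E : Matrix ι κ ℂ} (h : Eᴴ * E = 1) :
    ‖E‖ ≤ 1 := by
  have h1 := Matrix.l2_opNorm_conjTranspose_mul_self E
  have h2 : ‖(1 : Matrix κ κ ℂ)‖ ≤ 1 := Matrix.l2_opNorm_one_le
  rw [h] at h1
  nlinarith [norm_nonneg E]

theorem finTraceNorm_submatrix_le (X : Matrix ι ι ℂ) {f : κ → ι} (hf : Function.Injective f) :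
    finTraceNorm (X.submatrix f f) ≤ finTraceNorm X := by
  -- The isometry that sends the basis vector a to f a; a principal block is a compression by it.
  set E : Matrix ι κ ℂ := (1 : Matrix ι ι ℂ).submatrix id f with hE
  have hEE : Eᴴ * E = 1 := by
    ext a b
    simp [hE, Matrix.mul_apply, Matrix.one_apply, hf.eq_iff, eq_comm]
  have hX : X.submatrix f f = Eᴴ * X * E := by
    ext a b
    simp [hE, Matrix.mul_apply, Matrix.one_apply]
  refine finTraceNorm_le_of_forall fun U hU => ?_
  have h1 : (U * X.submatrix f f).trace = ((E * U * Eᴴ) * X).trace := by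
    rw [hX, ← Matrix.mul_assoc, ← Matrix.mul_assoc, Matrix.trace_mul_comm]
    simp only [Matrix.mul_assoc]
  rw [h1]
  refine norm_trace_mul_le_finTraceNorm X ?_
  have hE1 := Matrix.l2_opNorm_le_one_of_conjTranspose_mul_self hEE
  calc ‖E * U * Eᴴ‖ ≤ ‖E * U‖ * ‖Eᴴ‖ := Matrix.l2_opNorm_mul _ _
    _ ≤ (‖E‖ * ‖U‖) * ‖Eᴴ‖ := by gcongr; exact Matrix.l2_opNorm_mul _ _
    _ ≤ (1 * 1) * 1 := by rw [Matrix.l2_opNorm_conjTranspose]; gcongr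
    _ = 1 := by norm_num

open scoped Kronecker in
theorem finTraceNorm_kronecker (X : Matrix ι ι ℂ) (Y : Matrix κ κ ℂ) :
    finTraceNorm (X ⊗ₖ Y) = finTraceNorm X * finTraceNorm Y := by
  have hX := Matrix.nonneg_iff_posSemidef.1 (CFC.abs_nonneg X)
  have hY := Matrix.nonneg_iff_posSemidef.1 (CFC.abs_nonneg Y)
  have h : CFC.abs (X ⊗ₖ Y) = CFC.abs X ⊗ₖ CFC.abs Y := by
    refine CFC.sqrt_unique ?_ (Matrix.nonneg_iff_posSemidef.2 (hX.kronecker hY))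
    rw [← Matrix.mul_kronecker_mul, CFC.abs_mul_abs, CFC.abs_mul_abs,
      Matrix.star_eq_conjTranspose, Matrix.star_eq_conjTranspose, Matrix.star_eq_conjTranspose,
      Matrix.mul_kronecker_mul, Matrix.conjTranspose_kronecker]
  rw [finTraceNorm_eq, finTraceNorm_eq, finTraceNorm_eq, h, Matrix.trace_kronecker, Complex.mul_re]
  have h1 := (Complex.le_def.1 hX.trace_nonneg).2
  simp only [Complex.zero_im] at h1
  rw [← h1]; simp

/-- A Hermitian matrix has an orthogonal projection `P` which separates its positive part from its
negative part. -/
theorem Matrix.IsHermitian.exists_projection_finTraceNorm_eq {B : Matrix ι ι ℂ}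
    (hB : B.IsHermitian) : ∃ P : Matrix ι ι ℂ, P.IsHermitian ∧ P * P = P ∧
      finTraceNorm B = (P * B).trace.re - ((1 - P) * B).trace.re := by
  have hsa : IsSelfAdjoint B := hB
  have cf := Matrix.continuousOn_real_spectrum B
  have hid : cfc (fun x : ℝ => x) B = B := cfc_id' ℝ B hsa
  set g : ℝ → ℝ := fun x => if 0 ≤ x then 1 else 0 with hg
  refine ⟨cfc g B, (cfc_predicate (R := ℝ) g B : IsSelfAdjoint _), ?_, ?_⟩
  · rw [← cfc_mul _ _ B (cf _) (cf _)]
    refine cfc_congr fun x _ => ?_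
    by_cases h : 0 ≤ x <;> simp [hg, h]
  · have habs : CFC.abs B = cfc g B * B - (1 - cfc g B) * B := by
      rw [CFC.abs_eq_cfc_norm B hsa, sub_mul, one_mul]
      have h1 : cfc g B * B = cfc (fun x => g x * x) B := by
        rw [cfc_mul _ _ B (cf _) (cf _), hid]
      rw [h1]
      nth_rw 3 [← hid]
      rw [← cfc_sub _ _ B (cf _) (cf _), ← cfc_sub _ _ B (cf _) (cf _)]
      refine cfc_congr fun x _ => ?_
      by_cases h : 0 ≤ x
      · simp [hg, h, abs_of_nonneg h]
      · simp [hg, h, abs_of_neg (not_le.1 h)]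
    rw [finTraceNorm_eq, habs, Matrix.trace_sub, Complex.sub_re]

end FiniteTraceNorm

/-! ### Trace norm of infinite matrices, as the supremum over finite blocks. -/

section TraceNorm

variable {ι : Type*}

theorem traceNorm_le_iff {X : Matrix ι ι ℂ} {c : ℝ≥0∞} : traceNorm X ≤ c ↔
    ∀ F : Finset ι, ENNReal.ofReal (finTraceNorm
      (X.submatrix (Subtype.val : F → ι) (Subtype.val : F → ι))) ≤ c := iSup_le_iff

theorem finTraceNorm_block_le (X : Matrix ι ι ℂ) (F : Finset ι) :
    ENNReal.ofReal (finTraceNorm (X.submatrix (Subtype.val : F → ι) (Subtype.val : F → ι)))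
      ≤ traceNorm X := le_iSup (fun F : Finset ι => ENNReal.ofReal (finTraceNorm
        (X.submatrix (Subtype.val : F → ι) (Subtype.val : F → ι)))) F

theorem traceNorm_add_le (X Y : Matrix ι ι ℂ) : traceNorm (X + Y) ≤ traceNorm X + traceNorm Y := by
  classical
  refine traceNorm_le_iff.2 fun F => ?_
  rw [Matrix.submatrix_add]
  refine (ENNReal.ofReal_le_ofReal (finTraceNorm_add_le _ _)).trans ?_
  refine ENNReal.ofReal_add_le.trans ?_
  exact add_le_add (finTraceNorm_block_le X F) (finTraceNorm_block_le Y F)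

theorem traceNorm_smul_le (c : ℂ) (X : Matrix ι ι ℂ) :
    traceNorm (c • X) ≤ ENNReal.ofReal ‖c‖ * traceNorm X := by
  classical
  refine traceNorm_le_iff.2 fun F => ?_
  rw [Matrix.submatrix_smul]
  refine (ENNReal.ofReal_le_ofReal (finTraceNorm_smul_le _ _)).trans ?_
  rw [ENNReal.ofReal_mul (norm_nonneg _)]
  gcongr
  exact finTraceNorm_block_le X F

theorem traceNorm_zero : traceNorm (0 : Matrix ι ι ℂ) = 0 := by
  have := traceNorm_smul_le 0 (0 : Matrix ι ι ℂ)
  simpa using this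

theorem traceNorm_neg_le (X : Matrix ι ι ℂ) : traceNorm (-X) ≤ traceNorm X := by
  simpa using traceNorm_smul_le (-1) X

theorem traceNorm_sum_le {α : Type*} (s : Finset α) (X : α → Matrix ι ι ℂ) :
    traceNorm (∑ a ∈ s, X a) ≤ ∑ a ∈ s, traceNorm (X a) := by
  classical
  induction s using Finset.induction_on with
  | empty => simp [traceNorm_zero]
  | insert a s ha ih =>
    rw [Finset.sum_insert ha, Finset.sum_insert ha]
    exact (traceNorm_add_le _ _).trans (by gcongr)

theorem Matrix.PosSemidef.coe_re_diag {X : Matrix ι ι ℂ} (hX : X.PosSemidef) (i : ι) :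
    ((X i i).re : ℂ) = X i i :=
  Complex.ext rfl (by simpa using (Complex.le_def.1 (hX.diag_nonneg (i := i))).2)

theorem Matrix.PosSemidef.re_diag_nonneg {X : Matrix ι ι ℂ} (hX : X.PosSemidef) (i : ι) :
    0 ≤ (X i i).re := (Complex.le_def.1 (hX.diag_nonneg (i := i))).1

theorem Matrix.PosSemidef.traceNorm_le {X : Matrix ι ι ℂ} (hX : X.PosSemidef) {a : ℝ}
    (h : HasSum (fun i => (X i i).re) a) : traceNorm X ≤ ENNReal.ofReal a := by
  classical
  refine traceNorm_le_iff.2 fun F => ENNReal.ofReal_le_ofReal ?_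
  rw [(hX.submatrix _).finTraceNorm_eq_trace]
  have := sum_le_hasSum F (fun i _ => hX.re_diag_nonneg i) h
  refine le_trans (le_of_eq ?_) this
  simp only [Matrix.trace, Matrix.diag, Complex.re_sum, Matrix.submatrix_apply]
  exact Finset.sum_coe_sort F (fun i => (X i i).re)

theorem finTraceNorm_le_traceNorm [Fintype ι] (X : Matrix ι ι ℂ) :
    ENNReal.ofReal (finTraceNorm X) ≤ traceNorm X := by
  classical
  refine le_trans (ENNReal.ofReal_le_ofReal ?_) (finTraceNorm_block_le X Finset.univ)
  let f : ι → (Finset.univ : Finset ι) := fun i => ⟨i, Finset.mem_univ i⟩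
  have hf : Function.Injective f := fun a b h => by simpa [f] using h
  have h := finTraceNorm_submatrix_le (X.submatrix
    (Subtype.val : ↥(Finset.univ : Finset ι) → ι) (Subtype.val : ↥(Finset.univ : Finset ι) → ι)) hf
  rw [Matrix.submatrix_submatrix] at h
  exact h

theorem traceNorm_tensor_le {r : ℕ} (Y : Matrix ι ι ℂ) (Z : Matrix (Fin r) (Fin r) ℂ) :
    traceNorm (Matrix.of fun x y : ι × Fin r => Y x.1 y.1 * Z x.2 y.2)
      ≤ traceNorm Y * ENNReal.ofReal (finTraceNorm Z) := by
  classical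
  refine traceNorm_le_iff.2 fun F => ?_
  set F₁ := F.image Prod.fst with hF₁
  let f : F → F₁ × Fin r := fun x => (⟨x.1.1, Finset.mem_image_of_mem _ x.2⟩, x.1.2)
  have hf : Function.Injective f := by
    intro a b h
    simp only [f, Prod.mk.injEq, Subtype.mk.injEq] at h
    exact Subtype.ext (Prod.ext h.1 h.2)
  have h := finTraceNorm_submatrix_le (Matrix.kroneckerMap (· * ·)
    (Y.submatrix (Subtype.val : F₁ → ι) (Subtype.val : F₁ → ι)) Z) hf
  refine (ENNReal.ofReal_le_ofReal h).trans ?_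
  rw [finTraceNorm_kronecker, ENNReal.ofReal_mul (finTraceNorm_nonneg _)]
  gcongr
  exact finTraceNorm_block_le Y F₁

end TraceNorm

/-! ### Subadditivity of the diamond norm and the bound for rank-one maps. -/

section DiamondNorm

variable {d : ℕ} {ι : Type*}

theorem diamondNorm_le {Φ : Matrix (Fin d) (Fin d) ℂ → Matrix ι ι ℂ} {c : ℝ≥0∞}
    (h : ∀ (r : ℕ) (X : Matrix (Fin d × Fin r) (Fin d × Fin r) ℂ),
      traceNorm (ampliation Φ r X) ≤ c * ENNReal.ofReal (finTraceNorm X)) :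
    diamondNorm Φ ≤ c := by
  refine iSup_le fun r => iSup_le fun X => iSup_le fun _ => ?_
  refine ENNReal.div_le_of_le_mul ((h r X).trans ?_)
  gcongr
  exact finTraceNorm_le_traceNorm X

theorem diamondNorm_add_le (Φ Ψ : Matrix (Fin d) (Fin d) ℂ → Matrix ι ι ℂ) :
    diamondNorm (fun X => Φ X + Ψ X) ≤ diamondNorm Φ + diamondNorm Ψ := by
  refine iSup_le fun r => iSup_le fun X => iSup_le fun hX => ?_
  have h1 : traceNorm (ampliation Φ r X) / traceNorm X ≤ diamondNorm Φ :=
    le_iSup_of_le r (le_iSup_of_le X (le_iSup_of_le hX le_rfl))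
  have h2 : traceNorm (ampliation Ψ r X) / traceNorm X ≤ diamondNorm Ψ :=
    le_iSup_of_le r (le_iSup_of_le X (le_iSup_of_le hX le_rfl))
  refine le_trans ?_ (add_le_add h1 h2)
  rw [← ENNReal.add_div]
  exact ENNReal.div_le_div_right (traceNorm_add_le (ampliation Φ r X) (ampliation Ψ r X)) _

theorem diamondNorm_zero :
    diamondNorm (fun _ : Matrix (Fin d) (Fin d) ℂ => (0 : Matrix ι ι ℂ)) = 0 := by
  refine le_antisymm (diamondNorm_le fun r X => ?_) zero_le
  have : ampliation (fun _ : Matrix (Fin d) (Fin d) ℂ => (0 : Matrix ι ι ℂ)) r X = 0 := rfl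
  rw [this, traceNorm_zero]; exact zero_le

theorem diamondNorm_sum_le {α : Type*} (s : Finset α)
    (Φ : α → Matrix (Fin d) (Fin d) ℂ → Matrix ι ι ℂ) :
    diamondNorm (fun X => ∑ a ∈ s, Φ a X) ≤ ∑ a ∈ s, diamondNorm (Φ a) := by
  classical
  induction s using Finset.induction_on with
  | empty => simp [diamondNorm_zero]
  | insert a s ha ih =>
    simp only [Finset.sum_insert ha]
    exact (diamondNorm_add_le _ _).trans (by gcongr)

section

open scoped Matrix.Norms.L2Operator Kronecker

variable {κ μ : Type*} [Fintype κ] [DecidableEq κ] [Fintype μ] [DecidableEq μ]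

theorem Matrix.posSemidef_one_sub_of_norm_le {G : Matrix κ κ ℂ} (hG : ‖G‖ ≤ 1) :
    (1 - Gᴴ * G).PosSemidef := by
  have h0 : (0 : Matrix κ κ ℂ) ≤ Gᴴ * G :=
    Matrix.nonneg_iff_posSemidef.2 (Matrix.posSemidef_conjTranspose_mul_self G)
  have h1 : ‖Gᴴ * G‖ ≤ 1 := by
    rw [Matrix.l2_opNorm_conjTranspose_mul_self]
    exact mul_le_one₀ hG (norm_nonneg _) hG
  exact Matrix.le_iff.1 ((CStarAlgebra.norm_le_one_iff_of_nonneg _ h0).1 h1)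

theorem Matrix.norm_le_one_of_posSemidef_one_sub {G : Matrix κ κ ℂ}
    (hG : (1 - Gᴴ * G).PosSemidef) : ‖G‖ ≤ 1 := by
  have h0 : (0 : Matrix κ κ ℂ) ≤ Gᴴ * G :=
    Matrix.nonneg_iff_posSemidef.2 (Matrix.posSemidef_conjTranspose_mul_self G)
  have h1 : ‖Gᴴ * G‖ ≤ 1 :=
    (CStarAlgebra.norm_le_one_iff_of_nonneg _ h0).2 (Matrix.le_iff.2 hG)
  rw [Matrix.l2_opNorm_conjTranspose_mul_self] at h1
  nlinarith [norm_nonneg G]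

/-- G is a contraction exactly when 1 - G†G is positive, and 1 - G†G ⊗ W†W = (1 - G†G) ⊗ W†W + 1 ⊗
(1 - W†W). -/
theorem Matrix.l2_opNorm_kronecker_le_one {G : Matrix κ κ ℂ} {W : Matrix μ μ ℂ}
    (hG : ‖G‖ ≤ 1) (hW : ‖W‖ ≤ 1) : ‖G ⊗ₖ W‖ ≤ 1 := by
  refine Matrix.norm_le_one_of_posSemidef_one_sub ?_
  have h1 := (Matrix.posSemidef_one_sub_of_norm_le hG).kronecker
    (Matrix.posSemidef_conjTranspose_mul_self W)
  have h2 := (Matrix.PosSemidef.one (n := κ) (R := ℂ)).kronecker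
    (Matrix.posSemidef_one_sub_of_norm_le hW)
  have h3 : 1 - (G ⊗ₖ W)ᴴ * (G ⊗ₖ W) = (1 - Gᴴ * G) ⊗ₖ (Wᴴ * W) + 1 ⊗ₖ (1 - Wᴴ * W) := by
    rw [Matrix.conjTranspose_kronecker, ← Matrix.mul_kronecker_mul]
    ext ⟨a, b⟩ ⟨a', b'⟩
    simp only [Matrix.sub_apply, Matrix.add_apply, Matrix.kroneckerMap_apply, Matrix.one_apply,
      Prod.mk.injEq]
    split_ifs <;> simp_all <;> ring
  rw [h3]
  exact h1.add h2

/-- The Hilbert-Schmidt norm dominates the operator norm, by Cauchy-Schwarz in each row. -/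
theorem Matrix.l2_opNorm_le_one_of_sum_sq {G : Matrix κ κ ℂ}
    (hG : ∑ p, ∑ q, ‖G p q‖ ^ 2 ≤ 1) : ‖G‖ ≤ 1 := by
  rw [Matrix.cstar_norm_def]
  refine ContinuousLinearMap.opNorm_le_bound _ zero_le_one fun x => ?_
  rw [one_mul, EuclideanSpace.norm_eq, EuclideanSpace.norm_eq]
  refine Real.sqrt_le_sqrt ?_
  have h : ∀ p, ‖(Matrix.toEuclideanCLM (n := κ) (𝕜 := ℂ) G x) p‖ ^ 2
      ≤ (∑ q, ‖G p q‖ ^ 2) * ∑ q, ‖x q‖ ^ 2 := by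
    intro p
    have h1 : ‖(Matrix.toEuclideanCLM (n := κ) (𝕜 := ℂ) G x) p‖ ≤ ∑ q, ‖G p q‖ * ‖x q‖ := by
      rw [Matrix.ofLp_toEuclideanCLM]
      simp only [Matrix.mulVec, dotProduct]
      exact (norm_sum_le _ _).trans (le_of_eq (by simp))
    calc _ ≤ (∑ q, ‖G p q‖ * ‖x q‖) ^ 2 := by gcongr
      _ ≤ _ := Finset.sum_mul_sq_le_sq_mul_sq _ _ _
  calc _ ≤ ∑ p, (∑ q, ‖G p q‖ ^ 2) * ∑ q, ‖x q‖ ^ 2 := Finset.sum_le_sum fun p _ => h p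
    _ = (∑ p, ∑ q, ‖G p q‖ ^ 2) * ∑ q, ‖x q‖ ^ 2 := by rw [Finset.sum_mul]
    _ ≤ 1 * ∑ q, ‖x q‖ ^ 2 := by gcongr
    _ = _ := one_mul _

/-- The contraction with G is dual to W ↦ G ⊗ W, which maps contractions to contractions. -/
theorem finTraceNorm_contract_le {r : ℕ} {G : Matrix (Fin d) (Fin d) ℂ} (hG : ‖G‖ ≤ 1)
    (X : Matrix (Fin d × Fin r) (Fin d × Fin r) ℂ) :
    finTraceNorm (Matrix.of fun k l => (G * Matrix.of fun p q => X (p, k) (q, l)).trace)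
      ≤ finTraceNorm X := by
  refine finTraceNorm_le_of_forall fun W hW => ?_
  refine le_trans (le_of_eq ?_)
    (norm_trace_mul_le_finTraceNorm X (Matrix.l2_opNorm_kronecker_le_one hG hW))
  congr 1
  simp only [Matrix.trace, Matrix.diag, Matrix.mul_apply, Matrix.of_apply,
    Matrix.kroneckerMap_apply, Fintype.sum_prod_type, Finset.mul_sum]
  calc _ = ∑ k, ∑ p, ∑ l, ∑ q, W k l * (G p q * X (q, l) (p, k)) :=
        Finset.sum_congr rfl fun k _ => Finset.sum_comm
    _ = ∑ p, ∑ k, ∑ l, ∑ q, W k l * (G p q * X (q, l) (p, k)) := Finset.sum_comm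
    _ = _ := Finset.sum_congr rfl fun p _ => Finset.sum_congr rfl fun k _ => by
        rw [Finset.sum_comm]
        exact Finset.sum_congr rfl fun q _ => Finset.sum_congr rfl fun l _ => by ring

end

/-- The diamond norm of `X ↦ tr (G X) Y` is at most the Hilbert-Schmidt norm of `G` times the trace
norm of `Y`. -/
theorem diamondNorm_trace_smul_le {G : Matrix (Fin d) (Fin d) ℂ} {g : ℝ} (hg : 0 ≤ g)
    (hG : ∑ p, ∑ q, ‖G p q‖ ^ 2 ≤ g ^ 2) (Y : Matrix ι ι ℂ) :
    diamondNorm (fun X => (G * X).trace • Y) ≤ ENNReal.ofReal g * traceNorm Y := by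
  rcases hg.eq_or_lt with rfl | hg
  · have h0 : G = 0 := by
      ext p q
      have h1 : ∑ p, ∑ q, ‖G p q‖ ^ 2 = 0 :=
        le_antisymm (by simpa using hG) (by positivity)
      have h2 := (Finset.sum_eq_zero_iff_of_nonneg (fun p _ => by positivity)).1 h1 p
        (Finset.mem_univ p)
      have h3 := (Finset.sum_eq_zero_iff_of_nonneg (fun p _ => by positivity)).1 h2 q
        (Finset.mem_univ q)
      simpa using h3
    simp [h0, diamondNorm_zero]
  set G' : Matrix (Fin d) (Fin d) ℂ := (g : ℂ)⁻¹ • G with hG'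
  have hGG : G = (g : ℂ) • G' := by
    rw [hG', smul_smul, mul_inv_cancel₀ (by exact_mod_cast hg.ne'), one_smul]
  have h1 : ∑ p, ∑ q, ‖G' p q‖ ^ 2 ≤ 1 := by
    have : ∑ p, ∑ q, ‖G' p q‖ ^ 2 = (g ^ 2)⁻¹ * ∑ p, ∑ q, ‖G p q‖ ^ 2 := by
      simp only [hG', Matrix.smul_apply, smul_eq_mul, norm_mul, mul_pow, Finset.mul_sum]
      simp [abs_of_pos hg]
    rw [this, inv_mul_le_iff₀ (by positivity)]
    simpa using hG
  refine diamondNorm_le fun r X => ?_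
  have h2 : ampliation (fun X => (G * X).trace • Y) r X = Matrix.of fun x y : ι × Fin r =>
      ((g : ℂ) • Y) x.1 y.1 *
        (Matrix.of fun k l => (G' * Matrix.of fun p q => X (p, k) (q, l)).trace) x.2 y.2 := by
    ext x y
    simp only [ampliation, Matrix.of_apply, Matrix.smul_apply, smul_eq_mul]
    rw [hGG, Matrix.smul_mul, Matrix.trace_smul, smul_eq_mul]
    ring
  rw [h2]
  refine (traceNorm_tensor_le _ _).trans ?_
  have h3 := traceNorm_smul_le (g : ℂ) Y
  rw [Complex.norm_real, Real.norm_of_nonneg hg.le] at h3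
  gcongr
  exact finTraceNorm_contract_le (Matrix.l2_opNorm_le_one_of_sum_sq h1) X

end DiamondNorm

/-! ### Channels do not increase the trace norm, even with an ancilla. -/

section ChannelContraction

open scoped Matrix.Norms.L2Operator

variable {d : ℕ} {ι κ : Type*}

/-- Compressing the block matrix by the column (-U†, 1), with U attaining the trace norm of C, gives
tr(U†U P) - 2‖C‖₁ + tr Q ≥ 0. -/
theorem Matrix.PosSemidef.two_mul_finTraceNorm_le [Fintype κ] [DecidableEq κ]
    {P C C' Q : Matrix κ κ ℂ} (h : (Matrix.fromBlocks P C C' Q).PosSemidef) :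
    2 * finTraceNorm C ≤ P.trace.re + Q.trace.re := by
  obtain ⟨U, hU, hUC⟩ := exists_trace_mul_eq_finTraceNorm C
  have hC' : C' = Cᴴ := by
    have := h.1
    rw [Matrix.isHermitian_fromBlocks_iff] at this
    exact this.2.1.symm
  have hP : P.PosSemidef := h.submatrix (Sum.inl : κ → κ ⊕ κ)
  have h1 := (h.conjTranspose_mul_mul_same (Matrix.fromRows (-Uᴴ) (1 : Matrix κ κ ℂ))).trace_nonneg
  rw [Matrix.conjTranspose_fromRows_eq_fromCols_conjTranspose, Matrix.mul_assoc,
    Matrix.fromBlocks_mul_fromRows, Matrix.fromCols_mul_fromRows] at h1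
  have h2 : ((-Uᴴ)ᴴ * (P * -Uᴴ + C * 1) + (1 : Matrix κ κ ℂ)ᴴ * (C' * -Uᴴ + Q * 1)).trace
      = ((Uᴴ * U) * P).trace - (U * C).trace - star (U * C).trace + Q.trace := by
    rw [← Matrix.trace_conjTranspose (U * C), Matrix.conjTranspose_mul, hC']
    simp only [Matrix.conjTranspose_neg, Matrix.conjTranspose_conjTranspose, mul_one,
      Matrix.conjTranspose_one, one_mul, Matrix.trace_add, Matrix.mul_add, Matrix.neg_mul,
      Matrix.mul_neg, Matrix.trace_neg, neg_neg]
    rw [← Matrix.mul_assoc, Matrix.trace_mul_comm (U * P), ← Matrix.mul_assoc]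
    ring
  rw [h2, hUC] at h1
  have h3 := (Complex.le_def.1 h1).1
  simp only [Complex.zero_re, Complex.add_re, Complex.sub_re, Complex.ofReal_re, Complex.star_def,
    Complex.conj_re] at h3
  have h4 : ‖Uᴴ * U‖ ≤ 1 := by
    rw [Matrix.l2_opNorm_conjTranspose_mul_self]; exact mul_le_one₀ hU (norm_nonneg _) hU
  have h5 := (Complex.re_le_norm _).trans (hP.norm_trace_mul_le h4)
  linarith

theorem IsChannel.sum_ampliation_diag_le {Λ : Matrix (Fin d) (Fin d) ℂ →ₗ[ℂ] Matrix ι ι ℂ}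
    (hΛ : IsChannel Λ) {r : ℕ} {D : Matrix (Fin d × Fin r) (Fin d × Fin r) ℂ}
    (hD : D.PosSemidef) (F : Finset (ι × Fin r)) :
    ∑ x ∈ F, (ampliation Λ r D x x).re ≤ D.trace.re := by
  classical
  have hpos := hΛ.completelyPositive r D hD
  have h1 : F ⊆ (F.image Prod.fst) ×ˢ Finset.univ := fun x hx =>
    Finset.mem_product.2 ⟨Finset.mem_image_of_mem _ hx, Finset.mem_univ _⟩
  refine (Finset.sum_le_sum_of_subset_of_nonneg h1 fun x _ _ => hpos.re_diag_nonneg x).trans ?_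
  rw [Finset.sum_product_right]
  have h2 : D.trace.re = ∑ k, (Matrix.of fun p q => D (p, k) (q, k)).trace.re := by
    simp only [Matrix.trace, Matrix.diag, Complex.re_sum, Fintype.sum_prod_type, Matrix.of_apply]
    exact Finset.sum_comm
  rw [h2]
  refine Finset.sum_le_sum fun k _ => ?_
  have h3 := Complex.hasSum_re (hΛ.tracePreserving (Matrix.of fun p q => D (p, k) (q, k)))
  exact sum_le_hasSum (F.image Prod.fst) (fun x _ => hpos.re_diag_nonneg (x, k)) h3

/-- For the polar decomposition X = V A, the block matrix with diagonal V A V†, A and corner X is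
positive. Complete positivity with the doubled ancilla keeps it positive, and the corner is then
bounded by the traces of the diagonal blocks, which the channel preserves. -/
theorem IsChannel.traceNorm_ampliation_le {Λ : Matrix (Fin d) (Fin d) ℂ →ₗ[ℂ] Matrix ι ι ℂ}
    (hΛ : IsChannel Λ) (r : ℕ) (X : Matrix (Fin d × Fin r) (Fin d × Fin r) ℂ) :
    traceNorm (ampliation Λ r X) ≤ ENNReal.ofReal (finTraceNorm X) := by
  classical
  obtain ⟨V, hV, hVX, -⟩ := X.exists_polar
  have hA := Matrix.nonneg_iff_posSemidef.1 (CFC.abs_nonneg X)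
  have hXA : finTraceNorm X = (CFC.abs X).trace.re := finTraceNorm_eq X
  generalize CFC.abs X = A at hVX hA hXA
  let e : Fin r ⊕ Fin r → Fin (r + r) := finSumFinEquiv
  -- R stacks V on top of the identity, so that R A R† has the blocks V A V†, X, X†, A.
  set R : Matrix (Fin d × Fin (r + r)) (Fin d × Fin r) ℂ := Matrix.of fun x b =>
    Sum.elim (fun k => V (x.1, k) b) (fun k => (1 : Matrix _ _ ℂ) (x.1, k) b)
      (finSumFinEquiv.symm x.2) with hR
  have hRl : ∀ p k b, R (p, e (Sum.inl k)) b = V (p, k) b := fun p k b => by simp [hR, e]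
  have hRr : ∀ p k b, R (p, e (Sum.inr k)) b = (1 : Matrix _ _ ℂ) (p, k) b :=
    fun p k b => by simp only [hR, e, Matrix.of_apply, Equiv.symm_apply_apply, Sum.elim_inr]
  have hW := hΛ.completelyPositive (r + r) _ (hA.mul_mul_conjTranspose_same R)
  have hB : (V * A * Vᴴ).PosSemidef := hA.mul_mul_conjTranspose_same V
  have hll : ∀ x y k l, ampliation Λ (r + r) (R * A * Rᴴ) (x, e (Sum.inl k)) (y, e (Sum.inl l))
      = ampliation Λ r (V * A * Vᴴ) (x, k) (y, l) := fun x y k l => by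
    simp [ampliation, Matrix.mul_apply, hRl]
  have hlr : ∀ x y k l, ampliation Λ (r + r) (R * A * Rᴴ) (x, e (Sum.inl k)) (y, e (Sum.inr l))
      = ampliation Λ r X (x, k) (y, l) := fun x y k l => by
    have : X = V * A * (1 : Matrix _ _ ℂ)ᴴ := by rw [Matrix.conjTranspose_one, mul_one, hVX]
    rw [this]
    simp only [ampliation, Matrix.mul_apply, Matrix.of_apply, Matrix.conjTranspose_apply, hRl, hRr]
  have hrr : ∀ x y k l, ampliation Λ (r + r) (R * A * Rᴴ) (x, e (Sum.inr k)) (y, e (Sum.inr l))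
      = ampliation Λ r A (x, k) (y, l) := fun x y k l => by
    have : A = 1 * A * (1 : Matrix _ _ ℂ)ᴴ := by rw [Matrix.conjTranspose_one, mul_one, one_mul]
    conv_rhs => rw [this]
    simp only [ampliation, Matrix.mul_apply, Matrix.of_apply, Matrix.conjTranspose_apply, hRr]
  refine traceNorm_le_iff.2 fun F => ENNReal.ofReal_le_ofReal ?_
  let f : F ⊕ F → ι × Fin (r + r) :=
    Sum.elim (fun x => (x.1.1, e (Sum.inl x.1.2))) (fun x => (x.1.1, e (Sum.inr x.1.2)))
  have hM := hW.submatrix f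
  rw [← Matrix.fromBlocks_toBlocks (Matrix.submatrix _ f f)] at hM
  have h1 := hM.two_mul_finTraceNorm_le
  have hC : (Matrix.submatrix (ampliation Λ (r + r) (R * A * Rᴴ)) f f).toBlocks₁₂
      = (ampliation Λ r X).submatrix (Subtype.val : F → _) (Subtype.val : F → _) := by
    ext x y; exact hlr _ _ _ _
  rw [hC] at h1
  have hP : (Matrix.submatrix (ampliation Λ (r + r) (R * A * Rᴴ)) f f).toBlocks₁₁.trace.re
      = ∑ x ∈ F, (ampliation Λ r (V * A * Vᴴ) x x).re := by
    rw [Matrix.trace, Complex.re_sum, ← Finset.sum_coe_sort F]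
    exact Finset.sum_congr rfl fun x _ => congrArg Complex.re (hll _ _ _ _)
  have hQ : (Matrix.submatrix (ampliation Λ (r + r) (R * A * Rᴴ)) f f).toBlocks₂₂.trace.re
      = ∑ x ∈ F, (ampliation Λ r A x x).re := by
    rw [Matrix.trace, Complex.re_sum, ← Finset.sum_coe_sort F]
    exact Finset.sum_congr rfl fun x _ => congrArg Complex.re (hrr _ _ _ _)
  have h2 := hΛ.sum_ampliation_diag_le hB F
  have h3 := hΛ.sum_ampliation_diag_le hA F
  have h4 : (V * A * Vᴴ).trace.re ≤ A.trace.re := by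
    rw [Matrix.trace_mul_comm, ← Matrix.mul_assoc]
    refine (Complex.re_le_norm _).trans (hA.norm_trace_mul_le ?_)
    rw [Matrix.l2_opNorm_conjTranspose_mul_self]; exact mul_le_one₀ hV (norm_nonneg _) hV
  rw [hXA]
  linarith

end ChannelContraction

/-! ### Measurement in the standard basis: the trivial error bound. -/

section Dephasing

open scoped Matrix.Norms.L2Operator

variable {d : ℕ} {ι : Type*}

theorem IsPrimitiveRoot.sum_pow_mul_star_pow {ω : ℂ} (hd : d ≠ 0) (hω : IsPrimitiveRoot ω d)
    (p q : Fin d) : ∑ j ∈ Finset.range d, (ω ^ (p : ℕ)) ^ j * star ((ω ^ (q : ℕ)) ^ j)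
      = if p = q then (d : ℂ) else 0 := by
  have hn : ‖ω‖ = 1 := hω.norm'_eq_one hd
  have h0 : ω ≠ 0 := hω.ne_zero hd
  have hs : star ω = ω⁻¹ := (Complex.inv_eq_conj hn).symm
  have h1 : ∀ j, (ω ^ (p : ℕ)) ^ j * star ((ω ^ (q : ℕ)) ^ j)
      = (ω ^ (p : ℕ) * (ω ^ (q : ℕ))⁻¹) ^ j := fun j => by
    rw [star_pow, star_pow, hs, mul_pow, inv_pow]
  simp only [h1]
  split_ifs with h
  · subst h
    simp [h0]
  · have h2 : ω ^ (p : ℕ) * (ω ^ (q : ℕ))⁻¹ ≠ 1 := fun h3 => h <| by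
      rw [← div_eq_mul_inv, div_eq_one_iff_eq (pow_ne_zero _ h0)] at h3
      exact Fin.ext (hω.pow_inj p.2 q.2 h3)
    have h3 := mul_geom_sum (ω ^ (p : ℕ) * (ω ^ (q : ℕ))⁻¹) d
    have h4 : (ω ^ (p : ℕ) * (ω ^ (q : ℕ))⁻¹) ^ d = 1 := by
      rw [mul_pow, ← pow_mul, mul_comm, inv_pow, ← pow_mul, mul_comm (p : ℕ), mul_comm (q : ℕ),
        pow_mul, pow_mul, hω.pow_eq_one]; simp
    rw [h4, sub_self] at h3
    exact (mul_eq_zero.1 h3).resolve_left (sub_ne_zero.2 h2)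

theorem finTraceNorm_unitary_conj_le {κ : Type*} [Fintype κ] [DecidableEq κ]
    (X : Matrix κ κ ℂ) {D : Matrix κ κ ℂ} (hD : ‖D‖ ≤ 1) :
    finTraceNorm (D * X * Dᴴ) ≤ finTraceNorm X := by
  refine finTraceNorm_le_of_forall fun U hU => ?_
  have : (U * (D * X * Dᴴ)).trace = ((Dᴴ * U * D) * X).trace := by
    rw [← Matrix.mul_assoc, Matrix.trace_mul_comm]
    simp only [Matrix.mul_assoc]
  rw [this]
  refine norm_trace_mul_le_finTraceNorm X ?_
  have h1 : ‖Dᴴ‖ ≤ 1 := by rwa [Matrix.l2_opNorm_conjTranspose]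
  exact (norm_mul_le _ _).trans (mul_le_one₀ ((norm_mul_le _ _).trans
    (mul_le_one₀ h1 (norm_nonneg _) hU)) (norm_nonneg _) hD)

/-- The part of an operator on `ℂ^d ⊗ ℂ^r` that is off-diagonal in the first factor. -/
def offDiagonal {r : ℕ} (X : Matrix (Fin d × Fin r) (Fin d × Fin r) ℂ) :
    Matrix (Fin d × Fin r) (Fin d × Fin r) ℂ :=
  Matrix.of fun x y => if x.1 = y.1 then 0 else X x y

/-- Dephasing is the average of the conjugations by d diagonal unitaries built from d-th roots of
unity. -/
theorem finTraceNorm_offDiagonal_le {r : ℕ} (hd : d ≠ 0)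
    (X : Matrix (Fin d × Fin r) (Fin d × Fin r) ℂ) :
    finTraceNorm (offDiagonal X) ≤ 2 * (1 - 1 / (d : ℝ)) * finTraceNorm X := by
  set ω : ℂ := Complex.exp (2 * Real.pi * Complex.I / d) with hω0
  have hω : IsPrimitiveRoot ω d := Complex.isPrimitiveRoot_exp d hd
  have hn : ‖ω‖ = 1 := hω.norm'_eq_one hd
  let D : ℕ → Matrix (Fin d × Fin r) (Fin d × Fin r) ℂ :=
    fun j => Matrix.diagonal fun x => (ω ^ (x.1 : ℕ)) ^ j
  have hD : ∀ j, ‖D j‖ ≤ 1 := fun j => by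
    rw [Matrix.l2_opNorm_diagonal]
    exact (pi_norm_le_iff_of_nonneg zero_le_one).2 fun x => by simp [hn]
  have hsum : offDiagonal X = ((d : ℂ)⁻¹) • ∑ j ∈ Finset.range d, (X - D j * X * (D j)ᴴ) := by
    ext x y
    have hs := hω.sum_pow_mul_star_pow hd x.1 y.1
    have hd' : (d : ℂ) ≠ 0 := by exact_mod_cast hd
    have h1 : ∀ j, (X - D j * X * (D j)ᴴ) x y
        = X x y - X x y * ((ω ^ (x.1 : ℕ)) ^ j * star ((ω ^ (y.1 : ℕ)) ^ j)) := fun j => by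
      simp only [D, Matrix.diagonal_conjTranspose, Matrix.sub_apply, Matrix.mul_diagonal,
        Matrix.diagonal_mul, Pi.star_apply]
      ring
    rw [Matrix.smul_apply, Matrix.sum_apply]
    simp only [h1]
    rw [Finset.sum_sub_distrib, ← Finset.mul_sum, hs]
    simp only [offDiagonal, Matrix.of_apply, Finset.sum_const, Finset.card_range, nsmul_eq_mul,
      smul_eq_mul]
    split_ifs
    · field_simp; ring
    · field_simp; ring
  have hbound : finTraceNorm (∑ j ∈ Finset.range d, (X - D j * X * (D j)ᴴ))
      ≤ ((d : ℝ) - 1) * (2 * finTraceNorm X) := by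
    have hle : ∀ s : Finset ℕ, finTraceNorm (∑ j ∈ s, (X - D j * X * (D j)ᴴ))
        ≤ s.card * (2 * finTraceNorm X) := by
      intro s
      induction s using Finset.induction_on with
      | empty =>
        simpa using finTraceNorm_smul_le 0 (0 : Matrix (Fin d × Fin r) (Fin d × Fin r) ℂ)
      | insert a s ha ih =>
        rw [Finset.sum_insert ha, Finset.card_insert_of_notMem ha]
        have h1 := finTraceNorm_add_le (X - D a * X * (D a)ᴴ)
          (∑ j ∈ s, (X - D j * X * (D j)ᴴ))
        have h2 := finTraceNorm_add_le X ((-1 : ℂ) • (D a * X * (D a)ᴴ))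
        have h3 := finTraceNorm_smul_le (-1 : ℂ) (D a * X * (D a)ᴴ)
        have h4 := finTraceNorm_unitary_conj_le X (hD a)
        rw [neg_one_smul, ← sub_eq_add_neg] at h2
        rw [neg_one_smul] at h3
        simp only [norm_neg, norm_one, one_mul] at h3
        push_cast
        linarith
    obtain ⟨d', rfl⟩ := Nat.exists_eq_succ_of_ne_zero hd
    -- The unitary with index 0 is the identity and contributes nothing; this improves the constant
    -- from 2 to 2(1 - 1/d).
    have h0 : X - D 0 * X * (D 0)ᴴ = 0 := by
      have : D 0 = 1 := by simp [D]
      rw [this]; simp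
    rw [Finset.sum_range_succ', h0, add_zero]
    have := hle ((Finset.range d').image Nat.succ)
    rw [Finset.sum_image (by simp), Finset.card_image_of_injective _ Nat.succ_injective,
      Finset.card_range] at this
    refine this.trans (le_of_eq ?_)
    push_cast; ring
  rw [hsum]
  refine (finTraceNorm_smul_le _ _).trans ?_
  have hd' : (0 : ℝ) < d := by exact_mod_cast Nat.pos_of_ne_zero hd
  rw [norm_inv, Complex.norm_natCast]
  calc (d : ℝ)⁻¹ * _ ≤ (d : ℝ)⁻¹ * (((d : ℝ) - 1) * (2 * finTraceNorm X)) := by gcongr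
    _ = _ := by field_simp

/-- A channel is simulated by measuring in the standard basis up to the error `2 (1 - 1 / d)`. -/
theorem IsChannel.diamondNorm_sub_measure_basis_le
    {Λ : Matrix (Fin d) (Fin d) ℂ →ₗ[ℂ] Matrix ι ι ℂ} (hΛ : IsChannel Λ) (hd : d ≠ 0) :
    diamondNorm (fun X => Λ X - measurePrepare (fun k : Fin d => Matrix.single k k 1)
      (fun k => Λ (Matrix.single k k 1)) X) ≤ ENNReal.ofReal (2 * (1 - 1 / (d : ℝ))) := by
  have h0 : 0 ≤ 2 * (1 - 1 / (d : ℝ)) := by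
    have : (1 : ℝ) ≤ d := by exact_mod_cast Nat.one_le_iff_ne_zero.2 hd
    have : 1 / (d : ℝ) ≤ 1 := by rw [div_le_one (by linarith)]; exact this
    linarith
  refine diamondNorm_le fun r X => ?_
  have h : ampliation (fun X => Λ X - measurePrepare (fun k : Fin d => Matrix.single k k 1)
      (fun k => Λ (Matrix.single k k 1)) X) r X = ampliation Λ r (offDiagonal X) := by
    ext x y
    simp only [ampliation, Matrix.of_apply, measurePrepare]
    have h1 : (Matrix.of fun p q => offDiagonal X (p, x.2) (q, y.2))
        = (Matrix.of fun p q => X (p, x.2) (q, y.2)) - ∑ k : Fin d,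
          ((Matrix.single k k 1 : Matrix (Fin d) (Fin d) ℂ) *
            Matrix.of fun p q => X (p, x.2) (q, y.2)).trace • Matrix.single k k (1 : ℂ) := by
      ext p q
      simp only [Matrix.sub_apply, Matrix.of_apply, Matrix.sum_apply, Matrix.smul_apply,
        Matrix.single_apply, offDiagonal, Matrix.trace_single_mul, smul_eq_mul]
      by_cases hpq : p = q
      · subst hpq
        simp
      · have : ∀ k, ¬ (k = p ∧ k = q) := fun k hk => hpq (hk.1.symm.trans hk.2)
        simp [hpq, this]
    rw [h1, map_sub, map_sum]
    simp only [map_smul]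
  rw [h]
  refine (hΛ.traceNorm_ampliation_le r _).trans ?_
  rw [← ENNReal.ofReal_mul h0]
  exact ENNReal.ofReal_le_ofReal (finTraceNorm_offDiagonal_le hd X)

end Dephasing

/-! ### Absolute convergence of traces and partial traces. -/

section Envelope

variable {ι κ : Type*}

/-- A matrix whose entries are dominated by `g i * g j` for a square summable `g`; this makes all
partial traces absolutely convergent. -/
def HasEnvelope (Y : Matrix ι ι ℂ) : Prop :=
  ∃ g : ι → ℝ, (∀ i, 0 ≤ g i) ∧ Summable (fun i => g i ^ 2) ∧ ∀ i j, ‖Y i j‖ ≤ g i * g j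

theorem HasEnvelope.add {X Y : Matrix ι ι ℂ} (hX : HasEnvelope X) (hY : HasEnvelope Y) :
    HasEnvelope (X + Y) := by
  obtain ⟨g, hg, hgs, hgX⟩ := hX
  obtain ⟨h, hh, hhs, hhY⟩ := hY
  refine ⟨fun i => g i + h i, fun i => add_nonneg (hg i) (hh i), ?_, fun i j => ?_⟩
  · refine Summable.of_nonneg_of_le (fun i => by positivity) (fun i => ?_)
      ((hgs.mul_left 2).add (hhs.mul_left 2))
    nlinarith [sq_nonneg (g i - h i)]
  · refine (norm_add_le _ _).trans ?_
    nlinarith [hgX i j, hhY i j, mul_nonneg (hg i) (hh j), mul_nonneg (hh i) (hg j)]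

theorem HasEnvelope.smul {X : Matrix ι ι ℂ} (hX : HasEnvelope X) (c : ℂ) :
    HasEnvelope (c • X) := by
  obtain ⟨g, hg, hgs, hgX⟩ := hX
  refine ⟨fun i => Real.sqrt ‖c‖ * g i, fun i => mul_nonneg (Real.sqrt_nonneg _) (hg i), ?_,
    fun i j => ?_⟩
  · simp only [mul_pow]; exact hgs.mul_left _
  · rw [Matrix.smul_apply, smul_eq_mul, norm_mul]
    calc ‖c‖ * ‖X i j‖ ≤ ‖c‖ * (g i * g j) := by gcongr; exact hgX i j
      _ = (Real.sqrt ‖c‖ * Real.sqrt ‖c‖) * (g i * g j) := by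
        rw [Real.mul_self_sqrt (norm_nonneg _)]
      _ = _ := by ring

/-- Nonnegativity of the 2 × 2 principal minors. It makes the square roots of the diagonal entries
an envelope. -/
theorem Matrix.PosSemidef.norm_apply_le {X : Matrix ι ι ℂ} (hX : X.PosSemidef) (i j : ι) :
    ‖X i j‖ ≤ Real.sqrt (X i i).re * Real.sqrt (X j j).re := by
  have h := (hX.submatrix ![i, j]).det_nonneg
  rw [Matrix.det_fin_two] at h
  have h1 : X j i = star (X i j) := (hX.1.apply i j).symm ▸ by simp
  simp only [Matrix.submatrix_apply, Matrix.cons_val_zero, Matrix.cons_val_one] at h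
  rw [h1, ← hX.coe_re_diag i, ← hX.coe_re_diag j, Complex.star_def, Complex.mul_conj] at h
  have h2 := (Complex.le_def.1 h).1
  rw [← Complex.ofReal_mul, ← Complex.ofReal_sub, Complex.ofReal_re, Complex.zero_re,
    Complex.normSq_eq_norm_sq] at h2
  rw [← Real.sqrt_mul (hX.re_diag_nonneg i)]
  exact Real.le_sqrt_of_sq_le (by linarith)

theorem Matrix.PosSemidef.hasEnvelope {X : Matrix ι ι ℂ} (hX : X.PosSemidef)
    (h : Summable fun i => X i i) : HasEnvelope X := by
  refine ⟨fun i => Real.sqrt (X i i).re, fun i => Real.sqrt_nonneg _, ?_, hX.norm_apply_le⟩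
  simp only [Real.sq_sqrt (hX.re_diag_nonneg _)]
  exact (Complex.hasSum_re h.hasSum).summable

/-- Each series below pairs rows and columns along two injections, possibly different ones; the
product of two envelope values is at most the sum of their squares. -/
theorem HasEnvelope.summable {X : Matrix ι ι ℂ} (hX : HasEnvelope X) {f g : κ → ι}
    (hf : Function.Injective f) (hg : Function.Injective g) :
    Summable fun k => X (f k) (g k) := by
  obtain ⟨u, hu, hus, huX⟩ := hX
  refine Summable.of_norm_bounded (g := fun k => u (f k) ^ 2 + u (g k) ^ 2)
    ((hus.comp_injective hf).add (hus.comp_injective hg)) fun k => ?_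
  refine (huX _ _).trans ?_
  nlinarith [sq_nonneg (u (f k) - u (g k)), sq_nonneg (u (f k)), sq_nonneg (u (g k))]

end Envelope

/-! ### Positivity of infinite matrices. -/

section PositiveBlocks

variable {ι κ ζ : Type*}

theorem Matrix.posSemidef_of_finite_blocks {X : Matrix ι ι ℂ}
    (h : ∀ F : Finset ι,
      (X.submatrix (Subtype.val : F → ι) (Subtype.val : F → ι)).PosSemidef) : X.PosSemidef := by
  classical
  refine ⟨?_, fun x => ?_⟩
  · ext i j
    exact congrFun (congrFun (h {i, j}).1 ⟨i, by simp⟩) ⟨j, by simp⟩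
  · have h1 := (h x.support).dotProduct_mulVec_nonneg (fun i => x i.1)
    refine h1.trans (le_of_eq ?_)
    simp only [dotProduct, Matrix.mulVec, Finsupp.sum, Finset.mul_sum, Pi.star_apply,
      Matrix.submatrix_apply]
    rw [← Finset.sum_coe_sort x.support]
    refine Finset.sum_congr rfl fun i _ => ?_
    rw [← Finset.sum_coe_sort x.support]
    exact Finset.sum_congr rfl fun j _ => by ring

theorem Matrix.posSemidef_tsum_submatrix {M : Matrix κ κ ℂ} (hM : M.PosSemidef)
    (h : ι → ζ → κ) (hs : ∀ a b, Summable fun z => M (h a z) (h b z)) :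
    (Matrix.of fun a b => ∑' z, M (h a z) (h b z)).PosSemidef := by
  refine ⟨?_, fun x => ?_⟩
  · ext a b
    rw [Matrix.conjTranspose_apply, Matrix.of_apply, Matrix.of_apply, tsum_star]
    exact tsum_congr fun z => hM.1.apply _ _
  · have h1 : HasSum (fun z => x.sum fun a xa => x.sum fun b xb => star xa * M (h a z) (h b z) * xb)
        (x.sum fun a xa => x.sum fun b xb => star xa * (∑' z, M (h a z) (h b z)) * xb) :=
      hasSum_sum fun a _ => hasSum_sum fun b _ => ((hs a b).hasSum.mul_left _).mul_right _
    exact h1.nonneg fun z => (hM.submatrix fun a => h a z).2 x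

end PositiveBlocks

/-! ### Local projective measurements and the invariance of traces under pinching. -/

section Measurement

variable {ι A Z : Type*}

theorem hasSum_of_support_fst {f : A × Z → ℂ} {F : Finset A} {s : A → ℂ}
    (h0 : ∀ a z, a ∉ F → f (a, z) = 0) (hs : ∀ a ∈ F, HasSum (fun z => f (a, z)) (s a)) :
    HasSum f (∑ a ∈ F, s a) := by
  classical
  have h1 : f = fun p => ∑ a ∈ F, if p.1 = a then f p else 0 := by
    funext p
    rw [Finset.sum_ite_eq]
    split_ifs with h
    · rfl
    · exact h0 p.1 p.2 h
  rw [h1]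
  refine hasSum_sum fun a ha => ?_
  have hinj : Function.Injective (fun z : Z => (a, z)) := fun _ _ h => (Prod.mk.inj h).2
  refine (hinj.hasSum_iff fun p hp => ?_).1 ?_
  · rw [if_neg]
    exact fun h => hp ⟨p.2, Prod.ext h.symm rfl⟩
  · simpa [Function.comp_def] using hs a ha

/-- The operation `Y ↦ (P ⊗ 1) Y (P ⊗ 1)`, where `P` is supported on the finite set `F` of basis
vectors of the first factor. -/
def sandwich (e : ι ≃ A × Z) (F : Finset A) (P : Matrix A A ℂ) :
    Matrix ι ι ℂ →ₗ[ℂ] Matrix ι ι ℂ where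
  toFun Y := Matrix.of fun i j => ∑ a ∈ F, ∑ b ∈ F,
    P (e i).1 a * Y (e.symm (a, (e i).2)) (e.symm (b, (e j).2)) * P b (e j).1
  map_add' X Y := by
    ext i j
    simp only [Matrix.of_apply, Matrix.add_apply, mul_add, add_mul, Finset.sum_add_distrib]
  map_smul' c Y := by
    ext i j
    simp only [Matrix.of_apply, Matrix.smul_apply, smul_eq_mul, RingHom.id_apply, Finset.mul_sum]
    exact Finset.sum_congr rfl fun a _ => Finset.sum_congr rfl fun b _ => by ring

open Classical in
/-- The operation `Y ↦ (P ⊗ 1) Y (P ⊗ 1)`, where `P` is the projection off the finite set `F` of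
basis vectors of the first factor. -/
noncomputable def truncateOff (e : ι ≃ A × Z) (F : Finset A) :
    Matrix ι ι ℂ →ₗ[ℂ] Matrix ι ι ℂ where
  toFun Y := Matrix.of fun i j => if (e i).1 ∉ F ∧ (e j).1 ∉ F then Y i j else 0
  map_add' X Y := by
    ext i j
    simp only [Matrix.of_apply, Matrix.add_apply]
    split_ifs <;> simp
  map_smul' c Y := by
    ext i j
    simp only [Matrix.of_apply, Matrix.smul_apply, smul_eq_mul, RingHom.id_apply]
    split_ifs <;> simp

/-- An orthogonal projection supported on the finite set `F` of basis vectors. -/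
structure IsProjOn (F : Finset A) (P : Matrix A A ℂ) : Prop where
  support : ∀ a b, a ∉ F → P a b = 0
  herm : P.IsHermitian
  idem : ∀ a b, ∑ c ∈ F, P a c * P c b = P a b

open Classical in
/-- The projection onto the span of the basis vectors in `F`. -/
noncomputable def blockProj (F : Finset A) : Matrix A A ℂ :=
  Matrix.of fun a b => if a = b ∧ a ∈ F then 1 else 0

theorem IsProjOn.support' {F : Finset A} {P : Matrix A A ℂ} (hP : IsProjOn F P) (a b : A)
    (hb : b ∉ F) : P a b = 0 := by
  rw [← hP.herm.apply, hP.support b a hb, star_zero]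

theorem IsProjOn.compl {F : Finset A} {P : Matrix A A ℂ} (hP : IsProjOn F P) :
    IsProjOn F (blockProj F - P) where
  support a b ha := by simp [blockProj, ha, hP.support a b ha]
  herm := by
    refine Matrix.IsHermitian.sub ?_ hP.herm
    ext a b
    simp only [blockProj, Matrix.conjTranspose_apply, Matrix.of_apply]
    by_cases h : a = b
    · subst h; split_ifs <;> simp
    · simp [h, Ne.symm h]
  idem a b := by
    have h1 : ∀ c, (blockProj F - P) a c * (blockProj F - P) c b
        = blockProj F a c * blockProj F c b - blockProj F a c * P c b
          - P a c * blockProj F c b + P a c * P c b := fun c => by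
      simp only [Matrix.sub_apply]; ring
    simp only [h1, Finset.sum_add_distrib, Finset.sum_sub_distrib, hP.idem]
    classical
    have h2 : ∀ x : A → ℂ, ∑ c ∈ F, blockProj F a c * x c = if a ∈ F then x a else 0 := by
      intro x
      simp only [blockProj, Matrix.of_apply, ite_mul, one_mul, zero_mul]
      by_cases ha : a ∈ F
      · simp [ha]
      · simp [ha]
    have h3 : ∑ c ∈ F, P a c * blockProj F c b = P a b := by
      by_cases hb : b ∈ F
      · rw [Finset.sum_eq_single b]
        · simp [blockProj, hb]
        · intro c _ hc; simp [blockProj, hc]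
        · exact fun h => absurd hb h
      · rw [hP.support' a b hb]
        refine Finset.sum_eq_zero fun c hc => ?_
        have : ¬ (c = b ∧ c ∈ F) := fun h => hb (h.1 ▸ h.2)
        simp [blockProj, this]
    rw [h2, h2, h3]
    by_cases ha : a ∈ F
    · simp [ha]
    · simp [ha, hP.support a b ha, blockProj]

theorem isProjOn_extend [DecidableEq A] {F : Finset A} {P : Matrix F F ℂ} (hP : P.IsHermitian)
    (hPP : P * P = P) : IsProjOn F (Matrix.of fun a b =>
      if h : a ∈ F ∧ b ∈ F then P ⟨a, h.1⟩ ⟨b, h.2⟩ else 0) where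
  support a b ha := by simp [ha]
  herm := by
    ext a b
    simp only [Matrix.conjTranspose_apply, Matrix.of_apply]
    by_cases h : a ∈ F ∧ b ∈ F
    · rw [dif_pos h, dif_pos h.symm]; exact hP.apply _ _
    · rw [dif_neg h, dif_neg fun h' => h h'.symm, star_zero]
  idem a b := by
    rw [← Finset.sum_coe_sort F]
    by_cases h : a ∈ F ∧ b ∈ F
    · have := congrFun (congrFun hPP ⟨a, h.1⟩) ⟨b, h.2⟩
      rw [Matrix.mul_apply] at this
      simp only [Matrix.of_apply, dif_pos h, ← this]
      exact Finset.sum_congr rfl fun c _ => by simp [h.1, h.2]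
    · simp only [Matrix.of_apply, dif_neg h]
      refine Finset.sum_eq_zero fun c _ => ?_
      by_cases ha : a ∈ F
      · have hb : b ∉ F := fun hb => h ⟨ha, hb⟩
        simp [hb]
      · simp [ha]

variable {e : ι ≃ A × Z} {F : Finset A} {P : Matrix A A ℂ} {Y : Matrix ι ι ℂ}

/-- A finite block involves only finitely many indices of the second factor, so there the operation
is a conjugation K† Y' K of a finite block Y' of Y. -/
theorem Matrix.PosSemidef.sandwich (hY : Y.PosSemidef) (hP : IsProjOn F P) :
    (sandwich e F P Y).PosSemidef := by
  classical
  refine Matrix.posSemidef_of_finite_blocks fun G => ?_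
  let H : Type _ := F × (G.image fun i => (e i).2)
  let h : H → ι := fun x => e.symm (x.1.1, x.2.1)
  let K : Matrix H G ℂ := Matrix.of fun x i => if x.2.1 = (e i.1).2 then P x.1.1 (e i.1).1 else 0
  have := (hY.submatrix h).conjTranspose_mul_mul_same K
  convert this using 1
  ext i j
  have key : ∀ (k : G) (w : A → (G.image fun i => (e i).2) → ℂ),
      ∑ x : H, K x k * w x.1.1 x.2 = ∑ a ∈ F, P a (e k.1).1 *
        w a ⟨(e k.1).2, Finset.mem_image_of_mem (fun i => (e i).2) k.2⟩ := by
    intro k w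
    rw [Fintype.sum_prod_type, ← Finset.sum_coe_sort F]
    refine Finset.sum_congr rfl fun a _ => ?_
    rw [Finset.sum_eq_single ⟨(e k.1).2, Finset.mem_image_of_mem (fun i => (e i).2) k.2⟩]
    · simp [K]
    · intro b _ hb
      have : b.1 ≠ (e k.1).2 := fun h => hb (Subtype.ext h)
      simp [K, this]
    · simp
  have e1 : ∀ x, star (K x i) = star (K x i) * 1 := fun x => (mul_one _).symm
  simp only [Matrix.mul_apply, Matrix.conjTranspose_apply, Matrix.submatrix_apply]
  have step : ∀ y : H, (∑ x : H, star (K x i) * Y (h x) (h y))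
      = ∑ a ∈ F, P (e i.1).1 a * Y (e.symm (a, (e i.1).2)) (h y) := by
    intro y
    have := congrArg star (key i fun a z => star (Y (e.symm (a, z.1)) (h y)))
    rw [star_sum, star_sum] at this
    simp only [star_mul', star_star] at this
    refine this.trans (Finset.sum_congr rfl fun a _ => ?_)
    rw [hP.herm.apply]
  simp only [step]
  have := key j fun b z => ∑ a ∈ F, P (e i.1).1 a * Y (e.symm (a, (e i.1).2)) (e.symm (b, z.1))
  simp only [mul_comm (K _ _)] at this
  rw [this]
  simp only [_root_.sandwich, LinearMap.coe_mk, AddHom.coe_mk, Matrix.of_apply, Finset.mul_sum]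
  rw [Finset.sum_comm]
  exact Finset.sum_congr rfl fun a _ => Finset.sum_congr rfl fun b _ => by ring

theorem Matrix.PosSemidef.truncateOff (hY : Y.PosSemidef) :
    (truncateOff e F Y).PosSemidef := by
  classical
  refine Matrix.posSemidef_of_finite_blocks fun G => ?_
  let D : Matrix G G ℂ := Matrix.diagonal fun i => if (e i.1).1 ∉ F then 1 else 0
  have := (hY.submatrix (Subtype.val : G → ι)).conjTranspose_mul_mul_same D
  convert this using 1
  ext i j
  simp only [_root_.truncateOff, LinearMap.coe_mk, AddHom.coe_mk, Matrix.submatrix_apply,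
    Matrix.of_apply, D, Matrix.diagonal_conjTranspose, Matrix.mul_diagonal, Matrix.diagonal_mul,
    Pi.star_apply]
  by_cases hi : (e i.1).1 ∈ F <;> by_cases hj : (e j.1).1 ∈ F <;> simp [hi, hj]

/-- The twisted trace of `Y` along `(a, z) ↦ ((a, z), (a, φ z))` with weights `χ z`. -/
theorem hasSum_sandwich_twisted (hP : IsProjOn F P) (χ : Z → ℂ)
    (φ : Z → Z) (hφ : ∀ a b, Summable fun z => χ z * Y (e.symm (a, z)) (e.symm (b, φ z))) :
    HasSum (fun p : A × Z => χ p.2 * sandwich e F P Y (e.symm p) (e.symm (p.1, φ p.2)))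
      (∑ a ∈ F, ∑ b ∈ F, P b a * ∑' z, χ z * Y (e.symm (a, z)) (e.symm (b, φ z))) := by
  have h1 : HasSum (fun p : A × Z => χ p.2 * sandwich e F P Y (e.symm p) (e.symm (p.1, φ p.2)))
      (∑ c ∈ F, ∑ a ∈ F, ∑ b ∈ F, P b c * P c a * ∑' z, χ z * Y (e.symm (a, z))
        (e.symm (b, φ z))) := by
    refine hasSum_of_support_fst (fun c z hc => ?_) fun c hc => ?_
    · simp [sandwich, hP.support c _ hc]
    · have : ∀ z, χ z * sandwich e F P Y (e.symm (c, z)) (e.symm (c, φ z))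
          = ∑ a ∈ F, ∑ b ∈ F, P b c * P c a * (χ z * Y (e.symm (a, z)) (e.symm (b, φ z))) := by
        intro z
        simp only [sandwich, LinearMap.coe_mk, AddHom.coe_mk, Matrix.of_apply,
          Equiv.apply_symm_apply, Finset.mul_sum]
        exact Finset.sum_congr rfl fun a _ => Finset.sum_congr rfl fun b _ => by ring
      simp only [this]
      exact hasSum_sum fun a _ => hasSum_sum fun b _ => (hφ a b).hasSum.mul_left _
  -- The two copies of P meet in the sum over the traced index c, where idempotence merges them into
  -- one.
  convert h1 using 1
  symm
  rw [Finset.sum_comm]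
  refine Finset.sum_congr rfl fun a _ => ?_
  rw [Finset.sum_comm]
  refine Finset.sum_congr rfl fun b _ => ?_
  rw [← Finset.sum_mul, hP.idem]

theorem summable_truncateOff_twisted (χ : Z → ℂ) (φ : Z → Z)
    (hs : Summable fun p : A × Z => χ p.2 * Y (e.symm p) (e.symm (p.1, φ p.2))) :
    Summable fun p : A × Z => χ p.2 * truncateOff e F Y (e.symm p) (e.symm (p.1, φ p.2)) := by
  classical
  refine Summable.of_norm_bounded hs.norm fun p => ?_
  simp only [truncateOff, LinearMap.coe_mk, AddHom.coe_mk, Matrix.of_apply,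
    Equiv.apply_symm_apply]
  split_ifs
  · exact le_rfl
  · rw [mul_zero, norm_zero]; exact norm_nonneg _

/-- The weight χ and the twist φ touch only the unmeasured factor, so by cyclicity each projection
enters linearly, and P together with its complement adds up to the identity of the block. -/
theorem tsum_pinching (hP : IsProjOn F P) (χ : Z → ℂ) (φ : Z → Z)
    (hφ : ∀ a b, Summable fun z => χ z * Y (e.symm (a, z)) (e.symm (b, φ z)))
    (hs : Summable fun p : A × Z => χ p.2 * Y (e.symm p) (e.symm (p.1, φ p.2))) :
    (∑' p : A × Z, χ p.2 * sandwich e F P Y (e.symm p) (e.symm (p.1, φ p.2)))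
      + (∑' p : A × Z, χ p.2 * sandwich e F (blockProj F - P) Y (e.symm p)
          (e.symm (p.1, φ p.2)))
      + (∑' p : A × Z, χ p.2 * truncateOff e F Y (e.symm p) (e.symm (p.1, φ p.2)))
      = ∑' p : A × Z, χ p.2 * Y (e.symm p) (e.symm (p.1, φ p.2)) := by
  classical
  have h3 := summable_truncateOff_twisted (F := F) χ φ hs
  rw [(hasSum_sandwich_twisted hP χ φ hφ).tsum_eq,
    (hasSum_sandwich_twisted hP.compl χ φ hφ).tsum_eq]
  have h4 : HasSum (fun p : A × Z => χ p.2 * Y (e.symm p) (e.symm (p.1, φ p.2))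
      - χ p.2 * truncateOff e F Y (e.symm p) (e.symm (p.1, φ p.2)))
      (∑ a ∈ F, ∑' z, χ z * Y (e.symm (a, z)) (e.symm (a, φ z))) := by
    refine hasSum_of_support_fst (fun a z ha => ?_) fun a ha => ?_
    · simp [truncateOff, ha]
    · simpa [truncateOff, ha] using (hφ a a).hasSum
  have h5 := h4.tsum_eq
  rw [hs.tsum_sub h3] at h5
  have h6 : ∑ a ∈ F, ∑ b ∈ F, P b a * (∑' z, χ z * Y (e.symm (a, z)) (e.symm (b, φ z)))
      + ∑ a ∈ F, ∑ b ∈ F, (blockProj F - P) b a * (∑' z, χ z * Y (e.symm (a, z))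
        (e.symm (b, φ z))) = ∑ a ∈ F, ∑' z, χ z * Y (e.symm (a, z)) (e.symm (a, φ z)) := by
    rw [← Finset.sum_add_distrib]
    refine Finset.sum_congr rfl fun a ha => ?_
    rw [← Finset.sum_add_distrib]
    simp only [← add_mul, Matrix.sub_apply, add_sub_cancel]
    rw [Finset.sum_eq_single a]
    · simp [blockProj, ha]
    · intro b _ hb; simp [blockProj, hb]
    · exact fun h => absurd ha h
  rw [h6, ← h5]; ring

end Measurement

/-! ### Conditional maps and their effects. -/

section ConditionalMaps

variable {d : ℕ} {ι : Type*}

/-- Positive maps into trace class operators; these describe the unnormalised states conditioned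
on an outcome of a measurement. -/
structure IsCondMap (Ψ : Matrix (Fin d) (Fin d) ℂ →ₗ[ℂ] Matrix ι ι ℂ) : Prop where
  pos : ∀ X : Matrix (Fin d) (Fin d) ℂ, X.PosSemidef → (Ψ X).PosSemidef
  summable : ∀ X : Matrix (Fin d) (Fin d) ℂ, X.PosSemidef → Summable fun i => Ψ X i i

/-- The trace of a possibly infinite matrix. -/
noncomputable def diagTrace (Y : Matrix ι ι ℂ) : ℂ := ∑' i, Y i i

theorem IsChannel.isCondMap {Λ : Matrix (Fin d) (Fin d) ℂ →ₗ[ℂ] Matrix ι ι ℂ}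
    (hΛ : IsChannel Λ) : IsCondMap Λ where
  pos X hX := by
    have h := hΛ.completelyPositive 1 (X.submatrix Prod.fst Prod.fst) (hX.submatrix _)
    exact h.submatrix (fun i : ι => (i, (0 : Fin 1)))
  summable X _ := (hΛ.tracePreserving X).summable

/-- Extends summability from positive inputs to all inputs by linearity. -/
theorem Matrix.polarization (X : Matrix (Fin d) (Fin d) ℂ) :
    X = (4⁻¹ : ℂ) • ((X + 1)ᴴ * (X + 1)) + (4⁻¹ * Complex.I) •
        ((X + Complex.I • (1 : Matrix _ _ ℂ))ᴴ * (X + Complex.I • (1 : Matrix _ _ ℂ)))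
      + (-4⁻¹ : ℂ) • ((X - 1)ᴴ * (X - 1)) + (-4⁻¹ * Complex.I) •
        ((X - Complex.I • (1 : Matrix _ _ ℂ))ᴴ * (X - Complex.I • (1 : Matrix _ _ ℂ))) := by
  ext i j
  simp only [Matrix.conjTranspose_add, Matrix.conjTranspose_sub, Matrix.conjTranspose_smul,
    Matrix.conjTranspose_one, mul_add, add_mul, mul_sub, sub_mul, Matrix.add_apply,
    Matrix.sub_apply, Matrix.smul_apply, Matrix.smul_mul, Matrix.mul_smul, mul_one, one_mul,
    smul_eq_mul, Complex.star_def, Complex.conj_I]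
  ring_nf
  simp only [Complex.I_sq]
  ring

theorem IsCondMap.hasEnvelope {Ψ : Matrix (Fin d) (Fin d) ℂ →ₗ[ℂ] Matrix ι ι ℂ}
    (hΨ : IsCondMap Ψ) (X : Matrix (Fin d) (Fin d) ℂ) : HasEnvelope (Ψ X) := by
  have h : ∀ B : Matrix (Fin d) (Fin d) ℂ, HasEnvelope (Ψ (Bᴴ * B)) := fun B =>
    (hΨ.pos _ (Matrix.posSemidef_conjTranspose_mul_self B)).hasEnvelope
      (hΨ.summable _ (Matrix.posSemidef_conjTranspose_mul_self B))
  rw [X.polarization]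
  simp only [map_add, map_smul]
  exact ((((h _).smul _).add ((h _).smul _)).add ((h _).smul _)).add ((h _).smul _)

theorem HasEnvelope.summable_diag {Y : Matrix ι ι ℂ} (hY : HasEnvelope Y) :
    Summable fun i => Y i i :=
  hY.summable (f := id) (g := id) Function.injective_id Function.injective_id

theorem diagTrace_add {X Y : Matrix ι ι ℂ} (hX : HasEnvelope X) (hY : HasEnvelope Y) :
    diagTrace (X + Y) = diagTrace X + diagTrace Y :=
  hX.summable_diag.tsum_add hY.summable_diag

theorem diagTrace_smul (c : ℂ) (X : Matrix ι ι ℂ) : diagTrace (c • X) = c * diagTrace X :=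
  tsum_mul_left

/-- The effect on the input space: `tr (effect Ψ * X)` is the trace of `Ψ X`. -/
noncomputable def effect (Ψ : Matrix (Fin d) (Fin d) ℂ →ₗ[ℂ] Matrix ι ι ℂ) :
    Matrix (Fin d) (Fin d) ℂ := Matrix.of fun i j => diagTrace (Ψ (Matrix.single j i 1))

theorem IsCondMap.trace_effect_mul {Ψ : Matrix (Fin d) (Fin d) ℂ →ₗ[ℂ] Matrix ι ι ℂ}
    (hΨ : IsCondMap Ψ) (X : Matrix (Fin d) (Fin d) ℂ) :
    (effect Ψ * X).trace = diagTrace (Ψ X) := by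
  let T : Matrix (Fin d) (Fin d) ℂ →ₗ[ℂ] ℂ :=
    { toFun := fun X => diagTrace (Ψ X)
      map_add' := fun X Y => by
        rw [map_add, diagTrace_add (hΨ.hasEnvelope X) (hΨ.hasEnvelope Y)]
      map_smul' := fun c X => by rw [map_smul, diagTrace_smul]; rfl }
  have hT : ∀ X, diagTrace (Ψ X) = T X := fun X => rfl
  rw [hT]
  conv_rhs => rw [Matrix.matrix_eq_sum_single X]
  simp only [map_sum]
  have h1 : ∀ i j, T (Matrix.single i j (X i j)) = effect Ψ j i * X i j := fun i j => by
    have : Matrix.single i j (X i j) = (X i j) • Matrix.single i j (1 : ℂ) := by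
      rw [Matrix.smul_single, smul_eq_mul, mul_one]
    rw [this, map_smul, smul_eq_mul, mul_comm]; rfl
  simp only [h1, Matrix.trace, Matrix.diag, Matrix.mul_apply]
  exact Finset.sum_comm

theorem Matrix.PosSemidef.diagTrace_nonneg {Y : Matrix ι ι ℂ} (hY : Y.PosSemidef) :
    0 ≤ diagTrace Y := tsum_nonneg fun _ => hY.diag_nonneg

/-- Nonnegativity in ℂ includes being real, and a complex matrix with real quadratic form is
Hermitian. -/
theorem Matrix.posSemidef_of_quadForm_nonneg {M : Matrix (Fin d) (Fin d) ℂ}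
    (h : ∀ x : Fin d → ℂ, 0 ≤ star x ⬝ᵥ (M *ᵥ x)) : M.PosSemidef := by
  rw [Matrix.posSemidef_iff_dotProduct_mulVec]
  refine ⟨?_, h⟩
  rw [← Matrix.isSymmetric_toEuclideanLin_iff, LinearMap.isSymmetric_iff_inner_map_self_real]
  intro v
  have h1 := h v.ofLp
  have h2 : inner ℂ (Matrix.toEuclideanLin M v) v = star (star v.ofLp ⬝ᵥ (M *ᵥ v.ofLp)) := by
    rw [EuclideanSpace.inner_eq_star_dotProduct, Matrix.star_dotProduct, star_star]
    rw [dotProduct_comm]; rfl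
  rw [h2, Complex.conj_eq_iff_im]
  have := (Complex.le_def.1 h1).2
  simp only [Complex.zero_im] at this
  simp [← this]

theorem IsCondMap.effect_posSemidef {Ψ : Matrix (Fin d) (Fin d) ℂ →ₗ[ℂ] Matrix ι ι ℂ}
    (hΨ : IsCondMap Ψ) : (effect Ψ).PosSemidef := by
  refine Matrix.posSemidef_of_quadForm_nonneg fun x => ?_
  have h1 : star x ⬝ᵥ (effect Ψ *ᵥ x) = (effect Ψ * Matrix.vecMulVec x (star x)).trace := by
    rw [Matrix.mul_vecMulVec, Matrix.trace_vecMulVec, dotProduct_comm]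
  rw [h1, hΨ.trace_effect_mul]
  exact (hΨ.pos _ (Matrix.posSemidef_vecMulVec_self_star x)).diagTrace_nonneg

end ConditionalMaps

/-! ### Conditioning on the outcomes of a measurement. -/

section Refinement

variable {d : ℕ} {ι A Z : Type*} {Ψ : Matrix (Fin d) (Fin d) ℂ →ₗ[ℂ] Matrix ι ι ℂ}
  {e : ι ≃ A × Z} {F : Finset A} {P : Matrix A A ℂ}

theorem HasEnvelope.summable_slice {Y : Matrix ι ι ℂ} (hY : HasEnvelope Y) (a b : A) :
    Summable fun z => Y (e.symm (a, z)) (e.symm (b, z)) :=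
  hY.summable (fun _ _ h => (Prod.mk.inj (e.symm.injective h)).2)
    (fun _ _ h => (Prod.mk.inj (e.symm.injective h)).2)

theorem hasSum_diag_sandwich {Y : Matrix ι ι ℂ} (hY : HasEnvelope Y) (hP : IsProjOn F P) :
    HasSum (fun i => sandwich e F P Y i i)
      (∑ a ∈ F, ∑ b ∈ F, P b a * ∑' z, Y (e.symm (a, z)) (e.symm (b, z))) := by
  have h := hasSum_sandwich_twisted (e := e) (Y := Y) hP (fun _ => 1) id
    (by simpa using fun a b => hY.summable_slice a b)
  simp only [one_mul, id] at h
  exact e.symm.hasSum_iff.1 h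

theorem IsCondMap.comp_sandwich (hΨ : IsCondMap Ψ) (hP : IsProjOn F P) :
    IsCondMap (sandwich e F P ∘ₗ Ψ) where
  pos X hX := (hΨ.pos X hX).sandwich hP
  summable X _ := (hasSum_diag_sandwich (hΨ.hasEnvelope X) hP).summable

theorem IsCondMap.comp_truncateOff (hΨ : IsCondMap Ψ) :
    IsCondMap (truncateOff e F ∘ₗ Ψ) where
  pos X hX := (hΨ.pos X hX).truncateOff
  summable X _ := by
    refine Summable.of_norm_bounded (hΨ.hasEnvelope X).summable_diag.norm fun i => ?_
    simp only [truncateOff, LinearMap.coe_comp, LinearMap.coe_mk, AddHom.coe_mk,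
      Function.comp_apply, Matrix.of_apply]
    split_ifs
    · exact le_rfl
    · rw [norm_zero]; exact norm_nonneg _

theorem diagTrace_pinching {Y : Matrix ι ι ℂ} (hY : HasEnvelope Y) (hP : IsProjOn F P) :
    diagTrace (sandwich e F P Y) + diagTrace (sandwich e F (blockProj F - P) Y)
      + diagTrace (truncateOff e F Y) = diagTrace Y := by
  have h := tsum_pinching (e := e) (Y := Y) hP (fun _ => 1) id
    (by simpa using fun a b => hY.summable_slice a b)
    (by simpa [Function.comp_def] using e.symm.summable_iff.2 hY.summable_diag)
  simp only [one_mul, id] at h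
  have h1 : ∀ W : Matrix ι ι ℂ, diagTrace W = ∑' p : A × Z, W (e.symm p) (e.symm p) := fun W =>
    (e.symm.tsum_eq fun i => W i i).symm
  rw [h1, h1, h1, h1, h]

end Refinement

/-! ### Partial traces and no-signalling between disjoint sets of factors. -/

section PartialTrace

variable {n d : ℕ} {β : Fin n → Type*}

/-- Splitting an index into its part in `S` and its part off `S`. -/
abbrev splitIndex (β : Fin n → Type*) (S : Finset (Fin n)) :
    (∀ j, β j) ≃ (∀ j : S, β j) × (∀ j : {j // j ∉ S}, β j) :=
  Equiv.piEquivPiSubtypeProd (· ∈ S) β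

theorem partialTrace_apply (S : Finset (Fin n)) (X : Matrix (∀ j, β j) (∀ j, β j) ℂ)
    (x y : ∀ j : S, β j) : partialTrace S X x y
      = ∑' z, X ((splitIndex β S).symm (x, z)) ((splitIndex β S).symm (y, z)) := rfl

theorem partialTrace_add {X Y : Matrix (∀ j, β j) (∀ j, β j) ℂ} (hX : HasEnvelope X)
    (hY : HasEnvelope Y) (S : Finset (Fin n)) :
    partialTrace S (X + Y) = partialTrace S X + partialTrace S Y := by
  ext x y
  rw [Matrix.add_apply, partialTrace_apply, partialTrace_apply, partialTrace_apply]
  exact (hX.summable_slice x y).tsum_add (hY.summable_slice x y)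

theorem partialTrace_smul (c : ℂ) (X : Matrix (∀ j, β j) (∀ j, β j) ℂ) (S : Finset (Fin n)) :
    partialTrace S (c • X) = c • partialTrace S X := by
  ext x y
  rw [Matrix.smul_apply, partialTrace_apply, partialTrace_apply]
  exact tsum_mul_left

theorem Matrix.PosSemidef.partialTrace {X : Matrix (∀ j, β j) (∀ j, β j) ℂ} (hX : X.PosSemidef)
    (h : HasEnvelope X) (S : Finset (Fin n)) : (partialTrace S X).PosSemidef :=
  Matrix.posSemidef_tsum_submatrix hX (fun x z => (splitIndex β S).symm (x, z))
    fun a b => h.summable_slice a b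

theorem HasEnvelope.hasSum_partialTrace {X : Matrix (∀ j, β j) (∀ j, β j) ℂ}
    (h : HasEnvelope X) (S : Finset (Fin n)) :
    HasSum (fun x => partialTrace S X x x) (diagTrace X) := by
  have h1 := (splitIndex β S).symm.hasSum_iff.2 h.summable_diag.hasSum
  exact h1.prod_fiberwise fun x => (h.summable_slice x x).hasSum

variable {Ψ : Matrix (Fin d) (Fin d) ℂ →ₗ[ℂ] Matrix (∀ j, β j) (∀ j, β j) ℂ}

/-- The conditional map followed by the partial trace. -/
noncomputable def IsCondMap.marginal (hΨ : IsCondMap Ψ) (S : Finset (Fin n)) :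
    Matrix (Fin d) (Fin d) ℂ →ₗ[ℂ] Matrix (∀ j : S, β j) (∀ j : S, β j) ℂ where
  toFun X := partialTrace S (Ψ X)
  map_add' X Y := by rw [map_add, partialTrace_add (hΨ.hasEnvelope X) (hΨ.hasEnvelope Y)]
  map_smul' c X := by rw [map_smul, partialTrace_smul]; rfl

theorem IsChannel.marginal_isChannel (hΨ : IsChannel Ψ) (S : Finset (Fin n)) :
    IsChannel (hΨ.isCondMap.marginal S) where
  completelyPositive r X hX := by
    have h : ampliation (hΨ.isCondMap.marginal S) r X = Matrix.of fun a b => ∑' z,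
        ampliation Ψ r X ((splitIndex β S).symm (a.1, z), a.2)
          ((splitIndex β S).symm (b.1, z), b.2) := by
      ext a b; rfl
    rw [h]
    exact Matrix.posSemidef_tsum_submatrix (hΨ.completelyPositive r X hX)
      (fun (x : (∀ j : S, β j) × Fin r) z => ((splitIndex β S).symm (x.1, z), x.2))
      fun a b => (hΨ.isCondMap.hasEnvelope
        (Matrix.of fun p q => X (p, a.2) (q, b.2))).summable_slice a.1 b.1
  tracePreserving X := by
    have h := (hΨ.isCondMap.hasEnvelope X).hasSum_partialTrace S
    rwa [diagTrace, (hΨ.tracePreserving X).tsum_eq] at h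

theorem diagTrace_sandwich {X : Matrix (∀ j, β j) (∀ j, β j) ℂ} (hX : HasEnvelope X)
    {S : Finset (Fin n)} {F : Finset (∀ j : S, β j)}
    {P : Matrix (∀ j : S, β j) (∀ j : S, β j) ℂ} (hP : IsProjOn F P) :
    diagTrace (sandwich (splitIndex β S) F P X)
      = ∑ a ∈ F, ∑ b ∈ F, P b a * partialTrace S X a b :=
  (hasSum_diag_sandwich hX hP).tsum_eq

/-- A measurement of the factors in `S` does not change the state of the factors in a set `T`
disjoint from `S`. -/
theorem IsCondMap.partialTrace_pinching (hΨ : IsCondMap Ψ) (B : Matrix (Fin d) (Fin d) ℂ)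
    {S T : Finset (Fin n)} (hST : Disjoint S T) {F : Finset (∀ j : S, β j)}
    {P : Matrix (∀ j : S, β j) (∀ j : S, β j) ℂ} (hP : IsProjOn F P) :
    partialTrace T (sandwich (splitIndex β S) F P (Ψ B))
      + partialTrace T (sandwich (splitIndex β S) F (blockProj F - P) (Ψ B))
      + partialTrace T (truncateOff (splitIndex β S) F (Ψ B)) = partialTrace T (Ψ B) := by
  classical
  have hX := hΨ.hasEnvelope B
  have hX1 := (hΨ.comp_sandwich (e := splitIndex β S) hP).hasEnvelope B
  have hX2 := (hΨ.comp_sandwich (e := splitIndex β S) hP.compl).hasEnvelope B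
  have hX3 := (hΨ.comp_truncateOff (e := splitIndex β S) (F := F)).hasEnvelope B
  rw [LinearMap.comp_apply] at hX1 hX2 hX3
  generalize Ψ B = X at hX hX1 hX2 hX3 ⊢
  ext x y
  have hne : ∀ j : T, j.1 ∉ S := fun j hj => Finset.disjoint_left.1 hST hj j.2
  -- In coordinates split along S, the (x, y) entry of the partial trace of W onto T is the sum of
  -- W((a, u), (a, φ u)) over all a and all u that restrict to x on T; φ overwrites the coordinates
  -- in T by y.
  let χ : (∀ j : {j // j ∉ S}, β j) → ℂ := fun u => if (fun j : T => u ⟨j, hne j⟩) = x then 1 else 0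
  let φ : (∀ j : {j // j ∉ S}, β j) → (∀ j : {j // j ∉ S}, β j) := fun u j =>
    if h : j.1 ∈ T then y ⟨j, h⟩ else u j
  let e := splitIndex β S
  let f := splitIndex β T
  have key : ∀ W : Matrix (∀ j, β j) (∀ j, β j) ℂ, ∀ p, (χ p.2 * W (e.symm p) (e.symm (p.1, φ p.2)))
      = (if (f (e.symm p)).1 = x then 1 else 0) *
        W (e.symm p) (f.symm (y, (f (e.symm p)).2)) := by
    intro W p
    have h1 : (f (e.symm p)).1 = fun j : T => p.2 ⟨j, hne j⟩ := by
      funext j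
      simp [f, e, Equiv.piEquivPiSubtypeProd, hne j]
    have h2 : f.symm (y, (f (e.symm p)).2) = e.symm (p.1, φ p.2) := by
      funext j
      by_cases hT : j ∈ T
      · have hS : j ∉ S := hne ⟨j, hT⟩
        simp [f, e, Equiv.piEquivPiSubtypeProd, hT, hS, φ]
      · by_cases hS : j ∈ S
        · simp [f, e, Equiv.piEquivPiSubtypeProd, hT, hS]
        · simp [f, e, Equiv.piEquivPiSubtypeProd, hT, hS, φ]
    rw [h1, h2]
  have key2 : ∀ W : Matrix (∀ j, β j) (∀ j, β j) ℂ,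
      (Summable fun z => W (f.symm (x, z)) (f.symm (y, z))) →
      HasSum (fun p => χ p.2 * W (e.symm p) (e.symm (p.1, φ p.2))) (partialTrace T W x y) := by
    intro W hW
    simp only [key]
    have h1 : HasSum (fun q : (∀ j : T, β j) × (∀ j : {j // j ∉ T}, β j) =>
        (if q.1 = x then 1 else 0) * W (f.symm q) (f.symm (y, q.2))) (partialTrace T W x y) := by
      have := hasSum_of_support_fst (F := {x}) (s := fun _ => partialTrace T W x y)
        (f := fun q : (∀ j : T, β j) × (∀ j : {j // j ∉ T}, β j) =>
          (if q.1 = x then 1 else 0) * W (f.symm q) (f.symm (y, q.2)))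
        (fun a z ha => by simp [Finset.notMem_singleton.1 ha])
        (fun a ha => by
          rw [Finset.mem_singleton.1 ha]
          rw [partialTrace_apply]
          simpa [f] using hW.hasSum)
      simpa using this
    have h2 := (e.symm.trans f).hasSum_iff.2 h1
    simpa [Function.comp_def] using h2
  have hsl : ∀ W, HasEnvelope W → Summable fun z => W (f.symm (x, z)) (f.symm (y, z)) :=
    fun W hW => hW.summable_slice x y
  have hφ : ∀ a b, Summable fun z => χ z * X (e.symm (a, z)) (e.symm (b, φ z)) := by
    intro a b
    -- on the support of `χ` the map `φ` is injective
    let j : {u : ∀ j : {j // j ∉ S}, β j // (fun j : T => u ⟨j, hne j⟩) = x} →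
      (∀ j : {j // j ∉ S}, β j) := Subtype.val
    have hj : Function.Injective j := Subtype.val_injective
    have h0 : ∀ u, u ∉ Set.range j → χ u * X (e.symm (a, u)) (e.symm (b, φ u)) = 0 := by
      intro u hu
      have : ¬ (fun j : T => u ⟨j, hne j⟩) = x := fun h => hu ⟨⟨u, h⟩, rfl⟩
      simp [χ, this]
    rw [← hj.summable_iff h0]
    have h1 : Function.Injective fun u => e.symm (a, j u) := fun u v h =>
      hj (Prod.mk.inj (e.symm.injective h)).2
    have h2 : Function.Injective fun u => e.symm (b, φ (j u)) := fun u v h => by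
      have h3 := (Prod.mk.inj (e.symm.injective h)).2
      refine Subtype.ext (funext fun k => ?_)
      by_cases hk : k.1 ∈ T
      · exact congrFun (u.2.trans v.2.symm) ⟨k.1, hk⟩
      · have := congrFun h3 k
        simpa [φ, hk] using this
    refine (hX.summable h1 h2).congr fun u => ?_
    have := u.2
    simp only [Function.comp_apply, j, χ, this]
    simp
  have hs := (key2 X (hsl X hX)).summable
  have h := tsum_pinching (e := e) (Y := X) hP χ φ hφ hs
  rw [(key2 X (hsl X hX)).tsum_eq] at h
  rw [(key2 _ (hsl _ hX1)).tsum_eq, (key2 _ (hsl _ hX2)).tsum_eq,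
    (key2 _ (hsl _ hX3)).tsum_eq] at h
  exact h

end PartialTrace

/-! ### A Hermitian orthonormal basis of the matrix space. -/

section HermitianBasis

variable {d : ℕ} {ι : Type*}

/-- An orthonormal basis of the space of matrices which consists of Hermitian matrices. -/
noncomputable def hermBasis (p : Fin d × Fin d) : Matrix (Fin d) (Fin d) ℂ :=
  Matrix.single p.1 p.2 ((1 + Complex.I) / 2) + Matrix.single p.2 p.1 ((1 - Complex.I) / 2)

/-- The coordinates of a Hermitian matrix in the basis `hermBasis`. -/
def hermCoord (X : Matrix (Fin d) (Fin d) ℂ) (p : Fin d × Fin d) : ℝ :=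
  (X p.1 p.2).re + (X p.1 p.2).im

theorem trace_hermBasis_mul (p : Fin d × Fin d) (X : Matrix (Fin d) (Fin d) ℂ) :
    (hermBasis p * X).trace
      = (1 + Complex.I) / 2 * X p.2 p.1 + (1 - Complex.I) / 2 * X p.1 p.2 := by
  rw [hermBasis, add_mul, Matrix.trace_add, Matrix.trace_single_mul, Matrix.trace_single_mul,
    smul_eq_mul, smul_eq_mul]

theorem Matrix.IsHermitian.trace_mul_hermBasis {X : Matrix (Fin d) (Fin d) ℂ}
    (hX : X.IsHermitian) (p : Fin d × Fin d) :
    (X * hermBasis p).trace = (hermCoord X p : ℂ) := by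
  rw [Matrix.trace_mul_comm, trace_hermBasis_mul, ← hX.apply p.2 p.1, hermCoord]
  apply Complex.ext
  · simp; ring
  · simp; ring

theorem hermBasis_isHermitian (p : Fin d × Fin d) : (hermBasis p).IsHermitian := by
  unfold hermBasis
  rw [Matrix.IsHermitian, Matrix.conjTranspose_add, Matrix.conjTranspose_single,
    Matrix.conjTranspose_single, add_comm]
  congr 2 <;> simp [Complex.ext_iff]

theorem sum_hermBasis (X : Matrix (Fin d) (Fin d) ℂ) :
    ∑ p, (hermBasis p * X).trace • hermBasis p = X := by
  ext i j
  rw [Matrix.sum_apply]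
  simp only [Matrix.smul_apply, hermBasis, Matrix.add_apply, smul_eq_mul, mul_add,
    Finset.sum_add_distrib, Fintype.sum_prod_type]
  have h1 : ∀ (f : Fin d → Fin d → ℂ) (c : ℂ), ∑ x, ∑ y, f x y * Matrix.single x y c i j
      = f i j * c := by
    intro f c
    rw [Finset.sum_eq_single i, Finset.sum_eq_single j]
    · simp
    · intro b _ hb; simp [hb]
    · simp
    · intro b _ hb; exact Finset.sum_eq_zero fun y _ => by simp [hb]
    · simp
  have h2 : ∀ (f : Fin d → Fin d → ℂ) (c : ℂ), ∑ x, ∑ y, f x y * Matrix.single y x c i j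
      = f j i * c := by
    intro f c
    rw [Finset.sum_comm]
    exact h1 (fun y x => f x y) c
  have h3 := fun x y => trace_hermBasis_mul (x, y) X
  simp only [hermBasis] at h3
  rw [h1, h2, h3, h3]
  have hI : Complex.I * Complex.I = -1 := Complex.I_mul_I
  linear_combination (1/4 * X j i - 1/2 * X i j + 1/4 * X j i) * hI

/-- (Re + Im)² exceeds the squared modulus by 2 Re Im, which changes sign between the entries (p, q)
and (q, p). -/
theorem Matrix.IsHermitian.sum_norm_sq {X : Matrix (Fin d) (Fin d) ℂ} (hX : X.IsHermitian) :
    ∑ p, ∑ q, ‖X p q‖ ^ 2 = ∑ p, hermCoord X p ^ 2 := by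
  have h1 : ∑ p : Fin d, ∑ q, (X p q).re * (X p q).im = 0 := by
    have h2 : ∑ p : Fin d, ∑ q, (X p q).re * (X p q).im
        = - ∑ p : Fin d, ∑ q, (X p q).re * (X p q).im := by
      conv_lhs => rw [Finset.sum_comm]
      rw [← Finset.sum_neg_distrib]
      refine Finset.sum_congr rfl fun p _ => ?_
      rw [← Finset.sum_neg_distrib]
      refine Finset.sum_congr rfl fun q _ => ?_
      rw [← hX.apply q p]
      simp
    linarith
  have h2 : ∀ p q, ‖X p q‖ ^ 2 = hermCoord X (p, q) ^ 2 - 2 * ((X p q).re * (X p q).im) := by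
    intro p q
    rw [← Complex.normSq_eq_norm_sq, Complex.normSq_apply, hermCoord]; ring
  simp only [h2, Finset.sum_sub_distrib, ← Finset.mul_sum, h1, Fintype.sum_prod_type]
  ring

theorem sum_norm_sq_hermBasis (p : Fin d × Fin d) :
    ∑ i, ∑ j, ‖hermBasis p i j‖ ^ 2 = 1 := by
  have h := (hermBasis_isHermitian p).trace_mul_hermBasis p
  have h1 : (hermBasis p * hermBasis p).trace = ((∑ i, ∑ j, ‖hermBasis p i j‖ ^ 2 : ℝ) : ℂ) := by
    simp only [Matrix.trace, Matrix.diag, Matrix.mul_apply]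
    push_cast
    refine Finset.sum_congr rfl fun i _ => Finset.sum_congr rfl fun j _ => ?_
    rw [← (hermBasis_isHermitian p).apply j i, Complex.star_def, Complex.mul_conj,
      Complex.normSq_eq_norm_sq]
    push_cast; rfl
  rw [h1] at h
  have h2 : ∑ i, ∑ j, ‖hermBasis p i j‖ ^ 2 = hermCoord (hermBasis p) p := by exact_mod_cast h
  rw [h2, hermCoord, hermBasis]
  by_cases hp : p.1 = p.2
  · simp [hp]; norm_num
  · have hp' : p.2 ≠ p.1 := Ne.symm hp
    simp [hp, hp']; norm_num

theorem Matrix.PosSemidef.sum_hermCoord_sq_le {M : Matrix (Fin d) (Fin d) ℂ}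
    (hM : M.PosSemidef) : ∑ p, hermCoord M p ^ 2 ≤ M.trace.re ^ 2 := by
  rw [← hM.1.sum_norm_sq, sq, Matrix.trace, Complex.re_sum, Finset.sum_mul_sum]
  refine Finset.sum_le_sum fun i _ => Finset.sum_le_sum fun j _ => ?_
  have h := hM.norm_apply_le i j
  calc ‖M i j‖ ^ 2 ≤ (Real.sqrt (M i i).re * Real.sqrt (M j j).re) ^ 2 := by gcongr
    _ = (M i i).re * (M j j).re := by
      rw [mul_pow, Real.sq_sqrt (hM.re_diag_nonneg i), Real.sq_sqrt (hM.re_diag_nonneg j)]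

/-- Expansion of the input in the basis splits Φ into rank-one maps. Since the basis is Hermitian,
only Hermitian inputs of the defect need to be estimated, and its values there can be tested by
projections. -/
theorem diamondNorm_linear_le (Φ : Matrix (Fin d) (Fin d) ℂ →ₗ[ℂ] Matrix ι ι ℂ) :
    diamondNorm Φ ≤ ∑ p, traceNorm (Φ (hermBasis p)) := by
  have h : (Φ : Matrix (Fin d) (Fin d) ℂ → Matrix ι ι ℂ)
      = fun X => ∑ p, (hermBasis p * X).trace • Φ (hermBasis p) := by
    funext X
    conv_lhs => rw [← sum_hermBasis X]
    simp only [map_sum, map_smul]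
  refine (congrArg diamondNorm h).trans_le ?_
  refine (diamondNorm_sum_le _ _).trans (Finset.sum_le_sum fun p _ => ?_)
  have := diamondNorm_trace_smul_le zero_le_one (G := hermBasis p)
    (by rw [sum_norm_sq_hermBasis]; norm_num) (Φ (hermBasis p))
  simpa using this

theorem hermCoord_add (X Y : Matrix (Fin d) (Fin d) ℂ) (p : Fin d × Fin d) :
    hermCoord (X + Y) p = hermCoord X p + hermCoord Y p := by
  simp only [hermCoord, Matrix.add_apply, Complex.add_re, Complex.add_im]; ring

theorem hermCoord_smul (c : ℝ) (X : Matrix (Fin d) (Fin d) ℂ) (p : Fin d × Fin d) :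
    hermCoord ((c : ℂ) • X) p = c * hermCoord X p := by
  simp [hermCoord]; ring

end HermitianBasis

/-! ### Posteriors, defects and the martingale identity. -/

section Children

variable {n d : ℕ} {β : Fin n → Type*}

/-- Bundled conditional maps. -/
abbrev CondMap (d : ℕ) {n : ℕ} (β : Fin n → Type*) :=
  {Ψ : Matrix (Fin d) (Fin d) ℂ →ₗ[ℂ] Matrix (∀ j, β j) (∀ j, β j) ℂ // IsCondMap Ψ}

namespace CondMap

/-- The effect of a conditional map. -/
noncomputable def eff (Ψ : CondMap d β) : Matrix (Fin d) (Fin d) ℂ := effect Ψ.1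

/-- The weight of a conditional map: `d` times the probability of the outcome if the input is
maximally mixed. -/
noncomputable def weight (Ψ : CondMap d β) : ℝ := Ψ.eff.trace.re

/-- The coordinates of the normalised effect. -/
noncomputable def posterior (Ψ : CondMap d β) (p : Fin d × Fin d) : ℝ :=
  hermCoord Ψ.eff p / Ψ.weight

/-- The state of the factors in `S`, for the maximally mixed input, up to normalisation. -/
noncomputable def state (Ψ : CondMap d β) (S : Finset (Fin n)) :
    Matrix (∀ j : S, β j) (∀ j : S, β j) ℂ := partialTrace S (Ψ.1 1)

theorem eff_posSemidef (Ψ : CondMap d β) : Ψ.eff.PosSemidef := Ψ.2.effect_posSemidef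

theorem weight_nonneg (Ψ : CondMap d β) : 0 ≤ Ψ.weight :=
  (Complex.le_def.1 Ψ.eff_posSemidef.trace_nonneg).1

theorem coe_weight (Ψ : CondMap d β) : (Ψ.weight : ℂ) = Ψ.eff.trace :=
  Complex.ext rfl (by simpa using (Complex.le_def.1 Ψ.eff_posSemidef.trace_nonneg).2)

theorem eff_eq_zero (Ψ : CondMap d β) (h : Ψ.weight = 0) : Ψ.eff = 0 :=
  Ψ.eff_posSemidef.trace_eq_zero_iff.1 (by rw [← coe_weight, h, Complex.ofReal_zero])

/-- For weight 0 the effect vanishes, so the value 0 given to the posterior by division by zero is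
harmless. -/
theorem weight_mul_posterior (Ψ : CondMap d β) (p : Fin d × Fin d) :
    Ψ.weight * Ψ.posterior p = hermCoord Ψ.eff p := by
  by_cases h : Ψ.weight = 0
  · rw [h, Ψ.eff_eq_zero h]; simp [hermCoord]
  · rw [posterior, mul_div_cancel₀ _ h]

theorem sum_posterior_sq_le (Ψ : CondMap d β) : ∑ p, Ψ.posterior p ^ 2 ≤ 1 := by
  simp only [posterior, div_pow, ← Finset.sum_div]
  refine div_le_one_of_le₀ ?_ (sq_nonneg _)
  exact Ψ.eff_posSemidef.sum_hermCoord_sq_le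

theorem diagTrace_apply (Ψ : CondMap d β) (X : Matrix (Fin d) (Fin d) ℂ) :
    diagTrace (Ψ.1 X) = (Ψ.eff * X).trace := (Ψ.2.trace_effect_mul X).symm

theorem state_posSemidef (Ψ : CondMap d β) (S : Finset (Fin n)) : (Ψ.state S).PosSemidef :=
  (Ψ.2.pos _ Matrix.PosSemidef.one).partialTrace (Ψ.2.hasEnvelope _) S

theorem hasSum_state (Ψ : CondMap d β) (S : Finset (Fin n)) :
    HasSum (fun x => Ψ.state S x x) (Ψ.weight : ℂ) := by
  have h := (Ψ.2.hasEnvelope 1).hasSum_partialTrace S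
  rwa [diagTrace_apply, mul_one, ← coe_weight] at h

theorem traceNorm_state_le (Ψ : CondMap d β) (S : Finset (Fin n)) :
    traceNorm (Ψ.state S) ≤ ENNReal.ofReal Ψ.weight := by
  refine (Ψ.state_posSemidef S).traceNorm_le ?_
  have := Complex.hasSum_re (Ψ.hasSum_state S)
  simpa using this

/-- The defect of the product approximation for the factors in `S`. -/
noncomputable def defect (Ψ : CondMap d β) (S : Finset (Fin n)) :
    Matrix (Fin d) (Fin d) ℂ →ₗ[ℂ] Matrix (∀ j : S, β j) (∀ j : S, β j) ℂ where
  toFun X := partialTrace S (Ψ.1 X) - ((Ψ.eff * X).trace / Ψ.weight) • Ψ.state S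
  map_add' X Y := by
    rw [map_add, partialTrace_add (Ψ.2.hasEnvelope X) (Ψ.2.hasEnvelope Y), mul_add,
      Matrix.trace_add, add_div, add_smul]
    abel
  map_smul' c X := by
    rw [map_smul, partialTrace_smul, mul_smul_comm, Matrix.trace_smul, RingHom.id_apply,
      smul_sub, smul_smul, smul_eq_mul, mul_div_assoc]

theorem defect_apply (Ψ : CondMap d β) (S : Finset (Fin n)) (X : Matrix (Fin d) (Fin d) ℂ) :
    Ψ.defect S X
      = partialTrace S (Ψ.1 X) - ((Ψ.eff * X).trace / Ψ.weight) • Ψ.state S := rfl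

end CondMap

/-- A two-outcome projective measurement on a finite block of basis vectors of the factors in `S`;
the third outcome is to be off the block. -/
structure LocalMeasurement (β : Fin n → Type*) (S : Finset (Fin n)) where
  block : Finset (∀ j : S, β j)
  proj : Matrix (∀ j : S, β j) (∀ j : S, β j) ℂ
  isProjOn : IsProjOn block proj

namespace CondMap

variable {S : Finset (Fin n)}

/-- Conditioning on the outcome of the projection. -/
def accept (μ : LocalMeasurement β S) (Ψ : CondMap d β) : CondMap d β :=
  ⟨sandwich (splitIndex β S) μ.block μ.proj ∘ₗ Ψ.1, Ψ.2.comp_sandwich μ.isProjOn⟩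

/-- Conditioning on the outcome of the complementary projection within the block. -/
noncomputable def reject (μ : LocalMeasurement β S) (Ψ : CondMap d β) : CondMap d β :=
  ⟨sandwich (splitIndex β S) μ.block (blockProj μ.block - μ.proj) ∘ₗ Ψ.1,
    Ψ.2.comp_sandwich μ.isProjOn.compl⟩

/-- Conditioning on being off the block. -/
noncomputable def outside (μ : LocalMeasurement β S) (Ψ : CondMap d β) : CondMap d β :=
  ⟨truncateOff (splitIndex β S) μ.block ∘ₗ Ψ.1, Ψ.2.comp_truncateOff⟩

/-- The conditional maps for the outcomes of a local measurement. -/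
noncomputable def children (μ : LocalMeasurement β S) (Ψ : CondMap d β) : List (CondMap d β) :=
  [Ψ.accept μ, Ψ.reject μ, Ψ.outside μ]

theorem eff_ext {M N : Matrix (Fin d) (Fin d) ℂ}
    (h : ∀ X, (M * X).trace = (N * X).trace) : M = N := by
  ext i j
  have := h (Matrix.single j i 1)
  rwa [Matrix.trace_mul_comm, Matrix.trace_mul_comm N, Matrix.trace_single_mul,
    Matrix.trace_single_mul, one_smul, one_smul] at this

theorem eff_children (μ : LocalMeasurement β S) (Ψ : CondMap d β) :
    (Ψ.accept μ).eff + (Ψ.reject μ).eff + (Ψ.outside μ).eff = Ψ.eff := by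
  refine eff_ext fun X => ?_
  rw [add_mul, add_mul, Matrix.trace_add, Matrix.trace_add, ← diagTrace_apply, ← diagTrace_apply,
    ← diagTrace_apply, ← diagTrace_apply]
  exact diagTrace_pinching (Ψ.2.hasEnvelope X) μ.isProjOn

theorem weight_children (μ : LocalMeasurement β S) (Ψ : CondMap d β) :
    (Ψ.accept μ).weight + (Ψ.reject μ).weight + (Ψ.outside μ).weight = Ψ.weight := by
  simp only [weight, ← Complex.add_re, ← Matrix.trace_add, eff_children]

theorem partialTrace_children (μ : LocalMeasurement β S) (Ψ : CondMap d β)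
    {T : Finset (Fin n)} (hST : Disjoint S T) (X : Matrix (Fin d) (Fin d) ℂ) :
    partialTrace T ((Ψ.accept μ).1 X) + partialTrace T ((Ψ.reject μ).1 X)
      + partialTrace T ((Ψ.outside μ).1 X) = partialTrace T (Ψ.1 X) :=
  Ψ.2.partialTrace_pinching X hST μ.isProjOn

/-- The squared distance of the posteriors. -/
noncomputable def sqDist (Ψ Ψ' : CondMap d β) : ℝ :=
  ∑ p, (Ψ'.posterior p - Ψ.posterior p) ^ 2

theorem sqDist_nonneg (Ψ Ψ' : CondMap d β) : 0 ≤ sqDist Ψ Ψ' :=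
  Finset.sum_nonneg fun _ _ => sq_nonneg _

/-- The weighted second moment of the posterior. -/
noncomputable def moment (Ψ : CondMap d β) : ℝ := Ψ.weight * ∑ p, Ψ.posterior p ^ 2

theorem moment_nonneg (Ψ : CondMap d β) : 0 ≤ Ψ.moment :=
  mul_nonneg Ψ.weight_nonneg (Finset.sum_nonneg fun _ _ => sq_nonneg _)

theorem moment_le (Ψ : CondMap d β) : Ψ.moment ≤ Ψ.weight := by
  have := mul_le_mul_of_nonneg_left Ψ.sum_posterior_sq_le Ψ.weight_nonneg
  rwa [mul_one] at this

/-- The posterior of Ψ is the weighted mean of those of its children, so the variance is the gain in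
second moment. -/
theorem sum_weight_mul_sqDist (μ : LocalMeasurement β S) (Ψ : CondMap d β) :
    ((Ψ.children μ).map fun Ψ' => Ψ'.weight * sqDist Ψ Ψ').sum
      = ((Ψ.children μ).map moment).sum - Ψ.moment := by
  simp only [children, List.map_cons, List.map_nil, List.sum_cons, List.sum_nil, add_zero]
  have hw := weight_children μ Ψ
  have hc : ∀ p, (Ψ.accept μ).weight * (Ψ.accept μ).posterior p
      + (Ψ.reject μ).weight * (Ψ.reject μ).posterior p
      + (Ψ.outside μ).weight * (Ψ.outside μ).posterior p = Ψ.weight * Ψ.posterior p := fun p => by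
    simp only [weight_mul_posterior, ← hermCoord_add, eff_children]
  simp only [sqDist, moment, Finset.mul_sum, ← Finset.sum_add_distrib, ← Finset.sum_sub_distrib]
  refine Finset.sum_congr rfl fun p _ => ?_
  linear_combination (-2 * Ψ.posterior p) * hc p + Ψ.posterior p ^ 2 * hw

end CondMap

end Children

/-! ### A large defect is detected by a local measurement. -/

section Measurement

variable {n d : ℕ} {β : Fin n → Type*}

theorem Matrix.IsHermitian.exists_posSemidef_sub {X : Matrix (Fin d) (Fin d) ℂ}
    (hX : X.IsHermitian) : ∃ A B : Matrix (Fin d) (Fin d) ℂ,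
      A.PosSemidef ∧ B.PosSemidef ∧ X = A - B :=
  ⟨X⁺, X⁻, Matrix.nonneg_iff_posSemidef.1 (CFC.posPart_nonneg X),
    Matrix.nonneg_iff_posSemidef.1 (CFC.negPart_nonneg X), (CFC.posPart_sub_negPart X hX).symm⟩

namespace CondMap

variable {S : Finset (Fin n)}

theorem trace_eff_mul_nonneg (Ψ : CondMap d β) {X : Matrix (Fin d) (Fin d) ℂ} (hX : X.PosSemidef) :
    0 ≤ (Ψ.eff * X).trace := by
  rw [← diagTrace_apply]
  exact (Ψ.2.pos X hX).diagTrace_nonneg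

theorem defect_isHermitian (Ψ : CondMap d β) (S : Finset (Fin n))
    {X : Matrix (Fin d) (Fin d) ℂ} (hX : X.IsHermitian) : (Ψ.defect S X).IsHermitian := by
  obtain ⟨A, B, hA, hB, rfl⟩ := hX.exists_posSemidef_sub
  have h : ∀ A : Matrix (Fin d) (Fin d) ℂ, A.PosSemidef → (Ψ.defect S A).IsHermitian := by
    intro A hA
    rw [defect_apply]
    refine ((Ψ.2.pos A hA).partialTrace (Ψ.2.hasEnvelope A) S).1.sub ?_
    refine (Matrix.PosSemidef.smul (Ψ.state_posSemidef S) ?_).1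
    rw [div_eq_mul_inv]
    refine mul_nonneg (Ψ.trace_eff_mul_nonneg hA) ?_
    rw [← Complex.ofReal_inv]
    exact Complex.zero_le_real.2 (inv_nonneg.2 Ψ.weight_nonneg)
  rw [map_sub]
  exact (h A hA).sub (h B hB)

theorem traceNorm_defect_lt_top (Ψ : CondMap d β) (S : Finset (Fin n))
    {X : Matrix (Fin d) (Fin d) ℂ} (hX : X.IsHermitian) : traceNorm (Ψ.defect S X) < ⊤ := by
  obtain ⟨A, B, hA, hB, rfl⟩ := hX.exists_posSemidef_sub
  have hsub : ∀ {κ : Type _} (Y Z : Matrix κ κ ℂ), traceNorm Y < ⊤ → traceNorm Z < ⊤ →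
      traceNorm (Y - Z) < ⊤ := by
    intro κ Y Z hY hZ
    rw [sub_eq_add_neg]
    exact (traceNorm_add_le _ _).trans_lt
      (ENNReal.add_lt_top.2 ⟨hY, (traceNorm_neg_le Z).trans_lt hZ⟩)
  have h : ∀ A : Matrix (Fin d) (Fin d) ℂ, A.PosSemidef → traceNorm (Ψ.defect S A) < ⊤ := by
    intro A hA
    rw [defect_apply]
    refine hsub _ _ ?_ ?_
    · refine (((Ψ.2.pos A hA).partialTrace (Ψ.2.hasEnvelope A) S).traceNorm_le
        (a := (diagTrace (Ψ.1 A)).re) ?_).trans_lt ENNReal.ofReal_lt_top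
      exact Complex.hasSum_re ((Ψ.2.hasEnvelope A).hasSum_partialTrace S)
    · exact (traceNorm_smul_le _ _).trans_lt (ENNReal.mul_lt_top ENNReal.ofReal_lt_top
        ((Ψ.traceNorm_state_le S).trans_lt ENNReal.ofReal_lt_top))
  rw [map_sub]
  exact hsub _ _ (h A hA) (h B hB)

/-- The total defect of a list of conditional maps. -/
noncomputable def totalDefect (L : List (CondMap d β)) (S : Finset (Fin n)) :
    Matrix (Fin d) (Fin d) ℂ →ₗ[ℂ] Matrix (∀ j : S, β j) (∀ j : S, β j) ℂ :=
  (L.map fun Ψ => Ψ.defect S).sum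

theorem totalDefect_isHermitian (L : List (CondMap d β)) (S : Finset (Fin n))
    {X : Matrix (Fin d) (Fin d) ℂ} (hX : X.IsHermitian) : (totalDefect L S X).IsHermitian := by
  induction L with
  | nil => simp [totalDefect]
  | cons Ψ L ih =>
    simp only [totalDefect, List.map_cons, List.sum_cons, LinearMap.add_apply] at ih ⊢
    exact (Ψ.defect_isHermitian S hX).add ih

theorem traceNorm_totalDefect_lt_top (L : List (CondMap d β)) (S : Finset (Fin n))
    {X : Matrix (Fin d) (Fin d) ℂ} (hX : X.IsHermitian) : traceNorm (totalDefect L S X) < ⊤ := by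
  induction L with
  | nil => simp [totalDefect, traceNorm_zero]
  | cons Ψ L ih =>
    simp only [totalDefect, List.map_cons, List.sum_cons, LinearMap.add_apply] at ih ⊢
    exact (traceNorm_add_le _ _).trans_lt
      (ENNReal.add_lt_top.2 ⟨Ψ.traceNorm_defect_lt_top S hX, ih⟩)

theorem weight_mul_sqrt_nonneg (Ψ Ψ' : CondMap d β) : 0 ≤ Ψ'.weight * Real.sqrt (sqDist Ψ Ψ') :=
  mul_nonneg Ψ'.weight_nonneg (Real.sqrt_nonneg _)

/-- The weighted distance by which a local measurement moves the posteriors. -/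
noncomputable def increment (μ : LocalMeasurement β S) (L : List (CondMap d β)) : ℝ :=
  (L.map fun Ψ => ((Ψ.children μ).map fun Ψ' => Ψ'.weight * Real.sqrt (sqDist Ψ Ψ')).sum).sum

theorem increment_nonneg (μ : LocalMeasurement β S) (L : List (CondMap d β)) :
    0 ≤ increment μ L := by
  refine List.sum_nonneg fun x hx => ?_
  obtain ⟨Ψ, -, rfl⟩ := List.mem_map.1 hx
  refine List.sum_nonneg fun x hx => ?_
  obtain ⟨Ψ', -, rfl⟩ := List.mem_map.1 hx
  exact weight_mul_sqrt_nonneg _ _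

/-- The trace of the product of a block of `T` with `P`. -/
def blockPairing {κ : Type*} (F : Finset κ) (P T : Matrix κ κ ℂ) : ℂ :=
  ∑ a ∈ F, ∑ b ∈ F, P b a * T a b

/-- Pairing the marginal of Ψ(X) with P gives tr(E' X), where E' is the effect after acceptance. At
X = 1 this is the new weight, so the subtracted product term contributes the new weight times the
old posterior. -/
theorem blockPairing_defect (Ψ Ψ' : CondMap d β) {F : Finset (∀ j : S, β j)}
    {P : Matrix (∀ j : S, β j) (∀ j : S, β j) ℂ} (hP : IsProjOn F P)
    (h : Ψ'.1 = sandwich (splitIndex β S) F P ∘ₗ Ψ.1) (p : Fin d × Fin d) :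
    blockPairing F P (Ψ.defect S (hermBasis p))
      = ((Ψ'.weight * (Ψ'.posterior p - Ψ.posterior p) : ℝ) : ℂ) := by
  have key : ∀ X, blockPairing F P (partialTrace S (Ψ.1 X)) = (Ψ'.eff * X).trace := by
    intro X
    rw [blockPairing, ← diagTrace_sandwich (Ψ.2.hasEnvelope X) hP, ← diagTrace_apply, h]
    rfl
  have h1 : blockPairing F P (Ψ.defect S (hermBasis p))
      = blockPairing F P (partialTrace S (Ψ.1 (hermBasis p)))
        - (Ψ.eff * hermBasis p).trace / Ψ.weight * blockPairing F P (Ψ.state S) := by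
    simp only [blockPairing, defect_apply, Matrix.sub_apply, Matrix.smul_apply, smul_eq_mul,
      mul_sub, Finset.sum_sub_distrib, Finset.mul_sum]
    congr 1
    refine Finset.sum_congr rfl fun a _ => Finset.sum_congr rfl fun b _ => by ring
  rw [h1, state, key, key, mul_one, ← coe_weight, Ψ.eff_posSemidef.1.trace_mul_hermBasis,
    Ψ'.eff_posSemidef.1.trace_mul_hermBasis, ← weight_mul_posterior Ψ', posterior, posterior]
  push_cast
  ring

theorem abs_sub_posterior_le (Ψ Ψ' : CondMap d β) (p : Fin d × Fin d) :
    |Ψ'.posterior p - Ψ.posterior p| ≤ Real.sqrt (sqDist Ψ Ψ') := by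
  refine Real.abs_le_sqrt ?_
  exact Finset.single_le_sum (f := fun p => (Ψ'.posterior p - Ψ.posterior p) ^ 2)
    (fun _ _ => sq_nonneg _) (Finset.mem_univ p)

theorem abs_re_blockPairing_defect_le (Ψ Ψ' : CondMap d β) {F : Finset (∀ j : S, β j)}
    {P : Matrix (∀ j : S, β j) (∀ j : S, β j) ℂ} (hP : IsProjOn F P)
    (h : Ψ'.1 = sandwich (splitIndex β S) F P ∘ₗ Ψ.1) (p : Fin d × Fin d) :
    |(blockPairing F P (Ψ.defect S (hermBasis p))).re|
      ≤ Ψ'.weight * Real.sqrt (sqDist Ψ Ψ') := by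
  rw [blockPairing_defect Ψ Ψ' hP h, Complex.ofReal_re, abs_mul, abs_of_nonneg Ψ'.weight_nonneg]
  exact mul_le_mul_of_nonneg_left (abs_sub_posterior_le _ _ _) Ψ'.weight_nonneg

/-- The defects are summed before the measurement is chosen, so one projection serves all members of
the list. The outcome off the block only enlarges the right-hand side. -/
theorem blockPairing_totalDefect_le (μ : LocalMeasurement β S) (L : List (CondMap d β))
    (p : Fin d × Fin d) :
    (blockPairing μ.block μ.proj (totalDefect L S (hermBasis p))).re
      - (blockPairing μ.block (blockProj μ.block - μ.proj) (totalDefect L S (hermBasis p))).re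
      ≤ increment μ L := by
  induction L with
  | nil => simp [blockPairing, totalDefect, increment]
  | cons Ψ L ih =>
    have hadd : ∀ P : Matrix (∀ j : S, β j) (∀ j : S, β j) ℂ,
        (blockPairing μ.block P (totalDefect (Ψ :: L) S (hermBasis p))).re
        = (blockPairing μ.block P (Ψ.defect S (hermBasis p))).re
          + (blockPairing μ.block P (totalDefect L S (hermBasis p))).re := by
      intro P
      simp only [totalDefect, List.map_cons, List.sum_cons, LinearMap.add_apply, blockPairing,
        Matrix.add_apply, mul_add, Finset.sum_add_distrib, Complex.add_re]
    have h1 := abs_le.1 (abs_re_blockPairing_defect_le Ψ (Ψ.accept μ) μ.isProjOn rfl p)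
    have h2 := abs_le.1 (abs_re_blockPairing_defect_le Ψ (Ψ.reject μ) μ.isProjOn.compl rfl p)
    have h3 := weight_mul_sqrt_nonneg Ψ (Ψ.outside μ)
    have h4 : increment μ (Ψ :: L) = (Ψ.accept μ).weight * Real.sqrt (sqDist Ψ (Ψ.accept μ))
        + ((Ψ.reject μ).weight * Real.sqrt (sqDist Ψ (Ψ.reject μ))
        + (Ψ.outside μ).weight * Real.sqrt (sqDist Ψ (Ψ.outside μ))) + increment μ L := by
      simp [increment, children]
    rw [hadd, hadd, h4]
    linarith [h1.1, h1.2, h2.1, h2.2]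

/-- If the trace norm is infinite, its `toReal` is 0 and every block will do. -/
theorem exists_block_le {κ : Type*} (T : Matrix κ κ ℂ) {ε : ℝ}
    (hε : 0 < ε) : ∃ F : Finset κ, (traceNorm T).toReal - ε
      ≤ finTraceNorm (T.submatrix (Subtype.val : F → κ) (Subtype.val : F → κ)) := by
  by_contra! h
  have h0 := (finTraceNorm_nonneg _).trans_lt (h ∅)
  have h1 : traceNorm T ≤ ENNReal.ofReal ((traceNorm T).toReal - ε) :=
    traceNorm_le_iff.2 fun F => ENNReal.ofReal_le_ofReal (h F).le
  have h2 := ENNReal.toReal_mono ENNReal.ofReal_ne_top h1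
  rw [ENNReal.toReal_ofReal h0.le] at h2
  linarith

open Classical in
theorem exists_localMeasurement_of_isHermitian (T : Matrix (∀ j : S, β j) (∀ j : S, β j) ℂ)
    (hT : T.IsHermitian) {ε : ℝ} (hε : 0 < ε) :
    ∃ μ : LocalMeasurement β S, (traceNorm T).toReal - ε
      ≤ (blockPairing μ.block μ.proj T).re
        - (blockPairing μ.block (blockProj μ.block - μ.proj) T).re := by
  obtain ⟨F, hF⟩ := exists_block_le T hε
  obtain ⟨P, hP, hPP, h⟩ :=
    (hT.submatrix (Subtype.val : F → ∀ j : S, β j)).exists_projection_finTraceNorm_eq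
  refine ⟨⟨F, _, isProjOn_extend hP hPP⟩, hF.trans ?_⟩
  have h1 : (P * T.submatrix (Subtype.val : F → ∀ j : S, β j) Subtype.val).trace
      = blockPairing F (Matrix.of fun a b =>
      if h : a ∈ F ∧ b ∈ F then P ⟨a, h.1⟩ ⟨b, h.2⟩ else 0) T := by
    rw [Matrix.trace_mul_comm]
    simp only [blockPairing, Matrix.trace, Matrix.diag, Matrix.mul_apply, Matrix.submatrix_apply]
    rw [← Finset.sum_coe_sort F]
    refine Finset.sum_congr rfl fun a _ => ?_
    rw [← Finset.sum_coe_sort F]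
    refine Finset.sum_congr rfl fun b _ => ?_
    rw [Matrix.of_apply, dif_pos ⟨b.2, a.2⟩, mul_comm]
  have h2 : (T.submatrix (Subtype.val : F → ∀ j : S, β j) Subtype.val).trace
      = blockPairing F (blockProj F) T := by
    simp only [blockPairing, Matrix.trace, Matrix.diag, Matrix.submatrix_apply, blockProj,
      Matrix.of_apply]
    rw [← Finset.sum_coe_sort F]
    refine Finset.sum_congr rfl fun a _ => ?_
    rw [Finset.sum_eq_single a.1]
    · simp
    · intro b _ hb; simp [hb]
    · simp
  have h3 : ∀ Q : Matrix (∀ j : S, β j) (∀ j : S, β j) ℂ, blockPairing F (blockProj F - Q) T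
      = blockPairing F (blockProj F) T - blockPairing F Q T := by
    intro Q
    simp [blockPairing, sub_mul, Finset.sum_sub_distrib]
  rw [h, sub_mul, one_mul, Matrix.trace_sub, h2, h1, h3]

/-- Some local measurement moves the posteriors at least as much as the defect demands. -/
theorem exists_localMeasurement (L : List (CondMap d β)) (S : Finset (Fin n)) {ε : ℝ}
    (hε : 0 < ε) : ∃ μ : LocalMeasurement β S, ∑ p, traceNorm (totalDefect L S (hermBasis p))
      ≤ ENNReal.ofReal ((d : ℝ) ^ 2 * (increment μ L + ε)) := by
  rcases Nat.eq_zero_or_pos d with rfl | hd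
  · exact ⟨⟨∅, 0, ⟨by simp, by simp, by simp⟩⟩, by simp⟩
  have : Nonempty (Fin d × Fin d) := ⟨(⟨0, hd⟩, ⟨0, hd⟩)⟩
  -- Only the basis element with the largest defect is tested; bounding all the others by it costs
  -- the factor d².
  obtain ⟨p, -, hp⟩ := Finset.exists_max_image Finset.univ
    (fun p => traceNorm (totalDefect L S (hermBasis p))) Finset.univ_nonempty
  have hfin := traceNorm_totalDefect_lt_top L S (hermBasis_isHermitian p)
  obtain ⟨μ, hμ⟩ := exists_localMeasurement_of_isHermitian _
    (totalDefect_isHermitian L S (hermBasis_isHermitian p)) hε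
  refine ⟨μ, ?_⟩
  have h1 := blockPairing_totalDefect_le μ L p
  calc ∑ p, traceNorm (totalDefect L S (hermBasis p))
      ≤ ∑ _q : Fin d × Fin d, traceNorm (totalDefect L S (hermBasis p)) :=
        Finset.sum_le_sum fun q _ => hp q (Finset.mem_univ q)
    _ = (d : ℝ≥0∞) ^ 2 * traceNorm (totalDefect L S (hermBasis p)) := by
        simp [sq]
    _ ≤ (d : ℝ≥0∞) ^ 2 * ENNReal.ofReal (increment μ L + ε) := by
        gcongr
        exact (ENNReal.le_ofReal_iff_toReal_le hfin.ne
          (add_nonneg (increment_nonneg μ L) hε.le)).2 (by linarith)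
    _ = ENNReal.ofReal ((d : ℝ) ^ 2 * (increment μ L + ε)) := by
        rw [ENNReal.ofReal_mul (by positivity), ENNReal.ofReal_pow (by positivity),
          ENNReal.ofReal_natCast]

end CondMap

end Measurement

/-! ### Counting sequences of disjoint t-sets. -/

section Packings

variable {n : ℕ}

/-- The union of a list of sets. -/
def listUnion : List (Finset (Fin n)) → Finset (Fin n)
  | [] => ∅
  | S :: π => S ∪ listUnion π

theorem subset_listUnion {π : List (Finset (Fin n))} {S : Finset (Fin n)} (hS : S ∈ π) :
    S ⊆ listUnion π := by
  induction π with
  | nil => simp at hS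
  | cons T π ih =>
    rcases List.mem_cons.1 hS with rfl | h
    · exact Finset.subset_union_left
    · exact (ih h).trans Finset.subset_union_right

theorem cons_sigma_injective : Function.Injective
    fun p : (_ : List (Finset (Fin n))) × Finset (Fin n) => p.2 :: p.1 := fun p q h => by
  obtain ⟨h1, h2⟩ := List.cons.inj h
  cases p; cases q; simp_all

/-- The lists of `i` pairwise disjoint sets with `t` elements. -/
def packings (n t : ℕ) : ℕ → Finset (List (Finset (Fin n)))
  | 0 => {[]}
  | i + 1 => ((packings n t i).sigma fun π => (listUnion π)ᶜ.powersetCard t).map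
      ⟨fun p => p.2 :: p.1, cons_sigma_injective⟩

theorem sum_packings_succ {M : Type*} [AddCommMonoid M] (t i : ℕ)
    (g : List (Finset (Fin n)) → M) :
    ∑ π ∈ packings n t (i + 1), g π
      = ∑ π ∈ packings n t i, ∑ S ∈ (listUnion π)ᶜ.powersetCard t, g (S :: π) := by
  rw [packings, Finset.sum_map, Finset.sum_sigma]
  rfl

theorem card_listUnion {t i : ℕ} {π : List (Finset (Fin n))} (hπ : π ∈ packings n t i) :
    (listUnion π).card = i * t := by
  induction i generalizing π with
  | zero =>
    rw [packings, Finset.mem_singleton] at hπ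
    simp [hπ, listUnion]
  | succ i ih =>
    rw [packings, Finset.mem_map] at hπ
    obtain ⟨⟨π, S⟩, h, rfl⟩ := hπ
    rw [Finset.mem_sigma, Finset.mem_powersetCard] at h
    have hd : Disjoint S (listUnion π) :=
      Finset.disjoint_left.2 fun a ha => Finset.mem_compl.1 (h.2.1 ha)
    change (S ∪ listUnion π).card = _
    rw [Finset.card_union_of_disjoint hd, ih h.1, h.2.2]
    ring

/-- The number of lists of `i` pairwise disjoint sets with `t` elements each among `k` points. -/
def numPackings (k t i : ℕ) : ℕ := ∏ j ∈ Finset.range i, (k - j * t).choose t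

/-- The number of extensions depends only on how many points are already occupied, so the count
depends on J only through its size. -/
theorem card_packings_disjoint (t i : ℕ) (J : Finset (Fin n)) :
    ((packings n t i).filter fun π => Disjoint (listUnion π) J).card
      = numPackings (n - J.card) t i := by
  induction i with
  | zero => simp [packings, numPackings, Finset.filter_singleton, listUnion]
  | succ i ih =>
    rw [numPackings, Finset.prod_range_succ, ← numPackings, ← ih, Finset.card_eq_sum_ones,
      Finset.card_eq_sum_ones, Finset.sum_filter, sum_packings_succ, Finset.sum_filter,
      Finset.sum_mul]
    refine Finset.sum_congr rfl fun π hπ => ?_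
    split_ifs with h
    · rw [← Finset.sum_filter, ← Finset.card_eq_sum_ones, one_mul]
      have h1 : ((listUnion π)ᶜ.powersetCard t).filter (fun S => Disjoint (listUnion (S :: π)) J)
          = (listUnion π ∪ J)ᶜ.powersetCard t := by
        ext S
        simp only [Finset.mem_filter, Finset.mem_powersetCard, listUnion,
          Finset.disjoint_union_left, Finset.disjoint_union_right,
          Finset.subset_compl_iff_disjoint_right]
        tauto
      rw [h1, Finset.card_powersetCard, Finset.card_compl, Finset.card_union_of_disjoint h,
        card_listUnion hπ, Fintype.card_fin, Nat.sub_sub, add_comm]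
    · rw [zero_mul]
      refine Finset.sum_eq_zero fun S _ => if_neg fun hS => h ?_
      exact (Finset.disjoint_union_left.1 hS).2

theorem card_packings (n t i : ℕ) : (packings n t i).card = numPackings n t i := by
  have := card_packings_disjoint (n := n) t i ∅
  simpa using this

theorem numPackings_pos {k t i : ℕ} (h : i * t ≤ k) : 0 < numPackings k t i := by
  refine Finset.prod_pos fun j hj => Nat.choose_pos ?_
  have h1 : (j + 1) * t ≤ i * t := Nat.mul_le_mul_right t (Finset.mem_range.1 hj)
  rw [add_mul, one_mul] at h1
  omega

theorem card_packings_succ (n t i : ℕ) :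
    (packings n t (i + 1)).card = (packings n t i).card * (n - i * t).choose t := by
  rw [card_packings, card_packings, numPackings, Finset.prod_range_succ, numPackings]

theorem sum_packings_comm {M : Type*} [AddCommMonoid M] (t i : ℕ)
    (g : List (Finset (Fin n)) → Finset (Fin n) → M) :
    ∑ π ∈ packings n t i, ∑ S ∈ (listUnion π)ᶜ.powersetCard t, g π S
      = ∑ S ∈ Finset.univ.powersetCard t,
        ∑ π ∈ (packings n t i).filter (fun π => Disjoint (listUnion π) S), g π S := by
  refine Finset.sum_comm' fun π S => ?_
  simp only [Finset.mem_powersetCard, Finset.mem_filter, Finset.subset_univ, true_and,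
    Finset.subset_compl_iff_disjoint_right, disjoint_comm (a := S)]
  tauto

end Packings

/-! ### Successive measurements and the potential argument. -/

section Branch

variable {n d : ℕ} {β : Fin n → Type*}

namespace CondMap

theorem sum_map_flatMap {α γ M : Type*} [AddCommMonoid M] (L : List α) (g : α → List γ)
    (f : γ → M) : ((L.flatMap g).map f).sum = (L.map fun x => ((g x).map f).sum).sum := by
  induction L with
  | nil => rfl
  | cons x L ih => simp [List.flatMap_cons, ih]

/-- A local measurement which moves the posteriors at least as much as the defect demands. -/
noncomputable def bestMeasurement {ε : ℝ} (hε : 0 < ε) (L : List (CondMap d β))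
    (S : Finset (Fin n)) : LocalMeasurement β S := (exists_localMeasurement L S hε).choose

theorem bestMeasurement_spec {ε : ℝ} (hε : 0 < ε) (L : List (CondMap d β)) (S : Finset (Fin n)) :
    ∑ p, traceNorm (totalDefect L S (hermBasis p))
      ≤ ENNReal.ofReal ((d : ℝ) ^ 2 * (increment (bestMeasurement hε L S) L + ε)) :=
  (exists_localMeasurement L S hε).choose_spec

/-- The conditional maps for the outcomes of successive local measurements on the given sets. -/
noncomputable def branch {ε : ℝ} (hε : 0 < ε) (Λ : CondMap d β) :
    List (Finset (Fin n)) → List (CondMap d β)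
  | [] => [Λ]
  -- The same measurement on S is applied to all members of the list, whatever the earlier outcomes.
  | S :: π => (branch hε Λ π).flatMap (children (bestMeasurement hε (branch hε Λ π) S))

variable {ε : ℝ} (hε : 0 < ε) (Λ : CondMap d β)

/-- Whatever is conserved by each measurement on a set of π is conserved along the branch; applied
to effects, weights, and marginals on sets that are not measured. -/
theorem sum_map_branch {M : Type*} [AddCommMonoid M] (f : CondMap d β → M)
    {π : List (Finset (Fin n))}
    (h : ∀ S ∈ π, ∀ (μ : LocalMeasurement β S) (Ψ : CondMap d β),
      ((Ψ.children μ).map f).sum = f Ψ) : ((branch hε Λ π).map f).sum = f Λ := by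
  induction π with
  | nil => simp [branch]
  | cons S π ih =>
    rw [branch, sum_map_flatMap, ← ih fun T hT => h T (List.mem_cons_of_mem _ hT)]
    simp only [h S List.mem_cons_self]

theorem sum_eff_branch (π : List (Finset (Fin n))) :
    ((branch hε Λ π).map eff).sum = Λ.eff :=
  sum_map_branch hε Λ eff fun S _ μ Ψ => by
    simpa [children, add_assoc] using eff_children μ Ψ

theorem sum_weight_branch (π : List (Finset (Fin n))) :
    ((branch hε Λ π).map weight).sum = Λ.weight :=
  sum_map_branch hε Λ weight fun S _ μ Ψ => by
    simpa [children, add_assoc] using weight_children μ Ψ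

theorem sum_partialTrace_branch {π : List (Finset (Fin n))} {S : Finset (Fin n)}
    (hS : Disjoint (listUnion π) S) (X : Matrix (Fin d) (Fin d) ℂ) :
    ((branch hε Λ π).map fun Ψ => partialTrace S (Ψ.1 X)).sum = partialTrace S (Λ.1 X) :=
  sum_map_branch hε Λ (fun Ψ => partialTrace S (Ψ.1 X)) fun T hT μ Ψ => by
    simpa [children, add_assoc] using
      partialTrace_children μ Ψ (hS.mono_left (subset_listUnion hT)) X

/-- The total second moment of the posteriors. -/
noncomputable def potential (L : List (CondMap d β)) : ℝ := (L.map moment).sum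

theorem potential_nonneg (L : List (CondMap d β)) : 0 ≤ potential L := by
  refine List.sum_nonneg fun x hx => ?_
  obtain ⟨Ψ, -, rfl⟩ := List.mem_map.1 hx
  exact Ψ.moment_nonneg

theorem potential_branch_le (π : List (Finset (Fin n))) :
    potential (branch hε Λ π) ≤ Λ.weight := by
  rw [← sum_weight_branch hε Λ π]
  exact List.sum_le_sum fun Ψ _ => Ψ.moment_le

/-- A linearised Cauchy-Schwarz inequality, which can be summed over outcomes and packings before c
is fixed. -/
theorem weight_mul_sqrt_sqDist_le (Ψ Ψ' : CondMap d β) {c : ℝ} (hc : 0 < c) :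
    Ψ'.weight * Real.sqrt (sqDist Ψ Ψ')
      ≤ c⁻¹ / 2 * Ψ'.weight + c / 2 * (Ψ'.weight * sqDist Ψ Ψ') := by
  have h1 := Real.sq_sqrt (sqDist_nonneg Ψ Ψ')
  set s := Real.sqrt (sqDist Ψ Ψ')
  have h2 : s ≤ c⁻¹ / 2 + c / 2 * sqDist Ψ Ψ' := by
    rw [← h1]
    have : c⁻¹ / 2 + c / 2 * s ^ 2 - s = c / 2 * (s - c⁻¹) ^ 2 := by field_simp; ring
    have : 0 ≤ c / 2 * (s - c⁻¹) ^ 2 := by positivity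
    linarith
  have := mul_le_mul_of_nonneg_left h2 Ψ'.weight_nonneg
  linarith

theorem increment_le {S : Finset (Fin n)} (μ : LocalMeasurement β S) (L : List (CondMap d β))
    {c : ℝ} (hc : 0 < c) : increment μ L ≤ c⁻¹ / 2 * (L.map weight).sum
      + c / 2 * (potential (L.flatMap (children μ)) - potential L) := by
  induction L with
  | nil => simp [increment, potential]
  | cons Ψ L ih =>
    have h1 : increment μ (Ψ :: L)
        = ((Ψ.children μ).map fun Ψ' => Ψ'.weight * Real.sqrt (sqDist Ψ Ψ')).sum
          + increment μ L := by simp [increment]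
    have h2 : potential (Ψ :: L) = Ψ.moment + potential L := by simp [potential]
    have h3 : potential ((Ψ :: L).flatMap (children μ))
        = ((Ψ.children μ).map moment).sum + potential (L.flatMap (children μ)) := by
      simp [potential, List.flatMap_cons]
    have h4 := sum_weight_mul_sqDist μ Ψ
    have h5 := weight_children μ Ψ
    have h6 := weight_mul_sqrt_sqDist_le Ψ (Ψ.accept μ) hc
    have h7 := weight_mul_sqrt_sqDist_le Ψ (Ψ.reject μ) hc
    have h8 := weight_mul_sqrt_sqDist_le Ψ (Ψ.outside μ) hc
    have h9 : ((Ψ.children μ).map fun Ψ' => Ψ'.weight * Real.sqrt (sqDist Ψ Ψ')).sum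
        ≤ c⁻¹ / 2 * Ψ.weight + c / 2 * (((Ψ.children μ).map moment).sum - Ψ.moment) := by
      rw [← h4, ← h5]
      simp only [children, List.map_cons, List.map_nil, List.sum_cons, List.sum_nil, add_zero]
      linarith
    rw [h1, h2, h3, List.map_cons, List.sum_cons]
    linarith

theorem increment_bestMeasurement_le (π : List (Finset (Fin n))) (S : Finset (Fin n)) {c : ℝ}
    (hc : 0 < c) :
    increment (bestMeasurement hε (branch hε Λ π) S) (branch hε Λ π) ≤ c⁻¹ / 2 * Λ.weight
      + c / 2 * (potential (branch hε Λ (S :: π)) - potential (branch hε Λ π)) := by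
  rw [← sum_weight_branch hε Λ π]
  exact increment_le _ _ hc

/-- The mean potential after `i` rounds. -/
noncomputable def meanPotential (t i : ℕ) : ℝ :=
  (∑ π ∈ packings n t i, potential (branch hε Λ π)) / (packings n t i).card

/-- The gains of m rounds telescope to at most the weight of `Λ`, so some round gains at most the
average. -/
theorem exists_small_gain {t m : ℕ} (hm : 0 < m) (hmt : m * t ≤ n) : ∃ i < m,
    meanPotential hε Λ t (i + 1) - meanPotential hε Λ t i ≤ Λ.weight / m := by
  have h0 : 0 ≤ meanPotential hε Λ t 0 :=
    div_nonneg (Finset.sum_nonneg fun _ _ => potential_nonneg _) (Nat.cast_nonneg _)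
  have h1 : meanPotential hε Λ t m ≤ Λ.weight := by
    have hpos : (0 : ℝ) < (packings n t m).card := by
      rw [card_packings]; exact_mod_cast numPackings_pos hmt
    rw [meanPotential, div_le_iff₀ hpos, mul_comm, ← nsmul_eq_mul]
    exact Finset.sum_le_card_nsmul _ _ _ fun π _ => potential_branch_le hε Λ π
  have h2 := Finset.sum_range_sub (fun i => meanPotential hε Λ t i) m
  have h3 : ∑ i ∈ Finset.range m, (meanPotential hε Λ t (i + 1) - meanPotential hε Λ t i)
      ≤ ∑ _i ∈ Finset.range m, Λ.weight / m := by
    rw [h2, Finset.sum_const, Finset.card_range, nsmul_eq_mul,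
      mul_div_cancel₀ _ (Nat.cast_ne_zero.2 hm.ne')]
    linarith
  obtain ⟨i, hi, h⟩ := Finset.exists_le_of_sum_le ⟨0, Finset.mem_range.2 hm⟩ h3
  exact ⟨i, Finset.mem_range.1 hi, h⟩

/-- With c = √m the two halves of the linearised Cauchy-Schwarz bound are both w/(2√m), where w is
the weight of `Λ`. -/
theorem sum_increment_le {t m i : ℕ} (hm : 0 < m) (hit : (i + 1) * t ≤ n)
    (h : meanPotential hε Λ t (i + 1) - meanPotential hε Λ t i ≤ Λ.weight / m) :
    ∑ π ∈ packings n t i, ∑ S ∈ (listUnion π)ᶜ.powersetCard t,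
      increment (bestMeasurement hε (branch hε Λ π) S) (branch hε Λ π)
      ≤ (packings n t (i + 1)).card * (Λ.weight / Real.sqrt m) := by
  have hm' : (0 : ℝ) < m := Nat.cast_pos.2 hm
  have hs : 0 < Real.sqrt m := Real.sqrt_pos.2 hm'
  have hpos : (0 : ℝ) < (packings n t (i + 1)).card := by
    rw [card_packings]; exact_mod_cast numPackings_pos hit
  have hpos' : (0 : ℝ) < (packings n t i).card := by
    rw [card_packings]
    exact_mod_cast numPackings_pos (le_trans (Nat.mul_le_mul_right t (Nat.le_succ i)) hit)
  have hcard : ∀ π ∈ packings n t i,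
      ((listUnion π)ᶜ.powersetCard t).card = (n - i * t).choose t := fun π hπ => by
    rw [Finset.card_powersetCard, Finset.card_compl, card_listUnion hπ, Fintype.card_fin]
  have hsucc : ((packings n t (i + 1)).card : ℝ)
      = (packings n t i).card * (n - i * t).choose t := by
    exact_mod_cast card_packings_succ n t i
  calc ∑ π ∈ packings n t i, ∑ S ∈ (listUnion π)ᶜ.powersetCard t,
        increment (bestMeasurement hε (branch hε Λ π) S) (branch hε Λ π)
      ≤ ∑ π ∈ packings n t i, ∑ S ∈ (listUnion π)ᶜ.powersetCard t,
        ((Real.sqrt m)⁻¹ / 2 * Λ.weight + Real.sqrt m / 2 *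
          (potential (branch hε Λ (S :: π)) - potential (branch hε Λ π))) :=
        Finset.sum_le_sum fun π _ => Finset.sum_le_sum fun S _ =>
          increment_bestMeasurement_le hε Λ π S hs
    _ = (packings n t (i + 1)).card * ((Real.sqrt m)⁻¹ / 2 * Λ.weight) + Real.sqrt m / 2 *
          (∑ π ∈ packings n t (i + 1), potential (branch hε Λ π)
            - (n - i * t).choose t * ∑ π ∈ packings n t i, potential (branch hε Λ π)) := by
        rw [sum_packings_succ, Finset.mul_sum, ← Finset.sum_sub_distrib, Finset.mul_sum, hsucc,
          mul_assoc, ← nsmul_eq_mul, ← Finset.sum_const, ← Finset.sum_add_distrib]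
        refine Finset.sum_congr rfl fun π hπ => ?_
        rw [Finset.sum_add_distrib, Finset.sum_const, hcard π hπ, ← Finset.mul_sum,
          Finset.sum_sub_distrib, Finset.sum_const, hcard π hπ, nsmul_eq_mul, nsmul_eq_mul]
    _ = (packings n t (i + 1)).card * ((Real.sqrt m)⁻¹ / 2 * Λ.weight + Real.sqrt m / 2 *
          (meanPotential hε Λ t (i + 1) - meanPotential hε Λ t i)) := by
        have h1 : ∑ π ∈ packings n t (i + 1), potential (branch hε Λ π)
            = (packings n t (i + 1)).card * meanPotential hε Λ t (i + 1) := by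
          rw [meanPotential, mul_div_cancel₀ _ hpos.ne']
        have h2 : ∑ π ∈ packings n t i, potential (branch hε Λ π)
            = (packings n t i).card * meanPotential hε Λ t i := by
          rw [meanPotential, mul_div_cancel₀ _ hpos'.ne']
        rw [h1, h2, hsucc]
        ring
    _ ≤ (packings n t (i + 1)).card * ((Real.sqrt m)⁻¹ / 2 * Λ.weight + Real.sqrt m / 2 *
          (Λ.weight / m)) := by gcongr
    _ = (packings n t (i + 1)).card * (Λ.weight / Real.sqrt m) := by
        have h1 : (m : ℝ) = Real.sqrt m * Real.sqrt m := (Real.mul_self_sqrt hm'.le).symm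
        have h2 : Real.sqrt m / 2 * (Λ.weight / m) = (Real.sqrt m)⁻¹ / 2 * Λ.weight := by
          conv_lhs => rw [h1]
          rw [Real.sqrt_mul_self hs.le]
          field_simp
        rw [h2]
        ring

end CondMap

end Branch

/-! ### The family of all outcomes after a good round. -/

section Scheme

variable {n d : ℕ} {β : Fin n → Type*}

/-- A family of conditional maps of a channel, each obtained by conditioning on measurements of `u`
of the tensor factors. For each set `J` of factors, those members of the family for which no factor
in `J` has been measured add up to a multiple `num J.card` of the channel. -/
structure ConditioningScheme (Λ : CondMap d β) where
  Ω : Type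
  [fintype : Fintype Ω]
  used : Ω → Finset (Fin n)
  outcome : Ω → CondMap d β
  u : ℕ
  card_used : ∀ ω, (used ω).card = u
  num : ℕ → ℝ
  num_nonneg : ∀ l, 0 ≤ num l
  num_pos : ∀ l, l + u ≤ n → 0 < num l
  sum_eff : ∀ J : Finset (Fin n), ∑ ω with Disjoint (used ω) J, (outcome ω).eff
    = (num J.card : ℂ) • Λ.eff
  sum_partialTrace : ∀ (S : Finset (Fin n)) (X : Matrix (Fin d) (Fin d) ℂ),
    ∑ ω with Disjoint (used ω) S, partialTrace S ((outcome ω).1 X)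
      = (num S.card : ℂ) • partialTrace S (Λ.1 X)

attribute [instance] ConditioningScheme.fintype

namespace CondMap

variable {ε : ℝ} (hε : 0 < ε) (Λ : CondMap d β)

/-- The index set of the outcomes after `i` rounds. -/
abbrev BranchIndex (t i : ℕ) : Type :=
  (π : {π // π ∈ packings n t i}) × Fin (branch hε Λ π.1).length

theorem sum_branchIndex {M : Type*} [AddCommMonoid M] (t i : ℕ) (J : Finset (Fin n))
    (f : CondMap d β → M) :
    ∑ ω : BranchIndex hε Λ t i with Disjoint (listUnion ω.1.1) J,
      f ((branch hε Λ ω.1.1)[ω.2.1]'ω.2.2)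
      = ∑ π ∈ packings n t i with Disjoint (listUnion π) J, ((branch hε Λ π).map f).sum := by
  rw [Finset.sum_filter, Fintype.sum_sigma, Finset.sum_filter,
    ← Finset.sum_coe_sort (packings n t i)]
  refine Finset.sum_congr rfl fun π _ => ?_
  dsimp only
  split_ifs with h
  · exact Fin.sum_univ_fun_getElem (branch hε Λ π.1) f
  · simp

/-- The scheme of the outcomes after `i` rounds. -/
noncomputable def scheme (t i : ℕ) : ConditioningScheme Λ where
  Ω := BranchIndex hε Λ t i
  used ω := listUnion ω.1.1
  outcome ω := (branch hε Λ ω.1.1)[ω.2.1]'ω.2.2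
  u := i * t
  card_used ω := card_listUnion ω.1.2
  num l := numPackings (n - l) t i
  num_nonneg l := Nat.cast_nonneg _
  num_pos l hl := Nat.cast_pos.2 (numPackings_pos (by omega))
  sum_eff J := by
    rw [sum_branchIndex hε Λ t i J eff]
    simp only [sum_eff_branch]
    rw [Finset.sum_const, card_packings_disjoint, Complex.ofReal_natCast, Nat.cast_smul_eq_nsmul]
  sum_partialTrace S X := by
    rw [sum_branchIndex hε Λ t i S fun Ψ => partialTrace S (Ψ.1 X)]
    rw [Finset.sum_congr rfl fun π hπ =>
      sum_partialTrace_branch hε Λ (Finset.mem_filter.1 hπ).2 X, Finset.sum_const,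
      card_packings_disjoint, Complex.ofReal_natCast, Nat.cast_smul_eq_nsmul]

theorem card_packings_mul (n t i : ℕ) :
    ((packings n t (i + 1)).card : ℝ) = n.choose t * numPackings (n - t) t i := by
  have h1 := sum_packings_succ (n := n) t i fun _ => 1
  rw [sum_packings_comm, Finset.sum_const, smul_eq_mul, mul_one] at h1
  rw [h1]
  have h2 : ∀ S ∈ Finset.univ.powersetCard t,
      ∑ _π ∈ (packings n t i).filter (fun π => Disjoint (listUnion π) S), 1
        = numPackings (n - t) t i := fun S hS => by
    rw [Finset.sum_const, card_packings_disjoint, (Finset.mem_powersetCard.1 hS).2, smul_eq_mul,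
      mul_one]
  rw [Finset.sum_congr rfl h2, Finset.sum_const, Finset.card_powersetCard, Finset.card_univ,
    Fintype.card_fin, smul_eq_mul]
  push_cast; rfl

/-- There is a scheme for which the outputs of the conditional maps on most sets of factors are
nearly independent of the input. -/
theorem exists_scheme {ε : ℝ} (hε : 0 < ε) (Λ : CondMap d β) {t m : ℕ} (hm : 0 < m)
    (hmt : m * t ≤ n) :
    ∃ (𝔖 : ConditioningScheme Λ) (τ : Finset (Fin n) → ℝ), 𝔖.u + t ≤ m * t ∧
      (∀ S, 0 ≤ τ S) ∧
      (∀ S : Finset (Fin n), S.card = t →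
        ∑ p, traceNorm (∑ ω with Disjoint (𝔖.used ω) S, (𝔖.outcome ω).defect S (hermBasis p))
          ≤ ENNReal.ofReal (𝔖.num t * τ S)) ∧
      ∑ S ∈ Finset.univ.powersetCard t, τ S
        ≤ n.choose t * ((d : ℝ) ^ 2 * (Λ.weight / Real.sqrt m + ε)) := by
  obtain ⟨i, him, hi⟩ := exists_small_gain hε Λ hm hmt
  have hit : (i + 1) * t ≤ m * t := Nat.mul_le_mul_right t him
  have hit' : i * t + t ≤ m * t := by rwa [add_mul, one_mul] at hit
  have hnum : (0 : ℝ) < numPackings (n - t) t i := by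
    exact_mod_cast numPackings_pos (by omega)
  set g : List (Finset (Fin n)) → Finset (Fin n) → ℝ := fun π S => (d : ℝ) ^ 2 *
    (increment (bestMeasurement hε (branch hε Λ π) S) (branch hε Λ π) + ε) with hg
  have hg0 : ∀ π S, 0 ≤ g π S := fun π S =>
    mul_nonneg (by positivity) (add_nonneg (increment_nonneg _ _) hε.le)
  -- τ(S) is the mean, over the packings that avoid S, of the bound for the total defect on S.
  refine ⟨scheme hε Λ t i, fun S =>
    (∑ π ∈ packings n t i with Disjoint (listUnion π) S, g π S) / numPackings (n - t) t i,
    hit', fun S => ?_, fun S hS => ?_, ?_⟩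
  · exact div_nonneg (Finset.sum_nonneg fun π _ => hg0 π S) hnum.le
  · change _ ≤ ENNReal.ofReal ((numPackings (n - t) t i : ℝ) * _)
    rw [mul_div_cancel₀ _ hnum.ne', ENNReal.ofReal_sum_of_nonneg fun π _ => hg0 π S]
    have h1 : ∀ p : Fin d × Fin d, ∑ ω with Disjoint ((scheme hε Λ t i).used ω) S,
        ((scheme hε Λ t i).outcome ω).defect S (hermBasis p)
        = ∑ π ∈ packings n t i with Disjoint (listUnion π) S,
          totalDefect (branch hε Λ π) S (hermBasis p) := by
      intro p
      have := sum_branchIndex hε Λ t i S fun Ψ => Ψ.defect S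
      have h2 := congrArg (fun φ => φ (hermBasis p)) this
      simp only [LinearMap.sum_apply] at h2
      exact h2
    simp only [h1]
    calc ∑ p : Fin d × Fin d, traceNorm (∑ π ∈ packings n t i with Disjoint (listUnion π) S,
          totalDefect (branch hε Λ π) S (hermBasis p))
        ≤ ∑ p : Fin d × Fin d, ∑ π ∈ packings n t i with Disjoint (listUnion π) S,
          traceNorm (totalDefect (branch hε Λ π) S (hermBasis p)) :=
          Finset.sum_le_sum fun p _ => traceNorm_sum_le _ _
      _ = ∑ π ∈ packings n t i with Disjoint (listUnion π) S, ∑ p : Fin d × Fin d,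
          traceNorm (totalDefect (branch hε Λ π) S (hermBasis p)) := Finset.sum_comm
      _ ≤ _ := Finset.sum_le_sum fun π _ => bestMeasurement_spec hε (branch hε Λ π) S
  · have hpos : (0 : ℝ) < (packings n t (i + 1)).card := by
      rw [card_packings]; exact_mod_cast numPackings_pos (hit.trans hmt)
    -- Exchanging S with the packing turns the sum over S into one over packings with one more set,
    -- where the small gain applies.
    rw [← Finset.sum_div, ← sum_packings_comm, div_le_iff₀ hnum]
    have h1 := sum_increment_le hε Λ hm (hit.trans hmt) hi
    have h2 : ∑ π ∈ packings n t i, ∑ S ∈ (listUnion π)ᶜ.powersetCard t, g π S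
        = (d : ℝ) ^ 2 * (∑ π ∈ packings n t i, ∑ S ∈ (listUnion π)ᶜ.powersetCard t,
          increment (bestMeasurement hε (branch hε Λ π) S) (branch hε Λ π)
          + (packings n t (i + 1)).card * ε) := by
      have h3 := sum_packings_succ (n := n) t i fun _ => ε
      rw [Finset.sum_const, nsmul_eq_mul] at h3
      simp only [hg]
      rw [h3, ← Finset.sum_add_distrib, Finset.mul_sum]
      refine Finset.sum_congr rfl fun π _ => ?_
      rw [← Finset.sum_add_distrib, Finset.mul_sum]
    rw [h2]
    calc (d : ℝ) ^ 2 * (_ + (packings n t (i + 1)).card * ε)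
        ≤ (d : ℝ) ^ 2 * ((packings n t (i + 1)).card * (Λ.weight / Real.sqrt m)
          + (packings n t (i + 1)).card * ε) := by gcongr
      _ = _ := by rw [card_packings_mul n t i]; ring

end CondMap

end Scheme

/-! ### Scalar inequalities behind Pinsker's inequality and the entropy bounds. -/

section Pinsker

open Real in
-- After division by x(2x + 4) the difference of the two sides is the function g below. Its
-- derivative has the sign of x - 1, so its minimum is g(1) = 0.
theorem pinsker_pointwise {x : ℝ} (hx : 0 ≤ x) :
    3 * (x - 1) ^ 2 ≤ (4 + 2 * x) * (x * log x - x + 1) := by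
  rcases hx.eq_or_lt with rfl | hx
  · norm_num
  set g : ℝ → ℝ := fun x => log x - (x - 1) * (5 * x + 1) / (x * (2 * x + 4)) with hg
  have hder : ∀ y : ℝ, 0 < y → HasDerivAt g ((y - 1) ^ 3 / (y ^ 2 * (y + 2) ^ 2)) y := by
    intro y hy
    have h1 : HasDerivAt (fun x : ℝ => (x - 1) * (5 * x + 1))
        (1 * (5 * y + 1) + (y - 1) * 5) y := by
      refine ((hasDerivAt_id y).sub_const 1).mul ?_
      simpa using ((hasDerivAt_id y).const_mul 5).add_const 1
    have h2 : HasDerivAt (fun x : ℝ => x * (2 * x + 4)) (1 * (2 * y + 4) + y * 2) y := by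
      refine (hasDerivAt_id y).mul ?_
      simpa using ((hasDerivAt_id y).const_mul 2).add_const 4
    have h3 := (hasDerivAt_log hy.ne').sub (h1.div h2 (by positivity))
    refine h3.congr_deriv ?_
    field_simp
    ring
  have hcont : ∀ s : Set ℝ, s ⊆ Set.Ioi 0 → ContinuousOn g s := fun s hs y hy =>
    (hder y (hs hy)).continuousAt.continuousWithinAt
  have hg1 : g 1 = 0 := by simp [hg]
  have hpos : 0 ≤ g x := by
    rw [← hg1]
    rcases le_total x 1 with h | h
    · have hanti : AntitoneOn g (Set.Ioc 0 1) := by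
        refine antitoneOn_of_deriv_nonpos (convex_Ioc 0 1) (hcont _ fun y hy => hy.1) ?_ ?_
        · intro y hy
          rw [interior_Ioc] at hy
          exact (hder y hy.1).differentiableAt.differentiableWithinAt
        · intro y hy
          rw [interior_Ioc] at hy
          rw [(hder y hy.1).deriv]
          refine div_nonpos_of_nonpos_of_nonneg ?_ (by positivity)
          exact Odd.pow_nonpos (by decide) (by linarith [hy.2])
      exact hanti ⟨hx, h⟩ ⟨one_pos, le_rfl⟩ h
    · have hmono : MonotoneOn g (Set.Ici 1) := by
        refine monotoneOn_of_deriv_nonneg (convex_Ici 1)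
          (hcont _ fun y hy => Set.mem_Ioi.2 (one_pos.trans_le (Set.mem_Ici.1 hy))) ?_ ?_
        · intro y hy
          rw [interior_Ici] at hy
          exact (hder y (one_pos.trans hy)).differentiableAt.differentiableWithinAt
        · intro y hy
          rw [interior_Ici] at hy
          rw [(hder y (one_pos.trans hy)).deriv]
          have : 0 ≤ y - 1 := sub_nonneg.2 (le_of_lt hy)
          positivity
      exact hmono (Set.mem_Ici.2 le_rfl) h h
  have h4 : (4 + 2 * x) * (x * log x - x + 1) - 3 * (x - 1) ^ 2 = x * (2 * x + 4) * g x := by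
    simp only [hg]
    field_simp
    ring
  have h5 : 0 ≤ x * (2 * x + 4) * g x := by positivity
  linarith

/-- Pinsker's inequality term by term, with the square root linearised by the arithmetic-geometric
mean inequality. Summed over two probability distributions the weights (4b + 2a)/6 add up to 1. -/
theorem abs_sub_le_of_relative_entropy {a b c : ℝ} (ha : 0 ≤ a) (hb : 0 ≤ b)
    (hab : b = 0 → a = 0) (hc : 0 < c) :
    |a - b| ≤ c * ((4 * b + 2 * a) / 6)
      + (a * Real.log a - a * Real.log b - a + b) / (2 * c) := by
  rcases hb.eq_or_lt with rfl | hb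
  · simp [hab rfl]
  have h := pinsker_pointwise (div_nonneg ha hb.le)
  have h1 : a * Real.log a - a * Real.log b - a + b
      = b * (a / b * Real.log (a / b) - a / b + 1) := by
    rcases ha.eq_or_lt with rfl | ha
    · simp
    · rw [Real.log_div ha.ne' hb.ne']
      field_simp
  rw [h1]
  set x := a / b with hx
  have hx0 : 0 ≤ x := div_nonneg ha hb.le
  have hax : a = b * x := by rw [hx, mul_div_cancel₀ _ hb.ne']
  set D := x * Real.log x - x + 1
  have h2 : |x - 1| ≤ c * ((4 + 2 * x) / 6) + D / (2 * c) := by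
    refine abs_le_of_sq_le_sq ?_ ?_
    · have hD : 0 ≤ D := by
        by_contra! hD
        nlinarith [sq_nonneg (x - 1)]
      have h3 : (x - 1) ^ 2 ≤ 4 * (c * ((4 + 2 * x) / 6)) * (D / (2 * c)) := by
        have : 4 * (c * ((4 + 2 * x) / 6)) * (D / (2 * c)) = (4 + 2 * x) * D / 3 := by
          field_simp; ring
        rw [this]; linarith
      nlinarith [sq_nonneg (c * ((4 + 2 * x) / 6) - D / (2 * c))]
    · have hD : 0 ≤ D := by
        by_contra! hD
        nlinarith [sq_nonneg (x - 1)]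
      positivity
  rw [show a - b = b * (x - 1) by rw [hax]; ring, abs_mul, abs_of_pos hb]
  calc b * |x - 1| ≤ b * (c * ((4 + 2 * x) / 6) + D / (2 * c)) := by gcongr
    _ = _ := by rw [hax]; ring

/-- The tangent inequality F log F ≥ F log y + F - y at y = ab/f, the value of F under conditional
independence. The hypotheses on zeros exclude a spurious log 0 = 0. -/
theorem mul_log_ge {F a b f : ℝ} (hF : 0 ≤ F) (ha : 0 ≤ a) (hb : 0 ≤ b) (hf : 0 ≤ f)
    (hFa : a = 0 → F = 0) (hFb : b = 0 → F = 0) (haf : f = 0 → a = 0) :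
    F * (Real.log a + Real.log b - Real.log f) + F - a * b / f ≤ F * Real.log F := by
  have hnn : 0 ≤ a * b / f := by positivity
  rcases hF.eq_or_lt with rfl | hF
  · simpa using hnn
  have ha' : 0 < a := ha.lt_of_ne fun h => hF.ne' (hFa h.symm)
  have hb' : 0 < b := hb.lt_of_ne fun h => hF.ne' (hFb h.symm)
  have hf' : 0 < f := hf.lt_of_ne fun h => ha'.ne' (haf h.symm)
  have hy : 0 < a * b / f := by positivity
  have h1 : Real.log (a * b / f) = Real.log a + Real.log b - Real.log f := by
    rw [Real.log_div (by positivity) hf'.ne', Real.log_mul ha'.ne' hb'.ne']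
  have h2 := Real.log_le_sub_one_of_pos (div_pos hy hF)
  rw [Real.log_div hy.ne' hF.ne', h1] at h2
  have h3 := mul_le_mul_of_nonneg_left h2 hF.le
  have h4 : F * (a * b / f / F - 1) = a * b / f - F := by field_simp
  rw [h4] at h3
  linarith

theorem sum_negMulLog_le {κ : Type*} [Fintype κ] {p : κ → ℝ} (hp : ∀ c, 0 ≤ p c)
    (hsum : ∑ c, p c = 1) : -∑ c, p c * Real.log (p c) ≤ Real.log (Fintype.card κ) := by
  have hne : Nonempty κ := by
    by_contra h
    rw [not_nonempty_iff] at h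
    simp at hsum
  have hK : (0 : ℝ) < Fintype.card κ := Nat.cast_pos.2 Fintype.card_pos
  have h : ∀ c, -(p c * Real.log (p c)) - p c * Real.log (Fintype.card κ)
      ≤ (Fintype.card κ : ℝ)⁻¹ - p c := by
    intro c
    rcases (hp c).eq_or_lt with h0 | h0
    · rw [← h0]; simp
    have h1 := Real.log_le_sub_one_of_pos (x := (p c * Fintype.card κ)⁻¹) (by positivity)
    rw [Real.log_inv, Real.log_mul h0.ne' hK.ne'] at h1
    have h2 := mul_le_mul_of_nonneg_left h1 h0.le
    have h3 : p c * ((p c * Fintype.card κ)⁻¹ - 1) = (Fintype.card κ : ℝ)⁻¹ - p c := by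
      field_simp
    rw [h3] at h2
    linarith
  have h2 := Finset.sum_le_sum fun c (_ : c ∈ Finset.univ) => h c
  rw [Finset.sum_sub_distrib, Finset.sum_sub_distrib, ← Finset.sum_mul, hsum,
    Finset.sum_neg_distrib, Finset.sum_const, Finset.card_univ, nsmul_eq_mul,
    mul_inv_cancel₀ hK.ne'] at h2
  linarith

end Pinsker

/-! ### Harmonic set functions: convexity of the mean entropy. -/

section Harmonic

variable {n : ℕ}

/-- A nonnegative function of the sets with at most `r` elements whose value at a smaller set is the
mean of the values at the sets with one more element. -/
structure IsHarmonic (r : ℕ) (h : Finset (Fin n) → ℝ) : Prop where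
  nonneg : ∀ J, 0 ≤ h J
  mean : ∀ J : Finset (Fin n), J.card < r → ∑ a ∈ Jᶜ, h (insert a J) = (n - J.card) * h J

theorem sum_insert_compl {M : Type*} [AddCommMonoid M] (l : ℕ) (g : Finset (Fin n) → M) :
    ∑ J ∈ Finset.univ.powersetCard l, ∑ a ∈ Jᶜ, g (insert a J)
      = (l + 1) • ∑ J ∈ Finset.univ.powersetCard (l + 1), g J := by
  have h1 : ∀ J ∈ Finset.univ.powersetCard (l + 1), (l + 1) • g J = ∑ _a ∈ J, g J :=
    fun J hJ => by rw [Finset.sum_const, (Finset.mem_powersetCard.1 hJ).2]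
  rw [Finset.smul_sum, Finset.sum_congr rfl h1, Finset.sum_sigma', Finset.sum_sigma']
  refine Finset.sum_bij' (fun p _ => ⟨insert p.2 p.1, p.2⟩) (fun p _ => ⟨p.1.erase p.2, p.2⟩)
    ?_ ?_ ?_ ?_ ?_
  · rintro ⟨J, a⟩ h
    simp only [Finset.mem_sigma, Finset.mem_powersetCard, Finset.mem_compl] at h
    simp [h.2, h.1.2, Finset.mem_powersetCard]
  · rintro ⟨J, a⟩ h
    simp only [Finset.mem_sigma, Finset.mem_powersetCard] at h
    simp [h.2, h.1.2, Finset.mem_powersetCard]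
  · rintro ⟨J, a⟩ h
    simp only [Finset.mem_sigma, Finset.mem_powersetCard, Finset.mem_compl] at h
    simp [h.2]
  · rintro ⟨J, a⟩ h
    simp only [Finset.mem_sigma, Finset.mem_powersetCard] at h
    simp [h.2]
  · rintro ⟨J, a⟩ h
    rfl

namespace IsHarmonic

variable {r : ℕ} {h : Finset (Fin n) → ℝ}

theorem eq_zero_insert (hh : IsHarmonic r h) {J : Finset (Fin n)} (hJ : J.card < r)
    (h0 : h J = 0) {a : Fin n} (ha : a ∉ J) : h (insert a J) = 0 := by
  have h1 := hh.mean J hJ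
  rw [h0, mul_zero] at h1
  exact (Finset.sum_eq_zero_iff_of_nonneg fun a _ => hh.nonneg _).1 h1 a (Finset.mem_compl.2 ha)

theorem sum_eq (hh : IsHarmonic r h) (hr : r ≤ n) {l : ℕ} (hl : l ≤ r) :
    ∑ J ∈ Finset.univ.powersetCard l, h J = n.choose l * h ∅ := by
  induction l with
  | zero => simp
  | succ l ih =>
    have h1 := sum_insert_compl (n := n) l h
    have h2 : ∑ J ∈ Finset.univ.powersetCard l, ∑ a ∈ Jᶜ, h (insert a J)
        = (n - l) * ∑ J ∈ Finset.univ.powersetCard l, h J := by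
      rw [Finset.mul_sum]
      refine Finset.sum_congr rfl fun J hJ => ?_
      rw [hh.mean J (by rw [(Finset.mem_powersetCard.1 hJ).2]; omega),
        (Finset.mem_powersetCard.1 hJ).2]
    rw [h2, ih (by omega), nsmul_eq_mul] at h1
    have h3 : (n.choose (l + 1) : ℝ) * (l + 1) = n.choose l * (n - l) := by
      have := Nat.choose_succ_right_eq n l
      rw [← Nat.cast_sub (by omega : l ≤ n)]
      exact_mod_cast this
    have h4 : ((l : ℝ) + 1) ≠ 0 := by positivity
    push_cast at h1
    refine mul_left_cancel₀ h4 ?_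
    linear_combination -h1 - h ∅ * h3

theorem eq_zero (hh : IsHarmonic r h) (hr : r ≤ n) (h0 : h ∅ = 0) {J : Finset (Fin n)}
    (hJ : J.card ≤ r) : h J = 0 := by
  have h1 := hh.sum_eq hr hJ
  rw [h0, mul_zero] at h1
  exact (Finset.sum_eq_zero_iff_of_nonneg fun a _ => hh.nonneg _).1 h1 J
    (Finset.mem_powersetCard.2 ⟨Finset.subset_univ _, rfl⟩)

/-- Each value two steps above J is compared with the conditionally independent one, f(a) f(b)/h(J).
Harmonicity evaluates the logarithmic terms, and the remaining terms have a nonnegative sum. -/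
theorem local_convexity (hh : IsHarmonic r h) {J : Finset (Fin n)} (hJ : J.card + 2 ≤ r)
    (hr : r ≤ n) :
    2 * (n - J.card - 1) * ∑ a ∈ Jᶜ, h (insert a J) * Real.log (h (insert a J))
      - (n - J.card) * (n - J.card - 1) * (h J * Real.log (h J))
      ≤ ∑ a ∈ Jᶜ, ∑ b ∈ (insert a J)ᶜ,
        h (insert b (insert a J)) * Real.log (h (insert b (insert a J))) := by
  set f : Fin n → ℝ := fun a => h (insert a J) with hf
  set F : Fin n → Fin n → ℝ := fun a b => h (insert b (insert a J)) with hFdef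
  set k : ℝ := n - J.card with hk
  have hk2 : 2 ≤ k := by
    have : (J.card : ℝ) + 2 ≤ n := by exact_mod_cast hJ.trans hr
    simp only [hk]; linarith
  have hFs : ∀ a b, F a b = F b a := fun a b => by
    simp only [hFdef]; rw [Finset.insert_comm]
  have hcard : ∀ a ∈ Jᶜ, (insert a J).card = J.card + 1 := fun a ha =>
    Finset.card_insert_of_notMem (Finset.mem_compl.1 ha)
  have hsumf : ∑ a ∈ Jᶜ, f a = k * h J := hh.mean J (by omega)
  have hsumF : ∀ a ∈ Jᶜ, ∑ b ∈ (insert a J)ᶜ, F a b = (k - 1) * f a := by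
    intro a ha
    have := hh.mean (insert a J) (by rw [hcard a ha]; omega)
    rw [hcard a ha] at this
    rw [this, hk]; push_cast; ring
  have hswap : ∀ g : Fin n → Fin n → ℝ, ∑ a ∈ Jᶜ, ∑ b ∈ (insert a J)ᶜ, g a b
      = ∑ a ∈ Jᶜ, ∑ b ∈ (insert a J)ᶜ, g b a := by
    intro g
    refine Finset.sum_comm' fun a b => ?_
    simp only [Finset.mem_compl, Finset.mem_insert, not_or]
    constructor
    · rintro ⟨h1, h2, h3⟩; exact ⟨⟨Ne.symm h2, h1⟩, h3⟩
    · rintro ⟨⟨h1, h2⟩, h3⟩; exact ⟨h2, Ne.symm h1, h3⟩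
  have hpt : ∀ a ∈ Jᶜ, ∀ b ∈ (insert a J)ᶜ,
      F a b * (Real.log (f a) + Real.log (f b) - Real.log (h J)) + F a b - f a * f b / h J
        ≤ F a b * Real.log (F a b) := by
    intro a ha b hb
    rw [Finset.mem_compl, Finset.mem_insert, not_or] at hb
    have ha' := Finset.mem_compl.1 ha
    have hb' : b ∈ Jᶜ := Finset.mem_compl.2 hb.2
    refine mul_log_ge (hh.nonneg _) (hh.nonneg _) (hh.nonneg _) (hh.nonneg _) (fun h0 => ?_)
      (fun h0 => ?_) fun h0 => hh.eq_zero_insert (by omega) h0 ha'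
    · refine hh.eq_zero_insert (by rw [hcard a ha]; omega) h0 ?_
      simp [hb.1, hb.2]
    · rw [hFs]
      refine hh.eq_zero_insert (by rw [hcard b hb']; omega) h0 ?_
      simp [Ne.symm hb.1, ha']
  have h1 := Finset.sum_le_sum fun a ha => Finset.sum_le_sum (hpt a ha)
  refine le_trans ?_ h1
  have e1 : ∑ a ∈ Jᶜ, ∑ b ∈ (insert a J)ᶜ, F a b * Real.log (f a)
      = (k - 1) * ∑ a ∈ Jᶜ, f a * Real.log (f a) := by
    rw [Finset.mul_sum]
    refine Finset.sum_congr rfl fun a ha => ?_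
    rw [← Finset.sum_mul, hsumF a ha]; ring
  have e2 : ∑ a ∈ Jᶜ, ∑ b ∈ (insert a J)ᶜ, F a b * Real.log (f b)
      = (k - 1) * ∑ a ∈ Jᶜ, f a * Real.log (f a) := by
    rw [hswap fun a b => F a b * Real.log (f b), ← e1]
    exact Finset.sum_congr rfl fun a _ => Finset.sum_congr rfl fun b _ => by rw [hFs]
  have e3 : ∑ a ∈ Jᶜ, ∑ b ∈ (insert a J)ᶜ, F a b = (k - 1) * (k * h J) := by
    rw [← hsumf, Finset.mul_sum]
    exact Finset.sum_congr rfl hsumF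
  -- The pairs a = b are missing from the double sum; by Cauchy-Schwarz they account for at least k
  -- h(J).
  have e4 : ∑ a ∈ Jᶜ, ∑ b ∈ (insert a J)ᶜ, f a * f b / h J ≤ k * (k - 1) * h J := by
    have hsplit : ∀ a ∈ Jᶜ, ∑ b ∈ (insert a J)ᶜ, f a * f b / h J
        = f a * (k * h J) / h J - f a ^ 2 / h J := by
      intro a ha
      rw [← Finset.sum_div, ← Finset.mul_sum, ← hsumf, ← sub_div]
      congr 1
      have : Jᶜ = insert a (insert a J)ᶜ := by
        ext b
        simp only [Finset.mem_insert, Finset.mem_compl, not_or]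
        constructor
        · intro hb; by_cases hab : b = a <;> simp [hab, hb]
        · rintro (rfl | hb)
          · exact Finset.mem_compl.1 ha
          · exact hb.2
      rw [this, Finset.sum_insert (by simp)]
      ring
    rw [Finset.sum_congr rfl hsplit, Finset.sum_sub_distrib, ← Finset.sum_div, ← Finset.sum_div,
      ← Finset.sum_mul, hsumf]
    rcases (hh.nonneg J).eq_or_lt with h0 | h0
    · rw [← h0]; simp
    have hcs := sq_sum_le_card_mul_sum_sq (s := Jᶜ) (f := f)
    rw [hsumf, Finset.card_compl, Fintype.card_fin, Nat.cast_sub (by omega), ← hk] at hcs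
    have h5 : k * h J ^ 2 ≤ ∑ a ∈ Jᶜ, f a ^ 2 := by
      have hkpos : 0 < k := by linarith
      refine le_of_mul_le_mul_left ?_ hkpos
      linarith
    have h6 : k * h J ≤ (∑ a ∈ Jᶜ, f a ^ 2) / h J := by
      rw [le_div_iff₀ h0]; linarith
    have h7 : k * h J * (k * h J) / h J = k * k * h J := by field_simp
    rw [h7]
    linarith
  simp only [Finset.sum_sub_distrib, Finset.sum_add_distrib, mul_add, mul_sub] at e4 ⊢
  have e5 : ∑ a ∈ Jᶜ, ∑ b ∈ (insert a J)ᶜ, F a b * Real.log (h J)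
      = (k - 1) * (k * h J) * Real.log (h J) := by
    simp only [← Finset.sum_mul]; rw [e3]
  rw [e1, e2, e3, e5]
  linarith

/-- The mean of `h log h` over the sets with `l` elements. -/
noncomputable def meanEntropy (h : Finset (Fin n) → ℝ) (l : ℕ) : ℝ :=
  (∑ J ∈ Finset.univ.powersetCard l, h J * Real.log (h J)) / n.choose l

/-- The sum of the local inequalities over all J of size l, each larger set being counted once for
every way of building it up. -/
theorem meanEntropy_convex (hh : IsHarmonic r h) (hr : r ≤ n) {l : ℕ} (hl : l + 2 ≤ r) :
    2 * meanEntropy h (l + 1) ≤ meanEntropy h l + meanEntropy h (l + 2) := by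
  set Φ : ℕ → ℝ := fun l => ∑ J ∈ Finset.univ.powersetCard l, h J * Real.log (h J) with hΦ
  have h1 : ∑ J ∈ Finset.univ.powersetCard l, (2 * ((n : ℝ) - l - 1) *
        ∑ a ∈ Jᶜ, h (insert a J) * Real.log (h (insert a J))
      - (n - l) * (n - l - 1) * (h J * Real.log (h J)))
      ≤ ∑ J ∈ Finset.univ.powersetCard l, ∑ a ∈ Jᶜ, ∑ b ∈ (insert a J)ᶜ,
        h (insert b (insert a J)) * Real.log (h (insert b (insert a J))) := by
    refine Finset.sum_le_sum fun J hJ => ?_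
    rw [Finset.mem_powersetCard] at hJ
    rw [← hJ.2] at hl ⊢
    exact hh.local_convexity hl hr
  rw [Finset.sum_sub_distrib, ← Finset.mul_sum, ← Finset.mul_sum,
    sum_insert_compl l fun J => h J * Real.log (h J),
    sum_insert_compl l fun J => ∑ b ∈ Jᶜ, h (insert b J) * Real.log (h (insert b J)),
    sum_insert_compl (l + 1) fun J => h J * Real.log (h J)] at h1
  simp only [nsmul_eq_mul] at h1
  push_cast at h1
  have hln : ((l : ℝ) + 2) ≤ n := by exact_mod_cast hl.trans hr
  have c0 : (0 : ℝ) < n.choose l := Nat.cast_pos.2 (Nat.choose_pos (by omega))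
  have c1 : (0 : ℝ) < n.choose (l + 1) := Nat.cast_pos.2 (Nat.choose_pos (by omega))
  have c2 : (0 : ℝ) < n.choose (l + 2) := Nat.cast_pos.2 (Nat.choose_pos (by omega))
  have d1 : (n.choose (l + 1) : ℝ) * (l + 1) = n.choose l * (n - l) := by
    rw [← Nat.cast_sub (by omega : l ≤ n)]
    exact_mod_cast Nat.choose_succ_right_eq n l
  have d2 : (n.choose (l + 2) : ℝ) * (l + 2) = n.choose (l + 1) * (n - l - 1) := by
    have := Nat.choose_succ_right_eq n (l + 1)
    have h3 : (n : ℝ) - l - 1 = ((n - (l + 1) : ℕ) : ℝ) := by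
      rw [Nat.cast_sub (by omega)]; push_cast; ring
    rw [h3]
    exact_mod_cast this
  have m0 : Φ l = n.choose l * meanEntropy h l := by
    rw [meanEntropy, mul_div_cancel₀ _ c0.ne']
  have m1 : Φ (l + 1) = n.choose (l + 1) * meanEntropy h (l + 1) := by
    rw [meanEntropy, mul_div_cancel₀ _ c1.ne']
  have m2 : Φ (l + 2) = n.choose (l + 2) * meanEntropy h (l + 2) := by
    rw [meanEntropy, mul_div_cancel₀ _ c2.ne']
  change 2 * ((n : ℝ) - l - 1) * ((l + 1) * Φ (l + 1)) - (n - l) * (n - l - 1) * Φ l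
    ≤ (l + 1) * ((l + 1 + 1) * Φ (l + 2)) at h1
  rw [m0, m1, m2] at h1
  set e0 := meanEntropy h l
  set e1 := meanEntropy h (l + 1)
  set e2 := meanEntropy h (l + 2)
  have hpos : (0 : ℝ) < n.choose l * (n - l) * (n - l - 1) := by
    have : (0 : ℝ) < n - l := by linarith
    have : (0 : ℝ) < n - l - 1 := by linarith
    positivity
  refine le_of_mul_le_mul_left ?_ hpos
  have k1 : (n.choose l : ℝ) * (n - l) * (n - l - 1) * (2 * e1)
      = 2 * ((n : ℝ) - l - 1) * ((l + 1) * (n.choose (l + 1) * e1)) := by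
    linear_combination (-2 * e1 * ((n : ℝ) - l - 1)) * d1
  have k2 : (n.choose l : ℝ) * (n - l) * (n - l - 1) * (e0 + e2)
      = (n - l) * (n - l - 1) * (n.choose l * e0)
        + (l + 1) * ((l + 1 + 1) * (n.choose (l + 2) * e2)) := by
    linear_combination (-e2 * ((n : ℝ) - l - 1)) * d1 - (e2 * (l + 1)) * d2
  rw [k1, k2]
  linarith

/-- A convex sequence lies below its chord from 0 to r. -/
theorem _root_.convex_sequence_le {e : ℕ → ℝ} {r : ℕ}
    (he : ∀ l, l + 2 ≤ r → 2 * e (l + 1) ≤ e l + e (l + 2)) {t : ℕ} (ht : 1 ≤ t) (htr : t ≤ r) :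
    r * (e t - e 0) ≤ t * (e r - e 0) := by
  have h1 : ∀ l, l + 1 ≤ r → (l + 1) * (e l - e 0) ≤ l * (e (l + 1) - e 0) := by
    intro l
    induction l with
    | zero => simp
    | succ l ih =>
      intro hl
      have h2 := ih (by omega)
      have h3 := mul_le_mul_of_nonneg_left (he l (by omega)) (by positivity : (0 : ℝ) ≤ l + 1)
      push_cast
      have : e (l + 1 + 1) = e (l + 2) := rfl
      rw [this]
      linarith
  have h2 : ∀ s, t ≤ s → s ≤ r → s * (e t - e 0) ≤ t * (e s - e 0) := by
    intro s hs
    induction s, hs using Nat.le_induction with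
    | base => intro _; exact le_rfl
    | succ s hs ih =>
      intro hsr
      have h3 := ih (by omega)
      have h4 := h1 s hsr
      have hs0 : (0 : ℝ) < s := by exact_mod_cast (by omega : 0 < s)
      have h5 := mul_le_mul_of_nonneg_left h3 (by positivity : (0 : ℝ) ≤ (s : ℝ) + 1)
      have h6 := mul_le_mul_of_nonneg_left h4 (Nat.cast_nonneg (α := ℝ) t)
      refine le_of_mul_le_mul_left ?_ hs0
      push_cast
      linarith
  exact h2 r htr le_rfl

/-- The chord ends at level r at a value at most 0, since h log h ≤ 0 for 0 ≤ h ≤ 1. -/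
theorem meanEntropy_le (hh : IsHarmonic r h) (hr : r ≤ n) (h1 : ∀ J, J.card ≤ r → h J ≤ 1) {t : ℕ}
    (ht : 1 ≤ t) (htr : t ≤ r) :
    meanEntropy h t ≤ (1 - t / r) * (h ∅ * Real.log (h ∅)) := by
  have h2 := convex_sequence_le (e := meanEntropy h)
    (fun l hl => hh.meanEntropy_convex hr hl) ht htr
  have h3 : meanEntropy h r ≤ 0 := by
    refine div_nonpos_of_nonpos_of_nonneg (Finset.sum_nonpos fun J hJ => ?_) (Nat.cast_nonneg _)
    exact Real.mul_log_nonpos (hh.nonneg J) (h1 J (Finset.mem_powersetCard.1 hJ).2.le)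
  have h4 : meanEntropy h 0 = h ∅ * Real.log (h ∅) := by simp [meanEntropy]
  rw [← h4]
  have hr0 : (0 : ℝ) < r := by exact_mod_cast (by omega : 0 < r)
  refine le_of_mul_le_mul_left ?_ hr0
  have h5 : (r : ℝ) * ((1 - t / r) * meanEntropy h 0)
      = r * meanEntropy h 0 - t * meanEntropy h 0 := by
    field_simp
  rw [h5]
  have := mul_le_mul_of_nonneg_left h3 (Nat.cast_nonneg (α := ℝ) t)
  linarith

/-- Harmonic families of probability distributions vary little. -/
theorem sum_abs_sub_le {κ : Type*} [Fintype κ] {h : κ → Finset (Fin n) → ℝ}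
    (hh : ∀ c, IsHarmonic r (h c)) (hr : r ≤ n)
    (h1 : ∀ J : Finset (Fin n), J.card ≤ r → ∑ c, h c J = 1) {t : ℕ} (ht : 1 ≤ t) (htr : t ≤ r)
    {s : ℝ} (hs : 0 < s) :
    ∑ S ∈ Finset.univ.powersetCard t, ∑ c, |h c S - h c ∅|
      ≤ n.choose t * (s + t / r * Real.log (Fintype.card κ) / (2 * s)) := by
  have hC : (0 : ℝ) < n.choose t := Nat.cast_pos.2 (Nat.choose_pos (htr.trans hr))
  have hle : ∀ c (J : Finset (Fin n)), J.card ≤ r → h c J ≤ 1 := fun c J hJ => by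
    rw [← h1 J hJ]
    exact Finset.single_le_sum (f := fun c => h c J) (fun c _ => (hh c).nonneg J)
      (Finset.mem_univ c)
  have h2 : ∀ S ∈ Finset.univ.powersetCard t, ∀ c, |h c S - h c ∅|
      ≤ s * ((4 * h c ∅ + 2 * h c S) / 6)
      + (h c S * Real.log (h c S) - h c S * Real.log (h c ∅) - h c S + h c ∅) / (2 * s) := by
    intro S hS c
    refine abs_sub_le_of_relative_entropy ((hh c).nonneg S) ((hh c).nonneg ∅) (fun h0 => ?_) hs
    exact (hh c).eq_zero hr h0 (by rw [(Finset.mem_powersetCard.1 hS).2]; exact htr)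
  have h3 := Finset.sum_le_sum fun S hS => Finset.sum_le_sum fun c (_ : c ∈ Finset.univ) =>
    h2 S hS c
  refine h3.trans ?_
  rw [Finset.sum_comm]
  -- The mean of h(S) over the t-sets is h(∅), so the linear terms of the relative entropy cancel
  -- and the weights (4 h(∅) + 2 h(S))/6 average to h(∅).
  have h4 : ∀ c, ∑ S ∈ Finset.univ.powersetCard t, (s * ((4 * h c ∅ + 2 * h c S) / 6)
      + (h c S * Real.log (h c S) - h c S * Real.log (h c ∅) - h c S + h c ∅) / (2 * s))
      ≤ n.choose t * (s * h c ∅ + t / r * (-(h c ∅ * Real.log (h c ∅))) / (2 * s)) := by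
    intro c
    have h5 := (hh c).sum_eq hr htr
    have h6 := (hh c).meanEntropy_le hr (hle c) ht htr
    rw [meanEntropy, div_le_iff₀ hC] at h6
    simp only [Finset.sum_add_distrib, ← Finset.mul_sum, ← Finset.sum_div,
      Finset.sum_sub_distrib, ← Finset.sum_mul, h5, Finset.sum_const, Finset.card_powersetCard,
      Finset.card_univ, Fintype.card_fin, nsmul_eq_mul]
    have h7 : ∑ S ∈ Finset.univ.powersetCard t, h c S * Real.log (h c S)
        - n.choose t * h c ∅ * Real.log (h c ∅) - n.choose t * h c ∅ + n.choose t * h c ∅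
        ≤ n.choose t * (t / r * (-(h c ∅ * Real.log (h c ∅)))) := by linarith
    have h8 := div_le_div_of_nonneg_right h7 (by positivity : 0 ≤ 2 * s)
    refine (add_le_add_right h8 _).trans (le_of_eq ?_)
    ring
  refine (Finset.sum_le_sum fun c _ => h4 c).trans ?_
  rw [← Finset.mul_sum, Finset.sum_add_distrib, ← Finset.mul_sum, h1 ∅ (by simp), mul_one,
    ← Finset.sum_div, ← Finset.mul_sum, Finset.sum_neg_distrib]
  have h9 := sum_negMulLog_le (fun c => (hh c).nonneg ∅) (h1 ∅ (by simp))
  gcongr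

end IsHarmonic

end Harmonic

/-! ### Grouping the outcomes by approximate posterior. -/

section Cells

variable {n d : ℕ} {β : Fin n → Type*}

theorem Matrix.PosSemidef.eq_zero_of_hasSum_diag {ι : Type*} {X : Matrix ι ι ℂ}
    (hX : X.PosSemidef) (h : HasSum (fun i => X i i) 0) : X = 0 := by
  have h1 : HasSum (fun i => (X i i).re) 0 := by simpa using Complex.hasSum_re h
  have h2 := (hasSum_zero_iff_of_nonneg hX.re_diag_nonneg).1 h1
  ext i j
  have h3 := hX.norm_apply_le i j
  have h4 : (X i i).re = 0 := congrFun h2 i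
  rw [h4, Real.sqrt_zero, zero_mul] at h3
  exact norm_le_zero_iff.1 h3

theorem Matrix.PosSemidef.isDensity_smul {ι : Type*} {X : Matrix ι ι ℂ} {w : ℝ}
    (hX : X.PosSemidef) (h : HasSum (fun i => X i i) (w : ℂ)) (hw : 0 < w) :
    IsDensity ((w : ℂ)⁻¹ • X) := by
  refine ⟨hX.smul ?_, ?_⟩
  · rw [← Complex.ofReal_inv]
    exact Complex.zero_le_real.2 (inv_nonneg.2 hw.le)
  · have := h.mul_left (w : ℂ)⁻¹
    rwa [inv_mul_cancel₀ (Complex.ofReal_ne_zero.2 hw.ne')] at this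

theorem IsDensity.traceNorm_le {ι : Type*} {ρ : Matrix ι ι ℂ} (h : IsDensity ρ) :
    traceNorm ρ ≤ 1 := by
  have := h.1.traceNorm_le (a := 1) (by simpa using Complex.hasSum_re h.2)
  rwa [ENNReal.ofReal_one] at this

namespace CondMap

theorem abs_posterior_le_one (Ψ : CondMap d β) (p : Fin d × Fin d) : |Ψ.posterior p| ≤ 1 := by
  rw [← sq_le_one_iff_abs_le_one]
  exact (Finset.single_le_sum (f := fun p => Ψ.posterior p ^ 2)
    (fun _ _ => sq_nonneg _) (Finset.mem_univ p)).trans Ψ.sum_posterior_sq_le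

theorem floor_posterior_bounds (Ψ : CondMap d β) (k : ℕ) (p : Fin d × Fin d) :
    -(k : ℤ) ≤ ⌊k * Ψ.posterior p⌋ ∧ ⌊k * Ψ.posterior p⌋ ≤ k := by
  have h := abs_le.1 (Ψ.abs_posterior_le_one p)
  have hk : (0 : ℝ) ≤ k := Nat.cast_nonneg k
  constructor
  · rw [Int.le_floor]; push_cast; nlinarith
  · have h1 : (⌊k * Ψ.posterior p⌋ : ℝ) ≤ k := (Int.floor_le _).trans (by nlinarith)
    exact_mod_cast h1

/-- The posterior up to an error of `1 / k` in each coordinate. -/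
noncomputable def cell (k : ℕ) (Ψ : CondMap d β) (p : Fin d × Fin d) : Fin (2 * k + 1) :=
  -- The floor lies between -k and k; the shift by k makes it an index below 2k + 1.
  ⟨(⌊k * Ψ.posterior p⌋ + k).toNat, by have := Ψ.floor_posterior_bounds k p; omega⟩

theorem abs_sub_posterior_le_of_cell_eq {k : ℕ} (hk : 0 < k) {Ψ Ψ' : CondMap d β}
    (h : Ψ.cell k = Ψ'.cell k) (p : Fin d × Fin d) :
    |Ψ.posterior p - Ψ'.posterior p| ≤ 1 / k := by
  have h1 := congrArg Fin.val (congrFun h p)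
  simp only [cell] at h1
  have h2 := Ψ.floor_posterior_bounds k p
  have h3 := Ψ'.floor_posterior_bounds k p
  have h4 : ⌊k * Ψ.posterior p⌋ = ⌊k * Ψ'.posterior p⌋ := by omega
  have h5 := Int.abs_sub_lt_one_of_floor_eq_floor h4
  have hk' : (0 : ℝ) < k := Nat.cast_pos.2 hk
  rw [← mul_sub, abs_mul, abs_of_pos hk'] at h5
  rw [le_div_iff₀ hk']
  linarith

theorem state_eq_zero (Ψ : CondMap d β) (S : Finset (Fin n)) (h : Ψ.weight = 0) :
    Ψ.state S = 0 :=
  (Ψ.state_posSemidef S).eq_zero_of_hasSum_diag (by simpa [h] using Ψ.hasSum_state S)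

end CondMap

namespace ConditioningScheme

open CondMap

variable {Λ : CondMap d β} (𝔖 : ConditioningScheme Λ) (k : ℕ)

/-- The index set of the cells. -/
abbrev Cell (d k : ℕ) : Type := Fin d × Fin d → Fin (2 * k + 1)

theorem card_cell (d k : ℕ) : Fintype.card (Cell d k) = (2 * k + 1) ^ d ^ 2 := by
  simp [Cell, sq]

/-- The weight of a cell, given that no factor in `J` has been measured. -/
noncomputable def cellWeight (c : Cell d k) (J : Finset (Fin n)) : ℝ :=
  (∑ ω with Disjoint (𝔖.used ω) J,
    if (𝔖.outcome ω).cell k = c then (𝔖.outcome ω).weight else 0) / 𝔖.num J.card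

theorem cellWeight_nonneg (c : Cell d k) (J : Finset (Fin n)) : 0 ≤ 𝔖.cellWeight k c J := by
  refine div_nonneg (Finset.sum_nonneg fun ω _ => ?_) (𝔖.num_nonneg _)
  split_ifs
  exacts [weight_nonneg _, le_rfl]

theorem sum_weight (J : Finset (Fin n)) :
    ∑ ω with Disjoint (𝔖.used ω) J, (𝔖.outcome ω).weight = 𝔖.num J.card * Λ.weight := by
  have := congrArg (fun M => M.trace.re) (𝔖.sum_eff J)
  simpa [Matrix.trace_sum, weight] using this

theorem sum_cellWeight {J : Finset (Fin n)} (hJ : J.card + 𝔖.u ≤ n) :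
    ∑ c, 𝔖.cellWeight k c J = Λ.weight := by
  simp only [cellWeight]
  rw [← Finset.sum_div, Finset.sum_comm]
  simp only [Finset.sum_ite_eq, Finset.mem_univ, if_true]
  rw [sum_weight, mul_div_cancel_left₀ _ (𝔖.num_pos _ hJ).ne']

/-- An outcome whose measured set avoids J also avoids J ∪ {a} for exactly n - u - |J| choices of a
outside J. -/
theorem sum_insert (f : 𝔖.Ω → ℝ) {J : Finset (Fin n)} (hJ : J.card + 𝔖.u ≤ n) :
    ∑ a ∈ Jᶜ, ∑ ω with Disjoint (𝔖.used ω) (insert a J), f ω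
      = (n - 𝔖.u - J.card) * ∑ ω with Disjoint (𝔖.used ω) J, f ω := by
  simp only [Finset.sum_filter]
  rw [Finset.sum_comm, Finset.mul_sum]
  refine Finset.sum_congr rfl fun ω _ => ?_
  split_ifs with h
  · have h1 : ∀ a ∈ Jᶜ, (if Disjoint (𝔖.used ω) (insert a J) then f ω else 0)
        = if a ∉ 𝔖.used ω then f ω else 0 := by
      intro a _
      simp [Finset.disjoint_insert_right, h]
    rw [Finset.sum_congr rfl h1, ← Finset.sum_filter, Finset.sum_const, nsmul_eq_mul]
    have h2 : (Jᶜ.filter fun a => a ∉ 𝔖.used ω) = (J ∪ 𝔖.used ω)ᶜ := by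
      ext a; simp
    rw [h2, Finset.card_compl, Finset.card_union_of_disjoint h.symm, 𝔖.card_used,
      Fintype.card_fin, Nat.cast_sub hJ]
    push_cast; ring
  · rw [mul_zero]
    refine Finset.sum_eq_zero fun a _ => if_neg fun h2 => h ?_
    exact h2.mono_right (Finset.subset_insert _ _)

/-- The count above applied to the weights, whose sums are known; the positive weight of `Λ`
cancels. -/
theorem num_succ (hΛ : 0 < Λ.weight) {J : Finset (Fin n)} (hJ : J.card + 𝔖.u ≤ n) :
    (n - J.card) * 𝔖.num (J.card + 1) = (n - 𝔖.u - J.card) * 𝔖.num J.card := by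
  have h := 𝔖.sum_insert (fun ω => (𝔖.outcome ω).weight) hJ
  have h1 : ∀ a ∈ Jᶜ, ∑ ω with Disjoint (𝔖.used ω) (insert a J), (𝔖.outcome ω).weight
      = 𝔖.num (J.card + 1) * Λ.weight := fun a ha => by
    rw [sum_weight, Finset.card_insert_of_notMem (Finset.mem_compl.1 ha)]
  rw [Finset.sum_congr rfl h1, Finset.sum_const, Finset.card_compl, Fintype.card_fin,
    nsmul_eq_mul, Nat.cast_sub (by omega), sum_weight] at h
  refine mul_right_cancel₀ hΛ.ne' ?_
  linarith

/-- The same count restricted to one cell. The recursion for `num` converts the factor n - u - |J|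
into n - |J|. -/
theorem isHarmonic_cellWeight (hΛ : 0 < Λ.weight) (hu : 𝔖.u ≤ n) (c : Cell d k) :
    IsHarmonic (n - 𝔖.u) fun J => 𝔖.cellWeight k c J / Λ.weight where
  nonneg J := div_nonneg (𝔖.cellWeight_nonneg k c J) hΛ.le
  mean J hJ := by
    have hJ' : J.card + 1 + 𝔖.u ≤ n := by omega
    have h1 := 𝔖.num_succ hΛ (J := J) (by omega)
    have h2 := 𝔖.num_pos _ hJ'
    have h3 := 𝔖.num_pos J.card (by omega)
    rw [← Finset.sum_div, mul_div_assoc']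
    congr 1
    have h4 : ∀ a ∈ Jᶜ, 𝔖.cellWeight k c (insert a J)
        = (∑ ω with Disjoint (𝔖.used ω) (insert a J),
          if (𝔖.outcome ω).cell k = c then (𝔖.outcome ω).weight else 0) / 𝔖.num (J.card + 1) :=
      fun a ha => by
        rw [cellWeight, Finset.card_insert_of_notMem (Finset.mem_compl.1 ha)]
    rw [Finset.sum_congr rfl h4, ← Finset.sum_div, 𝔖.sum_insert _ (by omega), cellWeight,
      div_eq_iff h2.ne', mul_div_assoc', div_mul_eq_mul_div, eq_div_iff h3.ne']
    linear_combination (-∑ ω with Disjoint (𝔖.used ω) J,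
          if (𝔖.outcome ω).cell k = c then (𝔖.outcome ω).weight else 0) * h1

/-- For most sets `S` the weights of the cells hardly change if the outcomes of measurements on `S`
are left out. -/
theorem sum_abs_cellWeight_sub_le (hΛ : 0 < Λ.weight) {t : ℕ} (ht : 1 ≤ t)
    (htu : 𝔖.u + t ≤ n) {s : ℝ} (hs : 0 < s) :
    ∑ S ∈ Finset.univ.powersetCard t, ∑ c, |𝔖.cellWeight k c S - 𝔖.cellWeight k c ∅|
      ≤ Λ.weight * (n.choose t * (s + t / (n - 𝔖.u : ℕ)
        * Real.log ((2 * k + 1 : ℝ) ^ d ^ 2) / (2 * s))) := by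
  have h := IsHarmonic.sum_abs_sub_le (h := fun c J => 𝔖.cellWeight k c J / Λ.weight)
    (fun c => 𝔖.isHarmonic_cellWeight k hΛ (by omega) c) (Nat.sub_le _ _)
    (fun J hJ => by
      rw [← Finset.sum_div, 𝔖.sum_cellWeight k (by omega), div_self hΛ.ne'])
    ht (by omega) hs
  rw [card_cell] at h
  push_cast at h
  refine le_trans (le_of_eq ?_) (mul_le_mul_of_nonneg_left h hΛ.le)
  rw [Finset.mul_sum]
  refine Finset.sum_congr rfl fun S _ => ?_
  rw [Finset.mul_sum]
  refine Finset.sum_congr rfl fun c _ => ?_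
  rw [← sub_div, abs_div, abs_of_pos hΛ, mul_div_cancel₀ _ hΛ.ne']

/-- The measurement operator of a cell. -/
noncomputable def cellEffect (c : Cell d k) : Matrix (Fin d) (Fin d) ℂ :=
  (𝔖.num 0 : ℂ)⁻¹ • ∑ ω, if (𝔖.outcome ω).cell k = c then (𝔖.outcome ω).eff else 0

theorem cellEffect_posSemidef (c : Cell d k) : (𝔖.cellEffect k c).PosSemidef := by
  refine Matrix.PosSemidef.smul (Matrix.posSemidef_sum _ fun ω _ => ?_) ?_
  · split_ifs
    exacts [eff_posSemidef _, Matrix.PosSemidef.zero]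
  · rw [← Complex.ofReal_inv]
    exact Complex.zero_le_real.2 (inv_nonneg.2 (𝔖.num_nonneg 0))

theorem sum_cellEffect (hu : 𝔖.u ≤ n) : ∑ c, 𝔖.cellEffect k c = Λ.eff := by
  simp only [cellEffect]
  rw [← Finset.smul_sum, Finset.sum_comm]
  simp only [Finset.sum_ite_eq, Finset.mem_univ, if_true]
  have h := 𝔖.sum_eff ∅
  simp only [Finset.disjoint_empty_right, Finset.filter_true, Finset.card_empty] at h
  rw [h, smul_smul, inv_mul_cancel₀, one_smul]
  exact Complex.ofReal_ne_zero.2 (𝔖.num_pos 0 (by omega)).ne'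

theorem cellWeight_empty (c : Cell d k) :
    𝔖.cellWeight k c ∅ = (𝔖.num 0)⁻¹ *
      ∑ ω, if (𝔖.outcome ω).cell k = c then (𝔖.outcome ω).weight else 0 := by
  simp only [cellWeight, Finset.disjoint_empty_right, Finset.filter_true, Finset.card_empty]
  rw [div_eq_inv_mul]

theorem trace_cellEffect (c : Cell d k) :
    (𝔖.cellEffect k c).trace = (𝔖.cellWeight k c ∅ : ℂ) := by
  rw [cellWeight_empty, cellEffect, Matrix.trace_smul, Matrix.trace_sum, smul_eq_mul]
  push_cast
  congr 1
  refine Finset.sum_congr rfl fun ω _ => ?_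
  split_ifs
  exacts [(coe_weight _).symm, by simp]

theorem hermCoord_cellEffect (c : Cell d k) (p : Fin d × Fin d) :
    hermCoord (𝔖.cellEffect k c) p = (𝔖.num 0)⁻¹ * ∑ ω, if (𝔖.outcome ω).cell k = c then
      (𝔖.outcome ω).weight * (𝔖.outcome ω).posterior p else 0 := by
  have hsum : ∀ (s : Finset 𝔖.Ω) (g : 𝔖.Ω → Matrix (Fin d) (Fin d) ℂ),
      hermCoord (∑ ω ∈ s, g ω) p = ∑ ω ∈ s, hermCoord (g ω) p := by
    intro s g
    simp [hermCoord, Matrix.sum_apply, Finset.sum_add_distrib]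
  rw [cellEffect, ← Complex.ofReal_inv, hermCoord_smul, hsum]
  congr 1
  refine Finset.sum_congr rfl fun ω _ => ?_
  split_ifs
  exacts [(weight_mul_posterior _ p).symm, by simp [hermCoord]]

theorem cellEffect_eq_zero {c : Cell d k} (h : 𝔖.cellWeight k c ∅ = 0) :
    𝔖.cellEffect k c = 0 :=
  (𝔖.cellEffect_posSemidef k c).trace_eq_zero_iff.1 (by rw [trace_cellEffect, h]; simp)

theorem sum_norm_sq_cellEffect_le (c : Cell d k) :
    ∑ p, ∑ q, ‖((𝔖.cellWeight k c ∅ : ℂ)⁻¹ • 𝔖.cellEffect k c) p q‖ ^ 2 ≤ 1 ^ 2 := by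
  rcases (𝔖.cellWeight_nonneg k c ∅).eq_or_lt with h | h
  · simp [← h]
  have hpsd := 𝔖.cellEffect_posSemidef k c
  have h1 := hpsd.sum_hermCoord_sq_le
  rw [← hpsd.1.sum_norm_sq, trace_cellEffect, Complex.ofReal_re] at h1
  simp only [Matrix.smul_apply, norm_smul, norm_inv, Complex.norm_real, Real.norm_eq_abs,
    abs_of_pos h, mul_pow, ← Finset.mul_sum]
  rw [one_pow, inv_pow, inv_mul_le_iff₀ (by positivity), mul_one]
  exact h1

/-- The normalised effect of a cell is the weighted mean of the posteriors in it, all of which lie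
within 1/k of each other in each coordinate. -/
theorem abs_posterior_sub_cell_le (hk : 0 < k) (ω : 𝔖.Ω) (p : Fin d × Fin d)
    (h : 0 < 𝔖.cellWeight k ((𝔖.outcome ω).cell k) ∅) :
    |(𝔖.outcome ω).posterior p - (𝔖.cellWeight k ((𝔖.outcome ω).cell k) ∅)⁻¹ *
      hermCoord (𝔖.cellEffect k ((𝔖.outcome ω).cell k)) p| ≤ 1 / k := by
  set c := (𝔖.outcome ω).cell k with hc
  set W := 𝔖.cellWeight k c ∅ with hW
  have h1 : W * (𝔖.outcome ω).posterior p - hermCoord (𝔖.cellEffect k c) p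
      = (𝔖.num 0)⁻¹ * ∑ ω', if (𝔖.outcome ω').cell k = c then
        (𝔖.outcome ω').weight * ((𝔖.outcome ω).posterior p - (𝔖.outcome ω').posterior p)
        else 0 := by
    rw [hW, cellWeight_empty, hermCoord_cellEffect, mul_assoc, ← mul_sub, Finset.sum_mul,
      ← Finset.sum_sub_distrib]
    congr 1
    refine Finset.sum_congr rfl fun ω' _ => ?_
    split_ifs <;> ring
  have h2 : |W * (𝔖.outcome ω).posterior p - hermCoord (𝔖.cellEffect k c) p| ≤ W * (1 / k) := by
    rw [h1, abs_mul, abs_of_nonneg (inv_nonneg.2 (𝔖.num_nonneg 0)), hW, cellWeight_empty,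
      mul_assoc]
    refine mul_le_mul_of_nonneg_left ?_ (inv_nonneg.2 (𝔖.num_nonneg 0))
    rw [Finset.sum_mul]
    refine (Finset.abs_sum_le_sum_abs _ _).trans (Finset.sum_le_sum fun ω' _ => ?_)
    split_ifs with h'
    · rw [abs_mul, abs_of_nonneg (weight_nonneg _)]
      exact mul_le_mul_of_nonneg_left
        (abs_sub_posterior_le_of_cell_eq hk (hc.symm.trans h'.symm) p) (weight_nonneg _)
    · simp
  have h3 : (𝔖.outcome ω).posterior p - W⁻¹ * hermCoord (𝔖.cellEffect k c) p
      = W⁻¹ * (W * (𝔖.outcome ω).posterior p - hermCoord (𝔖.cellEffect k c) p) := by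
    field_simp
  rw [h3, abs_mul, abs_of_pos (inv_pos.2 h), inv_mul_le_iff₀ h]
  exact h2

/-- The deviation of the normalised effect of an outcome from that of its cell. -/
noncomputable def deviation (ω : 𝔖.Ω) : Matrix (Fin d) (Fin d) ℂ :=
  ((𝔖.outcome ω).weight : ℂ)⁻¹ • (𝔖.outcome ω).eff
    - (𝔖.cellWeight k ((𝔖.outcome ω).cell k) ∅ : ℂ)⁻¹ • 𝔖.cellEffect k ((𝔖.outcome ω).cell k)

theorem cellWeight_pos (hu : 𝔖.u ≤ n) (ω : 𝔖.Ω) (h : 0 < (𝔖.outcome ω).weight) :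
    0 < 𝔖.cellWeight k ((𝔖.outcome ω).cell k) ∅ := by
  rw [cellWeight_empty]
  refine mul_pos (inv_pos.2 (𝔖.num_pos 0 (by omega))) ?_
  refine Finset.sum_pos' (fun ω' _ => ?_) ⟨ω, Finset.mem_univ _, by simpa using h⟩
  split_ifs
  exacts [weight_nonneg _, le_rfl]

theorem sum_norm_sq_deviation_le (hk : 0 < k) (hu : 𝔖.u ≤ n) (ω : 𝔖.Ω)
    (h : 0 < (𝔖.outcome ω).weight) :
    ∑ p, ∑ q, ‖𝔖.deviation k ω p q‖ ^ 2 ≤ ((d : ℝ) / k) ^ 2 := by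
  have hW := 𝔖.cellWeight_pos k hu ω h
  have hsm : ∀ (w : ℝ) {M : Matrix (Fin d) (Fin d) ℂ}, M.IsHermitian →
      ((w : ℂ)⁻¹ • M).IsHermitian := by
    intro w M hM
    rw [← Complex.ofReal_inv, Matrix.IsHermitian, Matrix.conjTranspose_smul, hM.eq,
      Complex.star_def, Complex.conj_ofReal]
  have hherm : (𝔖.deviation k ω).IsHermitian :=
    (hsm _ (eff_posSemidef _).1).sub (hsm _ (𝔖.cellEffect_posSemidef k _).1)
  rw [hherm.sum_norm_sq]
  have h1 : ∀ p, hermCoord (𝔖.deviation k ω) p ^ 2 ≤ (1 / (k : ℝ)) ^ 2 := by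
    intro p
    have h2 := 𝔖.abs_posterior_sub_cell_le k hk ω p hW
    have h3 : hermCoord (𝔖.deviation k ω) p = (𝔖.outcome ω).posterior p
        - (𝔖.cellWeight k ((𝔖.outcome ω).cell k) ∅)⁻¹ *
      hermCoord (𝔖.cellEffect k ((𝔖.outcome ω).cell k)) p := by
      rw [deviation, sub_eq_add_neg, hermCoord_add, ← neg_smul, ← Complex.ofReal_inv,
        ← Complex.ofReal_inv, ← Complex.ofReal_neg, hermCoord_smul, hermCoord_smul, posterior]
      ring
    rw [h3, ← sq_abs]
    gcongr
  refine (Finset.sum_le_sum fun p _ => h1 p).trans (le_of_eq ?_)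
  rw [Finset.sum_const, Finset.card_univ, Fintype.card_prod, Fintype.card_fin, nsmul_eq_mul]
  push_cast; ring

end ConditioningScheme

end Cells

/-! ### The measure-and-prepare approximation and its mean error. -/

section CellStates

variable {n d : ℕ} {β : Fin n → Type*}

namespace ConditioningScheme

open CondMap

variable {Λ : CondMap d β} (𝔖 : ConditioningScheme Λ) (k : ℕ)

/-- The state of the factors in `S` which belongs to a cell, up to normalisation. -/
noncomputable def cellState (c : Cell d k) (S : Finset (Fin n)) :
    Matrix (∀ j : S, β j) (∀ j : S, β j) ℂ :=
  (𝔖.num S.card : ℂ)⁻¹ • ∑ ω with Disjoint (𝔖.used ω) S,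
    if (𝔖.outcome ω).cell k = c then (𝔖.outcome ω).state S else 0

theorem cellState_posSemidef (c : Cell d k) (S : Finset (Fin n)) :
    (𝔖.cellState k c S).PosSemidef := by
  refine Matrix.PosSemidef.smul (Matrix.posSemidef_sum _ fun ω _ => ?_) ?_
  · split_ifs
    exacts [state_posSemidef _ _, Matrix.PosSemidef.zero]
  · rw [← Complex.ofReal_inv]
    exact Complex.zero_le_real.2 (inv_nonneg.2 (𝔖.num_nonneg _))

theorem hasSum_cellState (c : Cell d k) (S : Finset (Fin n)) :
    HasSum (fun x => 𝔖.cellState k c S x x) (𝔖.cellWeight k c S : ℂ) := by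
  have h : HasSum (fun x => ∑ ω with Disjoint (𝔖.used ω) S,
      (if (𝔖.outcome ω).cell k = c then (𝔖.outcome ω).state S else 0) x x)
      (∑ ω with Disjoint (𝔖.used ω) S,
        ((if (𝔖.outcome ω).cell k = c then (𝔖.outcome ω).weight else 0 : ℝ) : ℂ)) := by
    refine hasSum_sum fun ω _ => ?_
    split_ifs
    · exact hasSum_state _ _
    · simp
  have h2 := h.mul_left (𝔖.num S.card : ℂ)⁻¹
  rw [cellWeight, div_eq_inv_mul]
  push_cast at h2 ⊢
  simpa only [cellState, Matrix.smul_apply, Matrix.sum_apply, smul_eq_mul] using h2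

theorem exists_density_cellState (hΛ : 0 < Λ.weight) (c : Cell d k) (S : Finset (Fin n)) :
    ∃ σ : Matrix (∀ j : S, β j) (∀ j : S, β j) ℂ, IsDensity σ ∧
      𝔖.cellState k c S = (𝔖.cellWeight k c S : ℂ) • σ := by
  rcases (𝔖.cellWeight_nonneg k c S).eq_or_lt with h | h
  -- A cell of weight 0 may be given any state; the normalised state of `Λ` is at hand.
  · refine ⟨_, (Λ.state_posSemidef S).isDensity_smul (Λ.hasSum_state S) hΛ, ?_⟩
    rw [← h, Complex.ofReal_zero, zero_smul]
    exact (𝔖.cellState_posSemidef k c S).eq_zero_of_hasSum_diag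
      (by simpa [← h] using 𝔖.hasSum_cellState k c S)
  · refine ⟨_, (𝔖.cellState_posSemidef k c S).isDensity_smul (𝔖.hasSum_cellState k c S) h, ?_⟩
    rw [smul_smul, mul_inv_cancel₀ (Complex.ofReal_ne_zero.2 h.ne'), one_smul]

/-- The outcomes that avoid S average to the marginal of `Λ`. Each is replaced by its product
approximation (the defect), then its normalised effect by that of its cell (the deviation), and
finally the cell weights seen from S by those of the POVM. -/
theorem partialTrace_sub_cells {S : Finset (Fin n)} (hS : S.card + 𝔖.u ≤ n)
    {σ : Cell d k → Matrix (∀ j : S, β j) (∀ j : S, β j) ℂ}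
    (hσ : ∀ c, 𝔖.cellState k c S = (𝔖.cellWeight k c S : ℂ) • σ c)
    (X : Matrix (Fin d) (Fin d) ℂ) :
    partialTrace S (Λ.1 X) - ∑ c, (𝔖.cellEffect k c * X).trace • σ c
      = (((𝔖.num S.card : ℂ)⁻¹ •
            ∑ ω with Disjoint (𝔖.used ω) S, (𝔖.outcome ω).defect S) X
          + ∑ ω with Disjoint (𝔖.used ω) S, (𝔖.deviation k ω * X).trace •
            ((𝔖.num S.card : ℂ)⁻¹ • (𝔖.outcome ω).state S))
        + ∑ c, (((𝔖.cellWeight k c ∅ : ℂ)⁻¹ • 𝔖.cellEffect k c) * X).trace •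
            (((𝔖.cellWeight k c S - 𝔖.cellWeight k c ∅ : ℝ) : ℂ) • σ c) := by
  set N : ℂ := (𝔖.num S.card : ℂ) with hN
  have hN0 : N ≠ 0 := Complex.ofReal_ne_zero.2 (𝔖.num_pos _ hS).ne'
  have h1 : partialTrace S (Λ.1 X) = N⁻¹ •
      ∑ ω with Disjoint (𝔖.used ω) S, partialTrace S ((𝔖.outcome ω).1 X) := by
    rw [𝔖.sum_partialTrace, smul_smul, inv_mul_cancel₀ hN0, one_smul]
  obtain ⟨b, hb⟩ : ∃ b : Cell d k → ℂ, ∀ c,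
      (((𝔖.cellWeight k c ∅ : ℂ)⁻¹ • 𝔖.cellEffect k c) * X).trace = b c := ⟨_, fun _ => rfl⟩
  have h2 : ∀ c, (𝔖.cellEffect k c * X).trace • σ c = (𝔖.cellWeight k c ∅ : ℂ) • b c • σ c := by
    intro c
    rw [← hb]
    by_cases h : 𝔖.cellWeight k c ∅ = 0
    · rw [𝔖.cellEffect_eq_zero k h, h]; simp
    · rw [smul_smul, smul_mul_assoc, Matrix.trace_smul, smul_eq_mul, mul_inv_cancel_left₀]
      exact Complex.ofReal_ne_zero.2 h
  have h3 : ∑ c, b c • (𝔖.cellWeight k c S : ℂ) • σ c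
      = N⁻¹ • ∑ ω with Disjoint (𝔖.used ω) S,
        b ((𝔖.outcome ω).cell k) • (𝔖.outcome ω).state S := by
    simp only [← hσ, cellState, ← hN, Finset.smul_sum]
    rw [Finset.sum_comm]
    refine Finset.sum_congr rfl fun ω _ => ?_
    rw [Finset.sum_eq_single ((𝔖.outcome ω).cell k)]
    · rw [if_pos rfl, smul_comm]
    · intro c _ hc
      rw [if_neg (Ne.symm hc), smul_zero, smul_zero]
    · simp
  have h4 : ∀ ω, (𝔖.deviation k ω * X).trace = ((𝔖.outcome ω).eff * X).trace
      / (𝔖.outcome ω).weight - b ((𝔖.outcome ω).cell k) := by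
    intro ω
    rw [deviation, sub_mul, Matrix.trace_sub, smul_mul_assoc, Matrix.trace_smul, smul_eq_mul,
      ← div_eq_inv_mul, hb]
  have h5 : ∀ c, b c • (((𝔖.cellWeight k c S - 𝔖.cellWeight k c ∅ : ℝ) : ℂ) • σ c)
      = b c • (𝔖.cellWeight k c S : ℂ) • σ c - (𝔖.cellWeight k c ∅ : ℂ) • (b c • σ c) := by
    intro c
    push_cast
    rw [sub_smul, smul_sub, smul_comm (b c) (𝔖.cellWeight k c ∅ : ℂ)]
  rw [h1]
  simp only [hb, h2, h4, h5, Finset.sum_sub_distrib, LinearMap.smul_apply, LinearMap.sum_apply,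
    defect_apply, smul_sub, sub_smul]
  rw [h3]
  simp only [Finset.smul_sum, smul_comm N⁻¹]
  abel

theorem diamondNorm_cells_le (hΛ : Λ.weight = d) (hk : 0 < k) {S : Finset (Fin n)}
    (hS : S.card + 𝔖.u ≤ n) {τ : ℝ} (hτ0 : 0 ≤ τ)
    (hτ : ∑ p, traceNorm (∑ ω with Disjoint (𝔖.used ω) S, (𝔖.outcome ω).defect S (hermBasis p))
          ≤ ENNReal.ofReal (𝔖.num S.card * τ))
    {σ : Cell d k → Matrix (∀ j : S, β j) (∀ j : S, β j) ℂ} (hσ1 : ∀ c, IsDensity (σ c))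
    (hσ : ∀ c, 𝔖.cellState k c S = (𝔖.cellWeight k c S : ℂ) • σ c) :
    diamondNorm (fun X => partialTrace S (Λ.1 X) - ∑ c, (𝔖.cellEffect k c * X).trace • σ c)
      ≤ ENNReal.ofReal (τ + (d : ℝ) ^ 2 / k
        + ∑ c, |𝔖.cellWeight k c S - 𝔖.cellWeight k c ∅|) := by
  have hu : 𝔖.u ≤ n := by omega
  have hN := 𝔖.num_pos _ hS
  have hNinv : ‖(𝔖.num S.card : ℂ)⁻¹‖ = (𝔖.num S.card)⁻¹ := by
    rw [norm_inv, Complex.norm_real, Real.norm_of_nonneg hN.le]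
  rw [funext (𝔖.partialTrace_sub_cells k hS hσ)]
  refine (diamondNorm_add_le _ _).trans ?_
  rw [ENNReal.ofReal_add (by positivity) (Finset.sum_nonneg fun _ _ => abs_nonneg _)]
  refine add_le_add ((diamondNorm_add_le _ _).trans ?_) ?_
  · rw [ENNReal.ofReal_add hτ0 (by positivity)]
    refine add_le_add ?_ ?_
    · refine (diamondNorm_linear_le _).trans ?_
      calc _ ≤ ∑ p, ENNReal.ofReal (𝔖.num S.card)⁻¹ *
            traceNorm (∑ ω with Disjoint (𝔖.used ω) S,
              (𝔖.outcome ω).defect S (hermBasis p)) := by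
            refine Finset.sum_le_sum fun p _ => ?_
            rw [LinearMap.smul_apply, LinearMap.sum_apply, ← hNinv]
            exact traceNorm_smul_le _ _
        _ ≤ ENNReal.ofReal (𝔖.num S.card)⁻¹ * ENNReal.ofReal (𝔖.num S.card * τ) := by
            rw [← Finset.mul_sum]
            gcongr
        _ = ENNReal.ofReal τ := by
            rw [← ENNReal.ofReal_mul (inv_nonneg.2 hN.le), inv_mul_cancel_left₀ hN.ne']
    · refine (diamondNorm_sum_le _ _).trans ?_
      have h1 : ∀ ω ∈ Finset.univ.filter fun ω => Disjoint (𝔖.used ω) S,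
          diamondNorm (fun X => (𝔖.deviation k ω * X).trace •
            ((𝔖.num S.card : ℂ)⁻¹ • (𝔖.outcome ω).state S))
          ≤ ENNReal.ofReal ((d : ℝ) / k * ((𝔖.num S.card)⁻¹ * (𝔖.outcome ω).weight)) := by
        intro ω _
        rcases (weight_nonneg (𝔖.outcome ω)).eq_or_lt with h | h
        · rw [state_eq_zero _ _ h.symm]
          simp [diamondNorm_zero]
        · refine (diamondNorm_trace_smul_le (by positivity)
            (𝔖.sum_norm_sq_deviation_le k hk hu ω h) _).trans ?_
          rw [ENNReal.ofReal_mul (by positivity), ENNReal.ofReal_mul (inv_nonneg.2 hN.le), ← hNinv]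
          gcongr
          refine (traceNorm_smul_le _ _).trans ?_
          gcongr
          exact traceNorm_state_le _ _
      refine (Finset.sum_le_sum h1).trans ?_
      rw [← ENNReal.ofReal_sum_of_nonneg]
      -- The outcomes that avoid S have total normalised weight d, which turns d/k into d²/k.
      · refine ENNReal.ofReal_le_ofReal (le_of_eq ?_)
        rw [← Finset.mul_sum, ← Finset.mul_sum, sum_weight, hΛ, inv_mul_cancel_left₀ hN.ne']
        ring
      · intro ω _
        have := weight_nonneg (𝔖.outcome ω)
        positivity
  · refine (diamondNorm_sum_le _ _).trans ?_
    rw [ENNReal.ofReal_sum_of_nonneg fun _ _ => abs_nonneg _]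
    refine Finset.sum_le_sum fun c _ => ?_
    refine (diamondNorm_trace_smul_le zero_le_one (𝔖.sum_norm_sq_cellEffect_le k c) _).trans ?_
    rw [ENNReal.ofReal_one, one_mul]
    refine (traceNorm_smul_le _ _).trans ?_
    rw [Complex.norm_real, Real.norm_eq_abs]
    refine (mul_le_mul_right (hσ1 c).traceNorm_le _).trans (le_of_eq (mul_one _))

end ConditioningScheme

/-- A single measurement approximates the marginals of a channel on sets of `t` factors, with small
error on average over these sets. -/
theorem IsChannel.exists_measurement_mean_error_le
    {Λ : Matrix (Fin d) (Fin d) ℂ →ₗ[ℂ] Matrix (∀ j, β j) (∀ j, β j) ℂ} (hΛ : IsChannel Λ)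
    (hd : 1 ≤ d) {t m k : ℕ} (ht : 1 ≤ t) (hm : 0 < m) (hmt : m * t ≤ n) (hk : 0 < k) {ε s : ℝ}
    (hε : 0 < ε) (hs : 0 < s) :
    ∃ (K : ℕ) (M : Fin K → Matrix (Fin d) (Fin d) ℂ), IsPOVM M ∧
      ∃ err : Finset (Fin n) → ℝ, (∀ S, 0 ≤ err S) ∧
        (∀ S : Finset (Fin n), S.card = t →
          ∃ σ : Fin K → Matrix (∀ j : S, β j) (∀ j : S, β j) ℂ, (∀ k, IsDensity (σ k)) ∧
            diamondNorm (fun X => partialTrace S (Λ X) - measurePrepare M σ X)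
              ≤ ENNReal.ofReal (err S)) ∧
        ∑ S ∈ Finset.univ.powersetCard t, err S ≤ n.choose t *
          ((d : ℝ) ^ 2 * (d / Real.sqrt m + ε) + (d : ℝ) ^ 2 / k
            + d * (s + t / (n + t - m * t : ℕ) * (d ^ 2 * Real.log (2 * k + 1)) / (2 * s))) := by
  set Λ' : CondMap d β := ⟨Λ, hΛ.isCondMap⟩ with hΛ'
  have heff : Λ'.eff = 1 := by
    refine CondMap.eff_ext fun X => ?_
    rw [← CondMap.diagTrace_apply, one_mul]
    exact (hΛ.tracePreserving X).tsum_eq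
  have hw : Λ'.weight = d := by
    rw [CondMap.weight, heff, Matrix.trace_one, Fintype.card_fin, Complex.natCast_re]
  have hw0 : 0 < Λ'.weight := by rw [hw]; exact_mod_cast hd
  obtain ⟨𝔖, τ, hu, hτ0, hτ, hτsum⟩ := CondMap.exists_scheme hε Λ' hm hmt
  let e := (Fintype.equivFin (ConditioningScheme.Cell d k)).symm
  refine ⟨_, fun i => 𝔖.cellEffect k (e i), ⟨fun i => 𝔖.cellEffect_posSemidef k _, ?_⟩,
    fun S => τ S + (d : ℝ) ^ 2 / k + ∑ c, |𝔖.cellWeight k c S - 𝔖.cellWeight k c ∅|,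
    fun S => ?_, fun S hS => ?_, ?_⟩
  · rw [e.sum_comp fun c => 𝔖.cellEffect k c, 𝔖.sum_cellEffect k (by omega), heff]
  · have := hτ0 S
    have : 0 ≤ ∑ c, |𝔖.cellWeight k c S - 𝔖.cellWeight k c ∅| :=
      Finset.sum_nonneg fun _ _ => abs_nonneg _
    positivity
  · choose σ hσ1 hσ using fun c => 𝔖.exists_density_cellState k hw0 c S
    refine ⟨fun i => σ (e i), fun i => hσ1 _, ?_⟩
    have h := 𝔖.diamondNorm_cells_le k hw hk (S := S) (by omega) (hτ0 S)
      (by have := hτ S hS; rwa [← hS] at this) hσ1 hσ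
    refine le_trans (le_of_eq ?_) h
    congr 1
    funext X
    rw [measurePrepare, e.sum_comp fun c => (𝔖.cellEffect k c * X).trace • σ c]
  · rw [Finset.sum_add_distrib, Finset.sum_add_distrib, Finset.sum_const,
      Finset.card_powersetCard, Finset.card_univ, Fintype.card_fin, nsmul_eq_mul]
    have h1 := 𝔖.sum_abs_cellWeight_sub_le k hw0 ht (by omega) hs
    rw [hw] at h1 hτsum
    -- At most (m - 1) t factors have been measured, since u + t ≤ m t.
    have h2 : (t : ℝ) / (n - 𝔖.u : ℕ) ≤ t / (n + t - m * t : ℕ) := by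
      have h3 : (0 : ℝ) < (n + t - m * t : ℕ) := Nat.cast_pos.2 (by omega)
      have h4 : ((n + t - m * t : ℕ) : ℝ) ≤ (n - 𝔖.u : ℕ) := Nat.cast_le.2 (by omega)
      gcongr
    have hlog : Real.log ((2 * k + 1 : ℝ) ^ d ^ 2) = d ^ 2 * Real.log (2 * k + 1) := by
      rw [Real.log_pow]; push_cast; rfl
    have hlog0 : 0 ≤ Real.log (2 * k + 1 : ℝ) := Real.log_nonneg (by
      have : (0 : ℝ) ≤ k := Nat.cast_nonneg k
      linarith)
    rw [hlog] at h1
    have h5 : (d : ℝ) * (n.choose t * (s + t / (n - 𝔖.u : ℕ)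
        * (d ^ 2 * Real.log (2 * k + 1)) / (2 * s)))
        ≤ d * (n.choose t * (s + t / (n + t - m * t : ℕ)
        * (d ^ 2 * Real.log (2 * k + 1)) / (2 * s))) := by gcongr
    linarith

end CellStates

/-! ### Choice of the parameters and numerical estimates. -/

section Parameters

theorem log_three_ge : (1.09 : ℝ) ≤ Real.log 3 := by
  have he := Real.exp_one_lt_d9
  have he0 := Real.exp_pos 1
  have h := Real.one_sub_inv_le_log_of_pos (x := 3 / Real.exp 1) (by positivity)
  rw [Real.log_div (by norm_num) he0.ne', Real.log_exp, inv_div] at h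
  linarith

/-- For d = 2 the last inequality is nearly tight and needs x < 1, which the trivial bound 2(1 -
1/d) provides; for d ≥ 3 the crude x ≤ 2 suffices. -/
theorem log_bounds {d : ℕ} (hd : 2 ≤ d) {x : ℝ} (hx : x < 2 * (1 - 1 / (d : ℝ))) :
    0.69 ≤ Real.log d ∧ x ≤ 2 ∧ 0.52 * x ≤ Real.log d ∧
      16 * (x * (2.14 + 2 * Real.log d) + 1) ≤ 27 * (d : ℝ) ^ 2 * Real.log d := by
  have hl2 := Real.log_two_gt_d9
  have hl2' := Real.log_two_lt_d9
  rcases hd.eq_or_lt with rfl | hd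
  · norm_num at hx
    push_cast
    refine ⟨by linarith, by linarith, by linarith, ?_⟩
    have : x * (2.14 + 2 * Real.log 2) ≤ 1 * (2.14 + 2 * Real.log 2) := by
      gcongr
    linarith
  · have hd3 : (3 : ℝ) ≤ d := by exact_mod_cast hd
    have hl : 1.09 ≤ Real.log d :=
      log_three_ge.trans (Real.log_le_log (by norm_num) hd3)
    have hx2 : x ≤ 2 := by
      have : 0 < 1 / (d : ℝ) := by positivity
      linarith
    refine ⟨by linarith, hx2, by linarith, ?_⟩
    have h1 : x * (2.14 + 2 * Real.log d) ≤ 2 * (2.14 + 2 * Real.log d) := by gcongr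
    have h2 : 27 * (3 : ℝ) ^ 2 * Real.log d ≤ 27 * (d : ℝ) ^ 2 * Real.log d := by gcongr
    linarith

/-- Since 2k + 1 ≤ 21.5 d²/x and log 21.5 ≤ 3.14, only -x log x ≤ 1 - x is needed; it accounts for
2.14 and the summand 1. -/
theorem mul_log_cells_le {d k : ℕ} (hd : 2 ≤ d) {x : ℝ} (hx0 : 0 < x) (hx : x ≤ 2)
    (hk : (k : ℝ) ≤ 10 * (d : ℝ) ^ 2 / x + 1) :
    x * Real.log (2 * k + 1) ≤ x * (2.14 + 2 * Real.log d) + 1 := by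
  have hd2 : (2 : ℝ) ≤ d := by exact_mod_cast hd
  have hk0 : (0 : ℝ) ≤ k := Nat.cast_nonneg k
  have h1 : (2 * k + 1 : ℝ) ≤ 21.5 * (d : ℝ) ^ 2 / x := by
    have h2 : (3 : ℝ) ≤ 1.5 * (d : ℝ) ^ 2 / x := by
      rw [le_div_iff₀ hx0]; nlinarith
    have h3 : 21.5 * (d : ℝ) ^ 2 / x = 2 * (10 * (d : ℝ) ^ 2 / x) + 1.5 * (d : ℝ) ^ 2 / x := by
      ring
    linarith
  have h4 : Real.log (2 * k + 1) ≤ Real.log 21.5 + 2 * Real.log d - Real.log x := by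
    refine (Real.log_le_log (by positivity) h1).trans (le_of_eq ?_)
    rw [Real.log_div (by positivity) hx0.ne', Real.log_mul (by norm_num) (by positivity),
      Real.log_pow]
    push_cast; ring
  have h5 : Real.log 21.5 ≤ 3.14 := by
    have h6 := Real.log_le_sub_one_of_pos (x := (21.5 / 2 ^ 5 : ℝ)) (by norm_num)
    rw [Real.log_div (by norm_num) (by norm_num), Real.log_pow] at h6
    have := Real.log_two_lt_d9
    push_cast at h6
    linarith
  have h7 := Real.one_sub_inv_le_log_of_pos hx0
  have h8 : x * (1 - x⁻¹) = x - 1 := by field_simp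
  have h9 := mul_le_mul_of_nonneg_left h7 hx0.le
  rw [h8] at h9
  have h10 : x * Real.log (2 * k + 1) ≤ x * (3.14 + 2 * Real.log d - Real.log x) := by
    gcongr
    linarith
  linarith

/-- A choice of the parameters for which the mean error is below `x`. -/
theorem exists_parameters {n d t : ℕ} (hd : 2 ≤ d) (ht : 1 ≤ t) (hn : 1 ≤ n) {x : ℝ} (hx0 : 0 < x)
    (hx : x < 2 * (1 - 1 / (d : ℝ)))
    (hx3 : x ^ 3 * n = 27 * (d : ℝ) ^ 6 * Real.log d * t) :
    ∃ (m k : ℕ) (ε s : ℝ), 0 < m ∧ m * t ≤ n ∧ 0 < k ∧ 0 < ε ∧ 0 < s ∧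
      (d : ℝ) ^ 2 * (d / Real.sqrt m + ε) + (d : ℝ) ^ 2 / k
        + d * (s + t / (n + t - m * t : ℕ) * (d ^ 2 * Real.log (2 * k + 1)) / (2 * s)) < x := by
  obtain ⟨hl, hx2, hlx, hlog⟩ := log_bounds hd hx
  set ℓ := Real.log d
  have hd2 : (2 : ℝ) ≤ d := by exact_mod_cast hd
  have hd0 : (0 : ℝ) < d := by linarith
  have ht0 : (0 : ℝ) < t := by exact_mod_cast ht
  have hn0 : (0 : ℝ) < n := by exact_mod_cast hn
  have hℓ0 : 0 < ℓ := by linarith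
  have htn : 2 * (t : ℝ) ≤ n := by
    have h1 : x ^ 3 ≤ 2 ^ 3 := by gcongr
    have h2 : (2 : ℝ) ^ 6 ≤ (d : ℝ) ^ 6 := by gcongr
    have h3 : x ^ 3 * n ≤ 8 * n := by
      have := mul_le_mul_of_nonneg_right h1 hn0.le
      linarith
    have h4 : 27 * (2 : ℝ) ^ 6 * 0.69 * t ≤ 27 * (d : ℝ) ^ 6 * ℓ * t := by gcongr
    linarith
  -- About half of the factors may be measured, so that at least n/2 remain for the entropy bound.
  set m := ⌈(n : ℝ) / (2 * t)⌉₊ with hm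
  set k := ⌈10 * (d : ℝ) ^ 2 / x⌉₊ with hk
  have hm1 : (n : ℝ) / (2 * t) ≤ m := Nat.le_ceil _
  have hm2 : (m : ℝ) < n / (2 * t) + 1 := Nat.ceil_lt_add_one (by positivity)
  have hk1 : 10 * (d : ℝ) ^ 2 / x ≤ k := Nat.le_ceil _
  have hk2 : (k : ℝ) < 10 * (d : ℝ) ^ 2 / x + 1 := Nat.ceil_lt_add_one (by positivity)
  have hm0 : (0 : ℝ) < m := lt_of_lt_of_le (by positivity) hm1
  have hk0 : (0 : ℝ) < k := lt_of_lt_of_le (by positivity) hk1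
  have hmt : (m : ℝ) * t < n / 2 + t := by
    have h1 := mul_lt_mul_of_pos_right hm2 ht0
    have h2 : (n / (2 * t) + 1) * (t : ℝ) = n / 2 + t := by field_simp
    rwa [h2] at h1
  have hmtn : m * t ≤ n := by
    have : (m : ℝ) * t ≤ n := by linarith
    exact_mod_cast this
  -- The four contributions are at most 0.38 x (defect), 0.01 x (ε), 0.1 x (cell size) and 0.5 x
  -- (change of the cell weights), in total 0.99 x.
  refine ⟨m, k, x / (100 * (d : ℝ) ^ 2), x / (4 * d), Nat.cast_pos.1 hm0, hmtn, Nat.cast_pos.1 hk0,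
    by positivity, by positivity, ?_⟩
  have e1 : (d : ℝ) ^ 2 * (d / Real.sqrt m) ≤ 0.38 * x := by
    have h1 : (d : ℝ) ^ 3 / (0.38 * x) ≤ Real.sqrt m := by
      refine Real.le_sqrt_of_sq_le (le_trans ?_ hm1)
      rw [div_pow, div_le_div_iff₀ (by positivity) (by positivity)]
      have h2 : 0.52 * x * (27 * (d : ℝ) ^ 6 * t) ≤ ℓ * (27 * (d : ℝ) ^ 6 * t) := by gcongr
      have h3 : 0.52 * x * (27 * (d : ℝ) ^ 6 * t) ≤ x * (x ^ 2 * n) := by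
        calc _ ≤ _ := h2
          _ = x ^ 3 * n := by rw [hx3]; ring
          _ = _ := by ring
      have h4 : 0.52 * (27 * (d : ℝ) ^ 6 * t) ≤ x ^ 2 * n := by
        refine le_of_mul_le_mul_left ?_ hx0
        linarith
      have h5 : (0 : ℝ) ≤ (d : ℝ) ^ 6 * t := by positivity
      have h6 : ((d : ℝ) ^ 3) ^ 2 * (2 * t) = 2 * ((d : ℝ) ^ 6 * t) := by ring
      rw [h6]
      have h7 : (n : ℝ) * (0.38 * x) ^ 2 = 0.1444 * (x ^ 2 * n) := by ring
      rw [h7]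
      linarith
    have hs : 0 < Real.sqrt m := Real.sqrt_pos.2 hm0
    rw [div_le_iff₀ (by positivity)] at h1
    rw [mul_div_assoc', div_le_iff₀ hs]
    linarith
  have e2 : (d : ℝ) ^ 2 / k ≤ 0.1 * x := by
    rw [div_le_iff₀ hx0] at hk1
    rw [div_le_iff₀ hk0]
    linarith
  have e3 : (t : ℝ) / (n + t - m * t : ℕ) * (d ^ 2 * Real.log (2 * k + 1))
      ≤ x ^ 2 / (8 * d ^ 2) := by
    have h1 : (t : ℝ) / (n + t - m * t : ℕ) ≤ 2 * t / n := by
      have h2 : (n : ℝ) / 2 ≤ (n + t - m * t : ℕ) := by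
        rw [Nat.cast_sub (by omega)]
        push_cast
        linarith
      calc (t : ℝ) / (n + t - m * t : ℕ) ≤ t / (n / 2) := by gcongr
        _ = 2 * t / n := by field_simp
    have h3 := mul_log_cells_le hd hx0 hx2 hk2.le
    set G := Real.log (2 * k + 1)
    have hG : 0 ≤ G := Real.log_nonneg (by linarith)
    have h4 : 16 * (x * G) ≤ 27 * (d : ℝ) ^ 2 * ℓ := by linarith
    calc (t : ℝ) / (n + t - m * t : ℕ) * (d ^ 2 * G) ≤ 2 * t / n * (d ^ 2 * G) := by gcongr
      _ ≤ x ^ 2 / (8 * d ^ 2) := by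
        rw [div_mul_eq_mul_div, div_le_div_iff₀ hn0 (by positivity)]
        refine le_of_mul_le_mul_left ?_ hx0
        calc x * (2 * t * (d ^ 2 * G) * (8 * d ^ 2))
            = 16 * (x * G) * (d ^ 4 * t) := by ring
          _ ≤ 27 * (d : ℝ) ^ 2 * ℓ * (d ^ 4 * t) := by gcongr
          _ = x ^ 3 * n := by rw [hx3]; ring
          _ = x * (x ^ 2 * n) := by ring
  have e4 : (d : ℝ) * (x / (4 * d) + t / (n + t - m * t : ℕ) * (d ^ 2 * Real.log (2 * k + 1))
      / (2 * (x / (4 * d)))) ≤ 0.5 * x := by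
    calc _ ≤ (d : ℝ) * (x / (4 * d) + x ^ 2 / (8 * d ^ 2) / (2 * (x / (4 * d)))) := by gcongr
      _ = 0.5 * x := by field_simp; norm_num
  have e5 : (d : ℝ) ^ 2 * (x / (100 * (d : ℝ) ^ 2)) = 0.01 * x := by field_simp; norm_num
  rw [mul_add, e5]
  linarith

end Parameters

/-! ### From the mean error to most subsets. -/

section MeanError

/-- Few members of a family exceed the mean by much. -/
theorem card_filter_gt_of_sum_lt {α : Type*} (s : Finset α) (f : α → ℝ) (hf : ∀ a, 0 ≤ f a)
    {η δ : ℝ} (hη : 0 < η) (h : ∑ a ∈ s, f a < s.card * (η * δ)) :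
    (1 - δ) * s.card < (s.filter fun a => f a ≤ η).card := by
  have h1 : ((s.filter fun a => ¬ f a ≤ η).card : ℝ) * η ≤ ∑ a ∈ s, f a := by
    rw [← nsmul_eq_mul]
    refine (Finset.card_nsmul_le_sum _ f η fun a ha => ?_).trans
      (Finset.sum_le_sum_of_subset_of_nonneg (Finset.filter_subset _ _) fun a _ _ => hf a)
    exact (not_le.1 (Finset.mem_filter.1 ha).2).le
  have h2 : ((s.filter fun a => f a ≤ η).card : ℝ) + (s.filter fun a => ¬ f a ≤ η).card
      = s.card := by
    exact_mod_cast Finset.card_filter_add_card_filter_not _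
  have h3 : ((s.filter fun a => ¬ f a ≤ η).card : ℝ) < s.card * δ := by
    refine lt_of_mul_lt_mul_right ?_ hη.le
    linarith
  linarith

theorem theorem2 {n d t : ℕ} (hd : 1 ≤ d) (ht : 1 ≤ t) (htn : t ≤ n)
    {β : Fin n → Type*}
    (Λ : Matrix (Fin d) (Fin d) ℂ →ₗ[ℂ] Matrix (∀ j, β j) (∀ j, β j) ℂ) (hΛ : IsChannel Λ)
    {δ : ℝ} (hδ : 0 < δ) :
    ∃ (K : ℕ) (M : Fin K → Matrix (Fin d) (Fin d) ℂ), IsPOVM M ∧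
      ∃ 𝒮 : Finset (Finset (Fin n)),
        (∀ S ∈ 𝒮, S.card = t) ∧
        (1 - δ) * (n.choose t : ℝ) < (𝒮.card : ℝ) ∧
        ∀ S ∈ 𝒮, ∃ σ : Fin K → Matrix (∀ j : S, β j) (∀ j : S, β j) ℂ,
          (∀ k, IsDensity (σ k)) ∧
          diamondNorm (fun X => partialTrace S (Λ X) - measurePrepare M σ X) ≤
            ENNReal.ofReal
              ((27 * Real.log 2 * (d : ℝ) ^ 6 * Real.logb 2 (d : ℝ) * (t : ℝ) /
                ((n : ℝ) * δ ^ 3)) ^ (1 / 3 : ℝ)) := by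
  have hlog2 : 0 < Real.log 2 := Real.log_pos (by norm_num)
  have hn0 : (0 : ℝ) < n := by exact_mod_cast ht.trans htn
  have hd1 : (1 : ℝ) ≤ d := by exact_mod_cast hd
  have hlog : Real.log 2 * Real.logb 2 d = Real.log d := by
    rw [Real.logb, mul_div_cancel₀ _ hlog2.ne']
  have hlogd : 0 ≤ Real.log d := Real.log_nonneg hd1
  set y : ℝ := 27 * Real.log 2 * (d : ℝ) ^ 6 * Real.logb 2 (d : ℝ) * (t : ℝ) / ((n : ℝ) * δ ^ 3)
    with hy
  have hy' : y * (n * δ ^ 3) = 27 * (d : ℝ) ^ 6 * Real.log d * t := by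
    rw [hy, div_mul_cancel₀ _ (by positivity), ← hlog]; ring
  have hy0 : 0 ≤ y := by
    rw [hy]
    have : 0 ≤ Real.logb 2 d := Real.logb_nonneg (by norm_num) hd1
    positivity
  set η : ℝ := y ^ (1 / 3 : ℝ) with hη
  have hη3 : η ^ 3 = y := by
    rw [hη, ← Real.rpow_natCast, ← Real.rpow_mul hy0]; norm_num
  have hbasis : IsPOVM fun k : Fin d => (Matrix.single k k 1 : Matrix (Fin d) (Fin d) ℂ) := by
    refine ⟨fun k => ?_, ?_⟩
    · have h := Matrix.PosSemidef.diagonal (n := Fin d) (d := Pi.single k (1 : ℂ))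
        (Pi.single_nonneg.2 zero_le_one)
      rwa [Matrix.diagonal_single] at h
    · ext i j
      rw [Matrix.sum_apply, Matrix.one_apply]
      by_cases hij : i = j
      · subst hij
        rw [Finset.sum_eq_single i] <;> simp +contextual
      · rw [if_neg hij]
        refine Finset.sum_eq_zero fun k _ => ?_
        rw [Matrix.single_apply, if_neg]
        rintro ⟨rfl, rfl⟩
        exact hij rfl
  -- If the claimed bound is at least the dephasing error, the standard basis works for every S.
  rcases le_or_gt (2 * (1 - 1 / (d : ℝ))) η with hη1 | hη1
  · refine ⟨d, _, hbasis, Finset.univ.powersetCard t, fun S hS => (Finset.mem_powersetCard.1 hS).2,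
      ?_, fun S _ => ⟨fun k => partialTrace S (Λ (Matrix.single k k 1)), fun k => ?_, ?_⟩⟩
    · rw [Finset.card_powersetCard, Finset.card_univ, Fintype.card_fin]
      have : (0 : ℝ) < n.choose t := Nat.cast_pos.2 (Nat.choose_pos htn)
      nlinarith
    · have h := hΛ.marginal_isChannel S
      refine ⟨h.isCondMap.pos _ (hbasis.1 k), ?_⟩
      have := h.tracePreserving (Matrix.single k k 1)
      rwa [Matrix.trace_single_eq_same] at this
    · exact ((hΛ.marginal_isChannel S).diamondNorm_sub_measure_basis_le (by omega)).trans
        (ENNReal.ofReal_le_ofReal hη1)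
  · rcases lt_or_ge 1 δ with hδ1 | hδ1
    -- For δ > 1 the required fraction is negative, and no subset is needed.
    · refine ⟨d, _, hbasis, ∅, by simp, ?_, by simp⟩
      have : (0 : ℝ) < n.choose t := Nat.cast_pos.2 (Nat.choose_pos htn)
      rw [Finset.card_empty, Nat.cast_zero]
      nlinarith
    · have hη0 : 0 ≤ η := Real.rpow_nonneg hy0 _
      have hd2 : 2 ≤ d := by
        by_contra h
        have : d = 1 := by omega
        rw [this] at hη1
        norm_num at hη1
        linarith
      have hlogd' : 0 < Real.log d := Real.log_pos (by exact_mod_cast hd2)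
      have ht0 : (0 : ℝ) < t := by exact_mod_cast ht
      have hηpos : 0 < η := by
        refine hη0.lt_of_ne fun h => ?_
        rw [← hη3, ← h] at hy'
        have : 0 < 27 * (d : ℝ) ^ 6 * Real.log d * t := by positivity
        rw [← hy'] at this
        norm_num at this
      -- The target for the mean error is ηδ, so that Markov's inequality at the threshold η loses
      -- less than a fraction δ of the subsets.
      obtain ⟨m, k, ε, s, hm, hmt, hk, hε, hs, hlt⟩ := exists_parameters (n := n) (t := t)
        (x := η * δ) hd2 ht (ht.trans htn) (by positivity)
        ((mul_le_of_le_one_right hη0 hδ1).trans_lt hη1)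
        (by rw [← hy', ← hη3]; ring)
      obtain ⟨K, M, hM, err, herr0, herr, hsum⟩ :=
        hΛ.exists_measurement_mean_error_le hd ht hm hmt hk hε hs
      have hC : (0 : ℝ) < n.choose t := Nat.cast_pos.2 (Nat.choose_pos htn)
      have hcard : ((Finset.univ : Finset (Fin n)).powersetCard t).card = n.choose t := by
        rw [Finset.card_powersetCard, Finset.card_univ, Fintype.card_fin]
      have hlarge := card_filter_gt_of_sum_lt (Finset.univ.powersetCard t) err herr0 hηpos (δ := δ)
        (by rw [hcard]; exact hsum.trans_lt (mul_lt_mul_of_pos_left hlt hC))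
      rw [hcard] at hlarge
      refine ⟨K, M, hM, _, fun S hS => ?_, hlarge, fun S hS => ?_⟩
      · exact (Finset.mem_powersetCard.1 (Finset.mem_filter.1 hS).1).2
      · obtain ⟨hS1, hS2⟩ := Finset.mem_filter.1 hS
        obtain ⟨σ, hσ, h⟩ := herr S (Finset.mem_powersetCard.1 hS1).2
        exact ⟨σ, hσ, h.trans (ENNReal.ofReal_le_ofReal hS2)⟩

end MeanError
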